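/- Let $G=(V,E)$ be a finite simple $k$-regular bipartite graph with $|V|\ge 2$. (Edge $k$-colorings of such graphs include the completions of $(n-k)\times n$ Latin rectangles.) An edge $k$-coloring is a map $C:E\to\{1,\dots,k\}$ in which no two adjacent edges have the same color. For any map $A:E\to\{1,\dots,k\}$, a vertex $v$ is deficient if for some colors $c,c'$ there are exactly two $c$-edges at $v$, no $c'$-edge at $v$, and no color other than $c$ occurs twice at $v$; $c$ is the repeated color of $v$. Flipping two colors on a set of edges means interchanging them there. The Markov chain $M(G,k)$ on the edge $k$-colorings of $G$ makes the following step from the current coloring $C$. 1. With probability $\frac12$, do nothing. 2. With probability $\frac14$, select a uniform unordered pair of colors $c,c'$. Let $H$ be the subgraph of all edges of color $c$ or $c'$. With probability $\frac12$ do nothing; with probability $\frac12$ select uniformly a connected subgraph of $H$ with at least one edge and flip $c,c'$ on it. Let $A_1$ be the result. If $A_1$ has deficient vertices, select one uniformly, select uniformly one of its two edges of the repeated color, and change the color of this edge ($c$ to $c'$, $c'$ to $c$). Otherwise, with probability $\frac12$ do this with a uniform edge among all edges of color $c$ or $c'$, and with probability $\frac12$ do nothing. Let $A_2$ be the result. 3.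 With probability $\frac14$, select a uniform set of three colors and, uniformly, a distinguished one $c''$ among them; let $c,c'$ be the others and $H$ the subgraph of all edges of color $c$ or $c'$. With probability $\frac12$ do nothing; with probability $\frac12$ select uniformly a path of $H$ with a positive even number of edges and flip $c,c'$ on it. Let $A_1$ be the result. If $A_1$ has deficient vertices, select one of them, $v$, uniformly and let $\tilde c$ be its repeated color. Otherwise select a vertex $v$ uniformly, select uniformly one of its edges of color $c$ or $c'$, and let $\tilde c$ be the color of this edge. In both cases flip $\tilde c,c''$ on the alternating $\tilde c$-$c''$-cycle through $v$. Let $A_2$ be the result. In cases 2 and 3, finally eliminate the deficiencies of $A_2$, if there are any: at a deficient vertex, selected uniformly, select uniformly one of the two edges of the repeated color and flip $c,c'$ on the maximal alternating $c$-$c'$-path that starts at the vertex with this edge. (If $k$ is too small for the selection of two, or of three, colors, nothing is done in that case.) Write $P(D\mid C)$ for the transition probabilities of $M(G,k)$. A way $w$ from $C$ to $D$ consists of the selected colors (including which one is distinguished) and the intermediate maps $A_1,A_2$; $P(D,w\mid C)$ is the probability that the step from $C$ leads to $D$ via $w$. The inverse way $w'$ from $D$ to $C$ has the same colors and the intermediate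 maps $A_2,A_1$, except when $A_1\ne C$ is itself an edge coloring (a whole cycle was flipped); then $w'$ consists in repeating, from $D$, the same flips in the same order. Then: (a) Every step of positive probability from an edge $k$-coloring leads to an edge $k$-coloring, and the diameter of $M(G,k)$ is at most $3|E|$: from any edge $k$-coloring any other one is reached with positive probability in at most $3|E|$ steps. (b) In the Metropolis–Hastings algorithm with proposal chain $M(G,k)$ and uniform target distribution, the inverse of the acceptance ratio is at most $16|V|(|V|-1)$. That is, for all edge $k$-colorings $C,D$ with $P(D\mid C)>0$, $$\left(\min\left\{1,\frac{P(C\mid D)}{P(D\mid C)}\right\}\right)^{-1}\le 16|V|(|V|-1);$$ and likewise in the variant of the algorithm that works with single ways: for every way $w$ from $C$ to $D$ with $P(D,w\mid C)>0$, the inverse way satisfies $P(C,w'\mid D)>0$ and $(w')'=w$, and $$\left(\min\left\{1,\frac{P(C,w'\mid D)}{P(D,w\mid C)}\right\}\right)^{-1}\le 16|V|(|V|-1).$$ -/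

import Mathlib

open scoped ENNReal

namespace LatinChain

/-! ### Random choices and Markov chains on a finite set -/

section Markov

variable {α β : Type*}

/-- A fair coin. -/
noncomputable def coin : PMF Bool := PMF.uniformOfFintype Bool

open Classical in
/-- Draw `x` uniformly from `s` and continue with `f x`. If there is nothing to draw from,
the result is `d` with probability one. -/
noncomputable def pick [Finite α] (s : Set α) (d : β) (f : α → PMF β) : PMF β :=
  if h : s.Nonempty then
    (PMF.uniformOfFinset s.toFinite.toFinset (s.toFinite.toFinset_nonempty.2 h)).bind f
  else PMF.pure d

/-- The law after `n` steps of the Markov chain with transition probabilities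
`P(y | x) = K x y`. -/
noncomputable def iterate (K : α → PMF α) : ℕ → α → PMF α
  | 0, x => PMF.pure x
  | n + 1, x => (iterate K n x).bind K

/-- The least number of steps in which the chain `K` gets from `x` to `y` with positive
probability (`⊤` if this is impossible). -/
noncomputable def chainDist (K : α → PMF α) (x y : α) : ℕ∞ :=
  ⨅ (n : ℕ) (_ : y ∈ (iterate K n x).support), (n : ℕ∞)

/-- The diameter of the chain `K` on the set of states `S`. -/
noncomputable def chainDiameter (K : α → PMF α) (S : Set α) : ℕ∞ :=
  ⨆ (x ∈ S) (y ∈ S), chainDist K x y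

/-- The Metropolis-Hastings acceptance probability of a proposal `y` made from `x`, for the
target distribution proportional to `g`. -/
noncomputable def acceptance (K : α → PMF α) (g : α → ℝ≥0∞) (x y : α) : ℝ≥0∞ :=
  min 1 (g y * K y x / (g x * K x y))

end Markov

/-! ### Labelings and colorings of the edges -/

section Colorings

variable {V : Type*} {G : SimpleGraph V} {k : ℕ}

/-- All maps from the edges of `G` to the `k` colors. -/
abbrev Labeling (G : SimpleGraph V) (k : ℕ) : Type _ := G.edgeSet → Fin k

/-- Among the edges in `S`, two different ones with a common vertex never have the same color.
For the edge set of a path or of a cycle that only uses two colors this means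
that the colors alternate. -/
def ProperOn (C : Labeling G k) (S : Set (Sym2 V)) : Prop :=
  ∀ e f : G.edgeSet, e.1 ∈ S → f.1 ∈ S → e ≠ f → (∃ v, v ∈ e.1 ∧ v ∈ f.1) → C e ≠ C f

/-- Edge `k`-colorings: no two adjacent edges have the same color. -/
def IsEdgeColoring (C : Labeling G k) : Prop := ProperOn C Set.univ

/-- The number of edges with color `c` that are incident to `v`. -/
noncomputable def colorDegree (C : Labeling G k) (v : V) (c : Fin k) : ℕ :=
  {e : G.edgeSet | v ∈ e.1 ∧ C e = c}.ncard

/-- `v` has a `(+c-c')`-deficiency: exactly two `c`-edges are incident to `v`, all other incident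
edges have pairwise different colors, and there is no incident `c'`-edge. -/
def HasDeficiency (C : Labeling G k) (v : V) (c c' : Fin k) : Prop :=
  colorDegree C v c = 2 ∧ (∀ d, d ≠ c → colorDegree C v d ≤ 1) ∧ colorDegree C v c' = 0

/-- `v` is a deficient vertex of `C`. -/
def IsDeficient (C : Labeling G k) (v : V) : Prop := ∃ c c', HasDeficiency C v c c'

/-- The edges at `v` whose color occurs at least twice at `v`. -/
def repeatedEdges (C : Labeling G k) (v : V) : Set G.edgeSet :=
  {e | v ∈ e.1 ∧ ∃ f : G.edgeSet, f ≠ e ∧ v ∈ f.1 ∧ C f = C e}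

/-- The subgraph of `G` formed by the edges of color `c` or `c'`. -/
def twoColor (C : Labeling G k) (c c' : Fin k) : SimpleGraph V :=
  SimpleGraph.fromEdgeSet {e | ∃ h : e ∈ G.edgeSet, C ⟨e, h⟩ = c ∨ C ⟨e, h⟩ = c'}

open Classical in
/-- Interchange the colors `c` and `c'` on the edges in `S`. -/
noncomputable def flip (c c' : Fin k) (S : Set (Sym2 V)) (C : Labeling G k) : Labeling G k :=
  fun e => if e.1 ∈ S then Equiv.swap c c' (C e) else C e

/-- The connected subgraphs (with at least one edge) of the subgraph formed by the colors
`c` and `c'`, as sets of edges. -/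
def connectedPieces (C : Labeling G k) (c c' : Fin k) : Set (Set (Sym2 V)) :=
  {S | ∃ K : (twoColor C c c').Subgraph, K.Connected ∧ K.edgeSet.Nonempty ∧ K.edgeSet = S}

/-- The paths with a positive even number of edges in the subgraph formed by the colors
`c` and `c'`, as sets of edges. -/
def evenPaths (C : Labeling G k) (c c' : Fin k) : Set (Set (Sym2 V)) :=
  {S | ∃ (u v : V) (p : (twoColor C c c').Walk u v),
    p.IsPath ∧ 0 < p.length ∧ Even p.length ∧ p.edgeSet = S}

/-- The edges of the maximal path with alternating colors `c` and `c'` that starts in `v` with the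
edge `e` (the union of all alternating paths which start in this way). -/
def altPath (C : Labeling G k) (c c' : Fin k) (v : V) (e : G.edgeSet) : Set (Sym2 V) :=
  {g | ∃ (w : V) (p : (twoColor C c c').Walk v w),
    p.IsPath ∧ ProperOn C p.edgeSet ∧ e.1 ∈ p.edgeSet ∧ g ∈ p.edgeSet}

/-- The edges of the cycle with alternating colors `a` and `b` that contains `v`. -/
def altCycle (C : Labeling G k) (a b : Fin k) (v : V) : Set (Sym2 V) :=
  {g | ∃ p : (twoColor C a b).Walk v v, p.IsCycle ∧ ProperOn C p.edgeSet ∧ g ∈ p.edgeSet}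

end Colorings

/-! ### The Markov chain -/

section Chain

/-- The possible selections of colors: none, an unordered pair of colors (listed increasingly),
or three colors, of which the last one is distinguished (the other two are listed increasingly). -/
inductive Choice (k : ℕ) : Type
  | stay : Choice k
  | two (c c' : Fin k) : Choice k
  | three (c c' c'' : Fin k) : Choice k

/-- With probability `1/2` no color is selected, with probability `1/4` a uniform pair, and with
probability `1/4` a uniform triple together with a uniform distinguished member. If there are not
enough colors for a selection, none is made. -/
noncomputable def selectColors (k : ℕ) : PMF (Choice k) :=
  coin.bind fun b => if b then PMF.pure .stay else
    coin.bind fun b' => if b' then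
      pick {q : Fin k × Fin k | q.1 < q.2} .stay fun q => PMF.pure (.two q.1 q.2)
    else
      pick {q : Fin k × Fin k × Fin k | q.1 < q.2.1 ∧ q.2.2 ≠ q.1 ∧ q.2.2 ≠ q.2.1} .stay
        fun q => PMF.pure (.three q.1 q.2.1 q.2.2)

variable {V : Type*} [Finite V] {G : SimpleGraph V} {k : ℕ}

/-- First phase: with probability `1/2` nothing is done; with probability `1/2` a uniform connected
subgraph (for two colors) or a uniform path of even length (for three colors) is drawn in the
subgraph of the two non-distinguished colors, and these colors are flipped on it. -/
noncomputable def create : Choice k → Labeling G k → PMF (Labeling G k)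
  | .stay, C => PMF.pure C
  | .two c c', C => coin.bind fun b => if b then PMF.pure C else
      pick (connectedPieces C c c') C fun S => PMF.pure (flip c c' S C)
  | .three c c' _, C => coin.bind fun b => if b then PMF.pure C else
      pick (evenPaths C c c') C fun S => PMF.pure (flip c c' S C)

open Classical in
/-- Second phase. Two colors: if there is a deficient vertex, a uniform one is selected, and one of
its edges of the repeated color changes its color to the other selected color; otherwise, with
probability `1/2` a uniform edge among those of the two colors does so, and with probability `1/2`
nothing happens. Three colors: a uniform deficient vertex, or a uniform vertex
if there is no deficient one, is selected; `a` is the repeated color at this vertex, or the color of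
one of its `c`- and `c'`-edges, drawn uniformly; the alternating cycle through the vertex with
the colors `a` and `c''` is flipped. -/
noncomputable def perturb : Choice k → Labeling G k → PMF (Labeling G k)
  | .stay, A => PMF.pure A
  | .two c c', A =>
      if ∃ v, IsDeficient A v then
        pick {v | IsDeficient A v} A fun v =>
          pick (repeatedEdges A v) A fun e => PMF.pure (flip c c' {e.1} A)
      else
        coin.bind fun b => if b then PMF.pure A else
          pick {e : G.edgeSet | A e = c ∨ A e = c'} A fun e => PMF.pure (flip c c' {e.1} A)
  | .three c c' c'', A =>
      if ∃ v, IsDeficient A v then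
        pick {v | IsDeficient A v} A fun v =>
          let a : Fin k := if colorDegree A v c = 2 then c else c'
          PMF.pure (flip a c'' (altCycle A a c'' v) A)
      else
        pick {v | ¬ IsDeficient A v} A fun v =>
          pick {f : G.edgeSet | v ∈ f.1 ∧ (A f = c ∨ A f = c')} A fun f =>
            PMF.pure (flip (A f) c'' (altCycle A (A f) c'' v) A)

/-- Elimination of the deficiencies in the colors `c` and `c'`: at a deficient vertex an edge of the
repeated color is drawn uniformly, and the maximal alternating path that starts with it
is flipped. If no vertex is deficient, nothing happens. -/
noncomputable def eliminateColors (c c' : Fin k) (A : Labeling G k) : PMF (Labeling G k) :=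
  pick {v | IsDeficient A v} A fun v =>
    pick (repeatedEdges A v) A fun e => PMF.pure (flip c c' (altPath A c c' v e) A)

/-- Third phase: all deficiencies are eliminated. -/
noncomputable def eliminate : Choice k → Labeling G k → PMF (Labeling G k)
  | .stay, A => PMF.pure A
  | .two c c', A => eliminateColors c c' A
  | .three c c' _, A => eliminateColors c c' A

/-- One step of the Markov chain `M(G,k)` from the current coloring `C`. -/
noncomputable def step (C : Labeling G k) : PMF (Labeling G k) :=
  (selectColors k).bind fun s =>
    (create s C).bind fun A₁ => (perturb s A₁).bind fun A₂ => eliminate s A₂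

/-! ### Ways of making a step -/

/-- A way to make a step: the selected colors, the labeling after the first phase and the labeling
after the second phase. -/
structure Way (G : SimpleGraph V) (k : ℕ) where
  colors : Choice k
  first : Labeling G k
  second : Labeling G k

/-- `P(D, w | C)`: the probability that `D` is proposed from `C` via the way `w`. -/
noncomputable def wayProb (C : Labeling G k) (w : Way G k) (D : Labeling G k) : ℝ≥0∞ :=
  selectColors k w.colors * create w.colors C w.first * perturb w.colors w.first w.second *
    eliminate w.colors w.second D

/-- On each edge where `C` and `A` differ, interchange in `D` the colors that this
edge has in `C` and in `A`. -/
def redo (C A D : Labeling G k) : Labeling G k := fun e => Equiv.swap (C e) (A e) (D e)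

open Classical in
/-- The inverse of the way `w` from `C` to `D`. It runs through the same labelings in reverse order,
with the same colors. The exception is a way whose first phase flips whole cycles and so
leads to another edge coloring: it is undone by repeating the same flips. -/
noncomputable def inverseWay (C : Labeling G k) (w : Way G k) (D : Labeling G k) : Way G k :=
  if w.first ≠ C ∧ IsEdgeColoring w.first then
    ⟨w.colors, redo C w.first D, redo w.first w.second (redo C w.first D)⟩
  else ⟨w.colors, w.second, w.first⟩

/-- The acceptance probability of `D`, proposed from `C` via the way `w`, for the target
distribution proportional to `g`, in the variant of the Metropolis-Hastings algorithm
that uses the probabilities of the single ways. -/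
noncomputable def wayAcceptance (g : Labeling G k → ℝ≥0∞) (C : Labeling G k) (w : Way G k)
    (D : Labeling G k) : ℝ≥0∞ :=
  min 1 (g D * wayProb D (inverseWay C w D) C / (g C * wayProb C w D))

end Chain

end LatinChain

/-!
In an edge coloring of a `k`-regular graph with `k` colors every color occurs exactly once at every
vertex. Hence for two selected colors `c` and `d` the edges of these colors form a 2-regular graph,
and this remains so (`Balanced.flip`) while `c` and `d` are interchanged on arbitrary sets of
edges: a vertex is deficient if its two edges in this graph have the same color, and a flip on `S`
changes the deficiency exactly at the boundary of `S`, the vertices at which `S` contains one of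
the two edges (`Balanced.isDeficient_flip`). A connected subgraph of a 2-regular graph is a union
of whole components, without boundary, or a path, whose boundary consists of its ends. So the first
phase of a step leads to an edge coloring or creates exactly two deficient vertices, the change of
an edge moves a deficiency along this edge or removes both (`TwoDeficient.flip_singleton`), and the
elimination has to flip a path between the two deficient vertices.

The existence of the alternating paths and cycles along which colors are flipped is a consequence
of bipartiteness. If edges get weights, and vertices the signs of the two classes, then the signed
sum over the vertices of the weights of their edges vanishes, even within one component of a
subgraph that carries the weights (`sum_sign_mul_incidentSum_component`). With weight `1` for one
color and `-1` for the other, this forces the two deficient vertices to be joined by paths with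
either first edge (`TwoDeficient.reachable_deleteEdges`), and it gives the existence and the
uniqueness of the alternating cycle that is flipped for three colors
(`CycleBase.isAltCycle_altCycle`). The latter needs the two deficient vertices to be in the same
class, which is why the paths are even there.

For the acceptance ratio, each phase of a way is compared with the phase of the inverse way that
undoes it. Every elimination that is possible has a probability of at least `1/4`. Writing `n` for
the number of vertices, there are at most `2n(n-1)` paths, since a path is determined by its ends
and its first edge, at most `n` components, and at most `n(n-1)` edges. In each of the cases the
product of the three ratios is at most `16n(n-1)` (`wayBound_of_ne_zero`). The transition
probability is the sum over the ways, and taking inverses is injective, so the same bound holds for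
it (`step_le_mul_of_wayBound`).

For the diameter, the colors of the target are put in place one after the other, in at most three
steps for each edge (`canReach_of_missing_le`). Deficiencies eliminated at the end of a step can be
created again by the first phase of the next step, so that it suffices to follow the labelings
between the first and the third phase. Suppose that an edge should get the color `c`. If it has the
color `d` that is selected together with `c`, then it changes its color to `c`, and afterwards the
other edge of color `c` at its end changes to `d`. This either leads to an edge coloring, or leaves
two deficient vertices, at one of which `c` is missing. The next edge to be corrected is the target
edge of color `c` at this vertex; if its color is neither `c` nor `d`, then an alternating cycle is
flipped first to give it the color `d`. These flips do not affect the colors already in place.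
-/

namespace LatinChain

/-! ### Color degrees and two-colored edges -/

section Basic

variable {V : Type*} {G : SimpleGraph V} {k : ℕ}

theorem flip_apply_mem {c d : Fin k} {S : Set (Sym2 V)} {A : Labeling G k} {e : G.edgeSet}
    (h : e.1 ∈ S) : flip c d S A e = Equiv.swap c d (A e) := by
  simp [flip, h]

theorem flip_apply_notMem {c d : Fin k} {S : Set (Sym2 V)} {A : Labeling G k} {e : G.edgeSet}
    (h : e.1 ∉ S) : flip c d S A e = A e := by
  simp [flip, h]

theorem flip_comm_colors (c d : Fin k) (S : Set (Sym2 V)) (A : Labeling G k) :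
    flip c d S A = flip d c S A := by
  funext e
  simp [flip, Equiv.swap_comm c d]

theorem flip_flip (c d : Fin k) (S : Set (Sym2 V)) (A : Labeling G k) :
    flip c d S (flip c d S A) = A := by
  funext e
  by_cases h : e.1 ∈ S
  · simp [flip_apply_mem h]
  · simp [flip_apply_notMem h]

theorem flip_flip_comm (c d : Fin k) (S T : Set (Sym2 V)) (A : Labeling G k) :
    flip c d S (flip c d T A) = flip c d T (flip c d S A) := by
  funext e
  by_cases h : e.1 ∈ S <;> by_cases h' : e.1 ∈ T <;> simp [flip, h, h']

theorem swap_eq_or_iff {c d x : Fin k} :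
    (Equiv.swap c d x = c ∨ Equiv.swap c d x = d) ↔ (x = c ∨ x = d) := by
  rw [Equiv.swap_apply_eq_iff, Equiv.swap_apply_eq_iff, Equiv.swap_apply_left,
    Equiv.swap_apply_right, or_comm]

theorem flip_eq_or_iff {c d : Fin k} {S : Set (Sym2 V)} {A : Labeling G k} {e : G.edgeSet} :
    (flip c d S A e = c ∨ flip c d S A e = d) ↔ (A e = c ∨ A e = d) := by
  by_cases h : e.1 ∈ S
  · rw [flip_apply_mem h, swap_eq_or_iff]
  · rw [flip_apply_notMem h]

theorem flip_eq_iff_of_ne {c d f : Fin k} (hc : f ≠ c) (hd : f ≠ d) {S : Set (Sym2 V)}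
    {A : Labeling G k} {e : G.edgeSet} : flip c d S A e = f ↔ A e = f := by
  by_cases h : e.1 ∈ S
  · rw [flip_apply_mem h, Equiv.swap_apply_eq_iff, Equiv.swap_apply_of_ne_of_ne hc hd]
  · rw [flip_apply_notMem h]

theorem mem_twoColor {A : Labeling G k} {c d : Fin k} (e : G.edgeSet) :
    e.1 ∈ (twoColor A c d).edgeSet ↔ A e = c ∨ A e = d := by
  have := G.not_isDiag_of_mem_edgeSet e.2
  simp [twoColor, SimpleGraph.edgeSet_fromEdgeSet, this]

theorem exists_of_mem_twoColor {A : Labeling G k} {c d : Fin k} {e : Sym2 V}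
    (h : e ∈ (twoColor A c d).edgeSet) : ∃ h : e ∈ G.edgeSet, A ⟨e, h⟩ = c ∨ A ⟨e, h⟩ = d := by
  simp only [twoColor, SimpleGraph.edgeSet_fromEdgeSet] at h
  exact h.1

theorem twoColor_le (A : Labeling G k) (c d : Fin k) : twoColor A c d ≤ G := by
  rw [← SimpleGraph.edgeSet_subset_edgeSet]
  intro e he
  exact (exists_of_mem_twoColor he).1

theorem twoColor_flip (A : Labeling G k) (c d : Fin k) (S : Set (Sym2 V)) :
    twoColor (flip c d S A) c d = twoColor A c d := by
  simp only [twoColor, flip_eq_or_iff]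

theorem twoColor_comm (A : Labeling G k) (c d : Fin k) : twoColor A c d = twoColor A d c := by
  simp only [twoColor, or_comm]

theorem flip_apply_ne_iff {c d : Fin k} (hcd : c ≠ d) {S : Set (Sym2 V)} {A : Labeling G k}
    (hS : S ⊆ (twoColor A c d).edgeSet) (e : G.edgeSet) : flip c d S A e ≠ A e ↔ e.1 ∈ S := by
  by_cases h : e.1 ∈ S
  · rw [flip_apply_mem h]
    simp only [h, iff_true]
    rcases (mem_twoColor e).1 (hS h) with h | h <;> simp [h, hcd, hcd.symm]
  · simp [flip_apply_notMem h, h]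

/-- A set of edges of the two colors can be read off from the labeling after its flip. -/
theorem eq_of_flip_eq {c d : Fin k} (hcd : c ≠ d) {S T : Set (Sym2 V)} {A : Labeling G k}
    (hS : S ⊆ (twoColor A c d).edgeSet) (hT : T ⊆ (twoColor A c d).edgeSet)
    (h : flip c d S A = flip c d T A) : S = T := by
  ext e
  constructor
  · intro he
    obtain ⟨he', -⟩ := exists_of_mem_twoColor (hS he)
    exact (flip_apply_ne_iff hcd hT ⟨e, he'⟩).1 (h ▸ (flip_apply_ne_iff hcd hS ⟨e, he'⟩).2 he)
  · intro he
    obtain ⟨he', -⟩ := exists_of_mem_twoColor (hT he)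
    exact (flip_apply_ne_iff hcd hS ⟨e, he'⟩).1 (h ▸ (flip_apply_ne_iff hcd hT ⟨e, he'⟩).2 he)

theorem flip_ne_self {c d : Fin k} (hcd : c ≠ d) {S : Set (Sym2 V)} {A : Labeling G k}
    (hS : S ⊆ (twoColor A c d).edgeSet) (hne : S.Nonempty) : flip c d S A ≠ A := by
  obtain ⟨e, he⟩ := hne
  obtain ⟨he', -⟩ := exists_of_mem_twoColor (hS he)
  intro h
  exact (flip_apply_ne_iff hcd hS ⟨e, he'⟩).2 he (congrFun h _)

theorem colorDegree_eq_one_iff {A : Labeling G k} {v : V} {c : Fin k} :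
    colorDegree A v c = 1 ↔ ∃! e : G.edgeSet, v ∈ e.1 ∧ A e = c := by
  rw [colorDegree, Set.ncard_eq_one]
  constructor
  · rintro ⟨a, ha⟩
    have : ∀ e : G.edgeSet, (v ∈ e.1 ∧ A e = c) ↔ e = a := fun e => by
      simpa using Set.ext_iff.1 ha e
    exact ⟨a, (this a).2 rfl, fun e he => (this e).1 he⟩
  · rintro ⟨a, ha, h⟩
    exact ⟨a, Set.ext fun e => ⟨fun he => h e he, fun he => by rw [he]; exact ha⟩⟩

theorem colorDegree_flip_of_ne {c d f : Fin k} (hc : f ≠ c) (hd : f ≠ d) (S : Set (Sym2 V))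
    (A : Labeling G k) (v : V) : colorDegree (flip c d S A) v f = colorDegree A v f := by
  simp only [colorDegree, flip_eq_iff_of_ne hc hd]

variable [Finite V]

theorem colorDegree_eq_zero_iff {A : Labeling G k} {v : V} {c : Fin k} :
    colorDegree A v c = 0 ↔ ∀ e : G.edgeSet, v ∈ e.1 → A e ≠ c := by
  rw [colorDegree, Set.ncard_eq_zero]
  simp [Set.ext_iff]

theorem colorDegree_le_one_iff {A : Labeling G k} {v : V} {c : Fin k} :
    colorDegree A v c ≤ 1 ↔
      ∀ e f : G.edgeSet, v ∈ e.1 → v ∈ f.1 → A e = c → A f = c → e = f := by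
  rw [colorDegree, Set.ncard_le_one]
  simp only [Set.mem_ofPred_eq]
  exact ⟨fun h e f he hf hec hfc => h e ⟨he, hec⟩ f ⟨hf, hfc⟩,
    fun h e he f hf => h e f he.1 hf.1 he.2 hf.2⟩

theorem colorDegree_add {c d : Fin k} (hcd : c ≠ d) (A : Labeling G k) (v : V) :
    colorDegree A v c + colorDegree A v d =
      {e : G.edgeSet | v ∈ e.1 ∧ (A e = c ∨ A e = d)}.ncard := by
  rw [colorDegree, colorDegree, ← Set.ncard_union_eq]
  · congr 1
    ext e
    simp only [Set.mem_union, Set.mem_ofPred_eq]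
    tauto
  · rw [Set.disjoint_left]
    rintro e ⟨_, h⟩ ⟨_, h'⟩
    exact hcd (h.symm.trans h')

theorem isEdgeColoring_iff {A : Labeling G k} :
    IsEdgeColoring A ↔ ∀ v c, colorDegree A v c ≤ 1 := by
  simp only [colorDegree_le_one_iff]
  constructor
  · intro h v c e f he hf hec hfc
    by_contra hne
    exact h e f trivial trivial hne ⟨v, he, hf⟩ (hec.trans hfc.symm)
  · rintro h e f - - hne ⟨v, he, hf⟩ hc
    exact hne (h v _ e f he hf rfl hc.symm)

/-- In an edge coloring with as many colors as there are edges at each vertex, every color occurs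
exactly once at each vertex. -/
theorem IsEdgeColoring.colorDegree_eq_one {C : Labeling G k}
    (hreg : ∀ v, {e : G.edgeSet | v ∈ e.1}.ncard = k) (hC : IsEdgeColoring C) (v : V)
    (c : Fin k) : colorDegree C v c = 1 := by
  have hle := isEdgeColoring_iff.1 hC
  have hsurj : ∃ e : {e : G.edgeSet | v ∈ e.1}, C e = c := by
    have hinj : Function.Injective fun e : {e : G.edgeSet | v ∈ e.1} => C e := fun e f h =>
      Subtype.ext (colorDegree_le_one_iff.1 (hle v (C f)) e f e.2 f.2 h rfl)
    have hcard : Nat.card {e : G.edgeSet | v ∈ e.1} = Nat.card (Fin k) := by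
      rw [Nat.card_coe_set_eq, hreg, Nat.card_fin]
    exact ((Nat.bijective_iff_injective_and_card _).2 ⟨hinj, hcard⟩).2 c
  obtain ⟨⟨e, he⟩, hec⟩ := hsurj
  have : colorDegree C v c ≠ 0 := fun h => colorDegree_eq_zero_iff.1 h e he hec
  have := hle v c
  omega

end Basic

/-! ### Balanced labelings and their deficient vertices -/

section Balanced

variable {V : Type*} {G : SimpleGraph V} {k : ℕ} {A C : Labeling G k} {c d : Fin k} {v : V}
  {e₁ e₂ : G.edgeSet} {S T : Set (Sym2 V)}

/-- `e₁` and `e₂` are distinct, and they are the edges at `v` with color `c` or `d`. -/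
def IsPair (A : Labeling G k) (c d : Fin k) (v : V) (e₁ e₂ : G.edgeSet) : Prop :=
  e₁ ≠ e₂ ∧ ∀ e : G.edgeSet, (v ∈ e.1 ∧ (A e = c ∨ A e = d)) ↔ (e = e₁ ∨ e = e₂)

/-- A labeling is balanced for the colors `c` and `d` if every vertex has two edges with one of
these colors, and one edge of each other color. These are the labelings that arise in the step
with selected colors `c` and `d`; the edges of color `c` or `d` form a 2-regular graph. -/
structure Balanced (c d : Fin k) (A : Labeling G k) : Prop where
  ne : c ≠ d
  pair : ∀ v, colorDegree A v c + colorDegree A v d = 2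
  other : ∀ v f, f ≠ c → f ≠ d → colorDegree A v f = 1

/-- The vertices at which `S` contains exactly one of the two edges of color `c` or `d`. -/
def IsBoundary (A : Labeling G k) (c d : Fin k) (S : Set (Sym2 V)) (v : V) : Prop :=
  ∃ e f : G.edgeSet, v ∈ e.1 ∧ v ∈ f.1 ∧ (A e = c ∨ A e = d) ∧ (A f = c ∨ A f = d) ∧
    e.1 ∈ S ∧ f.1 ∉ S

theorem IsPair.symm (h : IsPair A c d v e₁ e₂) : IsPair A c d v e₂ e₁ :=
  ⟨h.1.symm, fun e => (h.2 e).trans or_comm⟩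

theorem IsPair.left (h : IsPair A c d v e₁ e₂) : v ∈ e₁.1 ∧ (A e₁ = c ∨ A e₁ = d) :=
  (h.2 e₁).2 (Or.inl rfl)

theorem IsPair.right (h : IsPair A c d v e₁ e₂) : v ∈ e₂.1 ∧ (A e₂ = c ∨ A e₂ = d) :=
  (h.2 e₂).2 (Or.inr rfl)

theorem IsPair.swap_colors (h : IsPair A c d v e₁ e₂) : IsPair A d c v e₁ e₂ :=
  ⟨h.1, fun e => by rw [← h.2 e, or_comm (a := A e = d)]⟩

theorem isPair_flip_iff : IsPair (flip c d S A) c d v e₁ e₂ ↔ IsPair A c d v e₁ e₂ := by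
  simp only [IsPair, flip_eq_or_iff]

theorem isBoundary_flip_iff :
    IsBoundary (flip c d T A) c d S v ↔ IsBoundary A c d S v := by
  simp only [IsBoundary, flip_eq_or_iff]

theorem IsPair.isBoundary_iff (h : IsPair A c d v e₁ e₂) :
    IsBoundary A c d S v ↔ (e₁.1 ∈ S ↔ e₂.1 ∉ S) := by
  constructor
  · rintro ⟨e, f, he, hf, hec, hfc, heS, hfS⟩
    rcases (h.2 e).1 ⟨he, hec⟩ with rfl | rfl <;> rcases (h.2 f).1 ⟨hf, hfc⟩ with rfl | rfl <;>
      tauto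
  · intro hS
    by_cases h1 : e₁.1 ∈ S
    · exact ⟨e₁, e₂, h.left.1, h.right.1, h.left.2, h.right.2, h1, hS.1 h1⟩
    · exact ⟨e₂, e₁, h.right.1, h.left.1, h.right.2, h.left.2, by tauto, h1⟩

theorem Balanced.symm (h : Balanced c d A) : Balanced d c A :=
  ⟨h.ne.symm, fun v => by rw [add_comm, h.pair v], fun v f hd hc => h.other v f hc hd⟩

theorem Balanced.isDeficient_iff (h : Balanced c d A) :
    IsDeficient A v ↔ colorDegree A v c ≠ 1 := by
  have hp := h.pair v
  constructor
  · rintro ⟨a, b, h1, h2, h3⟩ hc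
    have hd : colorDegree A v d = 1 := by omega
    have : colorDegree A v a = 1 := by
      by_cases hac : a = c
      · rw [hac, hc]
      by_cases had : a = d
      · rw [had, hd]
      · exact h.other v a hac had
    omega
  · intro hne
    have : colorDegree A v c = 2 ∨ colorDegree A v c = 0 := by omega
    rcases this with h2 | h0
    · refine ⟨c, d, h2, fun f hf => ?_, by omega⟩
      by_cases hfd : f = d
      · rw [hfd]; omega
      · exact (h.other v f hf hfd).le
    · refine ⟨d, c, by omega, fun f hf => ?_, h0⟩
      by_cases hfc : f = c
      · rw [hfc]; omega
      · exact (h.other v f hfc hf).le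

/-- The labeling is balanced for `c` and `d`, and its deficient vertices are `x` and `y`. -/
structure TwoDeficient (c d : Fin k) (A : Labeling G k) (x y : V) : Prop
    extends Balanced c d A where
  ne_vertex : x ≠ y
  deficient_iff : ∀ v, IsDeficient A v ↔ v = x ∨ v = y

theorem TwoDeficient.symm_vertex {x y : V} (h : TwoDeficient c d A x y) :
    TwoDeficient c d A y x :=
  ⟨h.toBalanced, h.ne_vertex.symm, fun v => (h.deficient_iff v).trans or_comm⟩

theorem TwoDeficient.symm_colors {x y : V} (h : TwoDeficient c d A x y) :
    TwoDeficient d c A x y :=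
  ⟨h.toBalanced.symm, h.ne_vertex, h.deficient_iff⟩

variable [Finite V]

theorem Balanced.exists_isPair (h : Balanced c d A) (v : V) : ∃ e₁ e₂, IsPair A c d v e₁ e₂ := by
  have h2 := h.pair v
  rw [colorDegree_add h.ne, Set.ncard_eq_two] at h2
  obtain ⟨e₁, e₂, hne, hs⟩ := h2
  exact ⟨e₁, e₂, hne, fun e => by simpa using Set.ext_iff.1 hs e⟩

theorem Balanced.exists_isPair_left (h : Balanced c d A) {e : G.edgeSet} (hv : v ∈ e.1)
    (he : A e = c ∨ A e = d) : ∃ e', IsPair A c d v e e' := by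
  obtain ⟨e₁, e₂, hp⟩ := h.exists_isPair v
  rcases (hp.2 e).1 ⟨hv, he⟩ with rfl | rfl
  · exact ⟨_, hp⟩
  · exact ⟨_, hp.symm⟩

theorem Balanced.flip (h : Balanced c d A) (S : Set (Sym2 V)) : Balanced c d (flip c d S A) := by
  refine ⟨h.ne, fun v => ?_, fun v f hc hd => by
    rw [colorDegree_flip_of_ne hc hd, h.other v f hc hd]⟩
  rw [← h.pair v, colorDegree_add h.ne, colorDegree_add h.ne]
  simp only [flip_eq_or_iff]

theorem IsPair.colorDegree_eq_two_iff (h : IsPair A c d v e₁ e₂) :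
    colorDegree A v c = 2 ↔ A e₁ = c ∧ A e₂ = c := by
  have hsub : {e : G.edgeSet | v ∈ e.1 ∧ A e = c} ⊆ {e₁, e₂} := fun e he => by
    simpa using (h.2 e).1 ⟨he.1, Or.inl he.2⟩
  have hcard : ({e₁, e₂} : Set G.edgeSet).ncard = 2 := Set.ncard_pair h.1
  constructor
  · intro h2
    have heq := Set.eq_of_subset_of_ncard_le hsub (by rw [hcard]; exact h2.ge)
    have h1 : e₁ ∈ {e : G.edgeSet | v ∈ e.1 ∧ A e = c} := by rw [heq]; simp
    have h2 : e₂ ∈ {e : G.edgeSet | v ∈ e.1 ∧ A e = c} := by rw [heq]; simp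
    exact ⟨h1.2, h2.2⟩
  · rintro ⟨h1, h2⟩
    rw [← hcard, colorDegree]
    congr 1
    refine hsub.antisymm ?_
    rintro e (rfl | rfl)
    · exact ⟨h.left.1, h1⟩
    · exact ⟨h.right.1, h2⟩

/-- A vertex is deficient if its two edges in the selected colors have the same color. -/
theorem Balanced.isDeficient_iff_of_isPair (h : Balanced c d A) (hp : IsPair A c d v e₁ e₂) :
    IsDeficient A v ↔ A e₁ = A e₂ := by
  have h2 := hp.colorDegree_eq_two_iff
  have h2' := hp.swap_colors.colorDegree_eq_two_iff
  have hpair := h.pair v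
  have : IsDeficient A v ↔ colorDegree A v c = 2 ∨ colorDegree A v d = 2 := by
    rw [h.isDeficient_iff]
    omega
  rw [this, h2, h2']
  have := h.ne
  rcases hp.left.2 with h1 | h1 <;> rcases hp.right.2 with h3 | h3 <;>
    simp [h1, h3, this, this.symm]

/-- Flipping the two colors on `S` changes the deficiency exactly at the boundary of `S`. -/
theorem Balanced.isDeficient_flip (h : Balanced c d A) :
    IsDeficient (LatinChain.flip c d S A) v ↔ ¬(IsDeficient A v ↔ IsBoundary A c d S v) := by
  obtain ⟨e₁, e₂, hp⟩ := h.exists_isPair v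
  rw [(h.flip S).isDeficient_iff_of_isPair (isPair_flip_iff.2 hp), h.isDeficient_iff_of_isPair hp,
    hp.isBoundary_iff]
  have hne := h.ne
  have hne' := h.ne.symm
  by_cases h1 : e₁.1 ∈ S <;> by_cases h2 : e₂.1 ∈ S <;>
  rcases hp.left.2 with h3 | h3 <;> rcases hp.right.2 with h4 | h4 <;>
    simp [flip_apply_mem, flip_apply_notMem, h1, h2, h3, h4, hne, hne']

theorem Balanced.isEdgeColoring_iff (h : Balanced c d A) :
    IsEdgeColoring A ↔ ∀ v, ¬ IsDeficient A v := by
  rw [LatinChain.isEdgeColoring_iff]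
  constructor
  · rintro hA v ⟨a, b, h2, -⟩
    have := hA v a
    omega
  · intro hA v f
    have h1 := hA v
    rw [h.isDeficient_iff, not_not] at h1
    have := h.pair v
    by_cases hfc : f = c
    · rw [hfc]; omega
    by_cases hfd : f = d
    · rw [hfd]; omega
    · exact (h.other v f hfc hfd).le

theorem IsEdgeColoring.balanced (hreg : ∀ v, {e : G.edgeSet | v ∈ e.1}.ncard = k)
    (hC : IsEdgeColoring C) (hcd : c ≠ d) : Balanced c d C := by
  have h1 := hC.colorDegree_eq_one hreg
  exact ⟨hcd, fun v => by rw [h1, h1], fun v f _ _ => h1 v f⟩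

theorem IsEdgeColoring.not_isDeficient (hC : IsEdgeColoring C) (v : V) : ¬ IsDeficient C v := by
  rintro ⟨a, b, h2, -⟩
  have := isEdgeColoring_iff.1 hC v a
  omega

/-- At a deficient vertex the edges of the repeated color are the edges of the two colors. -/
theorem Balanced.mem_repeatedEdges_iff (h : Balanced c d A) (hv : IsDeficient A v)
    {e : G.edgeSet} : e ∈ repeatedEdges A v ↔ v ∈ e.1 ∧ (A e = c ∨ A e = d) := by
  constructor
  · rintro ⟨hve, f, hfe, hvf, hc⟩
    refine ⟨hve, ?_⟩
    by_contra hne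
    push Not at hne
    have := h.other v (A e) hne.1 hne.2
    exact hfe (colorDegree_le_one_iff.1 this.le f e hvf hve hc rfl)
  · rintro ⟨hve, hc⟩
    obtain ⟨e', hp⟩ := h.exists_isPair_left hve hc
    exact ⟨hve, e', hp.1.symm, hp.right.1, ((h.isDeficient_iff_of_isPair hp).1 hv).symm⟩

theorem Balanced.repeatedEdges_eq (h : Balanced c d A) (hv : IsDeficient A v)
    (hp : IsPair A c d v e₁ e₂) : repeatedEdges A v = {e₁, e₂} := by
  ext e
  rw [h.mem_repeatedEdges_iff hv, hp.2]
  simp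

theorem TwoDeficient.not_isEdgeColoring {x y : V} (h : TwoDeficient c d A x y) :
    ¬ IsEdgeColoring A :=
  fun hA => hA.not_isDeficient x ((h.deficient_iff x).2 (Or.inl rfl))

theorem isBoundary_singleton_iff (h : Balanced c d A) {e : G.edgeSet} (he : A e = c ∨ A e = d) :
    IsBoundary A c d {e.1} v ↔ v ∈ e.1 := by
  constructor
  · rintro ⟨e', f, he', -, -, -, h1, -⟩
    rw [Set.mem_singleton_iff] at h1
    rwa [← h1]
  · intro hv
    obtain ⟨e', hp⟩ := h.exists_isPair_left hv he
    rw [hp.isBoundary_iff]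
    have : e'.1 ≠ e.1 := fun h' => hp.1 (Subtype.ext h'.symm)
    simp [this]

end Balanced

/-! ### Signed double counting in a bipartite graph -/

section DoubleCounting

variable {V : Type*} {G : SimpleGraph V}

/-- `s` is `1` on one class of a bipartition of `G` and `-1` on the other. -/
structure IsSign (G : SimpleGraph V) (s : V → ℤ) : Prop where
  eq_or : ∀ v, s v = 1 ∨ s v = -1
  adj : ∀ u w, G.Adj u w → s u + s w = 0

theorem exists_isSign (h : G.IsBipartite) : ∃ s, IsSign G s := by
  obtain ⟨C⟩ := h
  refine ⟨fun v => if C v = 0 then 1 else -1, fun v => ?_, fun u w huw => ?_⟩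
  · split_ifs <;> simp
  · have hne := C.valid huw
    split_ifs <;> first | rfl | (exfalso; omega)

variable [Finite V] {s : V → ℤ}

/-- The sum of the weights of the edges at `v`. -/
noncomputable def incidentSum (ε : G.edgeSet → ℤ) (v : V) : ℤ :=
  ∑ e ∈ (Set.toFinite {e : G.edgeSet | v ∈ e.1}).toFinset, ε e

theorem incidentSum_eq_zero {ε : G.edgeSet → ℤ} {v : V}
    (h : ∀ e : G.edgeSet, v ∈ e.1 → ε e = 0) : incidentSum ε v = 0 :=
  Finset.sum_eq_zero fun e he => h e (by simpa using he)

theorem incidentSum_congr {ε ε' : G.edgeSet → ℤ} {v : V}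
    (h : ∀ e : G.edgeSet, v ∈ e.1 → ε e = ε' e) : incidentSum ε v = incidentSum ε' v :=
  Finset.sum_congr rfl fun e he => h e (by simpa using he)

theorem incidentSum_eq_sum {ε : G.edgeSet → ℤ} {v : V} (X : Finset G.edgeSet)
    (hX : ∀ e ∈ X, v ∈ e.1) (h : ∀ e : G.edgeSet, v ∈ e.1 → e ∉ X → ε e = 0) :
    incidentSum ε v = ∑ e ∈ X, ε e := by
  symm
  refine Finset.sum_subset (fun e he => by simpa using hX e he) fun e he he' => ?_
  exact h e (by simpa using he) he'

theorem incidentSum_eq_pair {ε : G.edgeSet → ℤ} {v : V} {e₁ e₂ : G.edgeSet} (hne : e₁ ≠ e₂)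
    (h1 : v ∈ e₁.1) (h2 : v ∈ e₂.1)
    (h : ∀ e : G.edgeSet, v ∈ e.1 → e ≠ e₁ → e ≠ e₂ → ε e = 0) :
    incidentSum ε v = ε e₁ + ε e₂ := by
  classical
  rw [incidentSum_eq_sum {e₁, e₂}, Finset.sum_pair hne]
  · simp [h1, h2]
  · intro e he hX
    simp only [Finset.mem_insert, Finset.mem_singleton, not_or] at hX
    exact h e he hX.1 hX.2

/-- Each edge joins vertices of opposite signs, so its weight cancels in the signed sum over all
vertices. Only the vertices in `X` contribute to this sum. -/
theorem sum_sign_mul_incidentSum (hs : IsSign G s) (ε : G.edgeSet → ℤ) (X : Finset V)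
    (hX : ∀ v ∉ X, incidentSum ε v = 0) : ∑ v ∈ X, s v * incidentSum ε v = 0 := by
  classical
  have := Fintype.ofFinite V
  rw [Finset.sum_subset (Finset.subset_univ X) fun v _ hv => by rw [hX v hv, mul_zero]]
  have h1 : ∀ v, s v * incidentSum ε v =
      ∑ e : G.edgeSet, if v ∈ e.1 then s v * ε e else 0 := fun v => by
    rw [incidentSum, Finset.mul_sum, ← Finset.sum_filter]
    refine Finset.sum_congr ?_ fun _ _ => rfl
    ext e
    simp
  simp only [h1]
  rw [Finset.sum_comm]
  refine Finset.sum_eq_zero fun e _ => ?_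
  obtain ⟨e, he⟩ := e
  induction e using Sym2.ind with
  | _ a b =>
    have hab : G.Adj a b := he
    rw [← Finset.sum_filter]
    have : (Finset.univ.filter fun v => v ∈ s(a, b)) = {a, b} := by
      ext v
      simp
    rw [this, Finset.sum_pair hab.ne, ← add_mul, hs.adj a b hab, zero_mul]

/-- The signed count restricted to one component of a subgraph. -/
theorem sum_sign_mul_incidentSum_component (hs : IsSign G s) {F : SimpleGraph V} (x : V)
    (ε : G.edgeSet → ℤ) (hε : ∀ e : G.edgeSet, e.1 ∉ F.edgeSet → ε e = 0) (X : Finset V)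
    (hXr : ∀ v ∈ X, F.Reachable x v)
    (hX : ∀ v ∉ X, F.Reachable x v → incidentSum ε v = 0) :
    ∑ v ∈ X, s v * incidentSum ε v = 0 := by
  classical
  let δ : G.edgeSet → ℤ := fun e => if ∃ v ∈ e.1, F.Reachable x v then ε e else 0
  have hin : ∀ v, F.Reachable x v → incidentSum δ v = incidentSum ε v := fun v hv =>
    incidentSum_congr fun e he => if_pos ⟨v, he, hv⟩
  have hout : ∀ v, ¬ F.Reachable x v → incidentSum δ v = 0 := fun v hv => by
    refine incidentSum_eq_zero fun e he => ?_
    by_cases heF : e.1 ∈ F.edgeSet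
    · refine if_neg ?_
      rintro ⟨u, hu, hxu⟩
      have huv : u ≠ v := fun h => hv (h ▸ hxu)
      have : e.1 = s(u, v) := (Sym2.mem_and_mem_iff huv).1 ⟨hu, he⟩
      rw [this] at heF
      exact hv (hxu.trans (SimpleGraph.Adj.reachable heF))
    · simp only [δ, hε e heF, ite_self]
  have := sum_sign_mul_incidentSum hs δ X fun v hv => by
    by_cases hr : F.Reachable x v
    · rw [hin v hr, hX v hv hr]
    · exact hout v hr
  rw [← this]
  exact Finset.sum_congr rfl fun v hv => by rw [hin v (hXr v hv)]

end DoubleCounting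

/-! ### Trails and boundaries -/

section Trails

variable {V : Type*} {G : SimpleGraph V} {k : ℕ}

/-- The number of edges of a trail at a vertex is even, except at its two ends. -/
theorem even_card_filter_trail {F : SimpleGraph V} {u v : V} {p : F.Walk u v} (hp : p.IsTrail)
    (w : V) (X : Finset (Sym2 V)) [DecidablePred (· ∈ p.edges)]
    (h1 : ∀ e ∈ p.edges, w ∈ e → e ∈ X) (h2 : ∀ e ∈ X, w ∈ e) :
    Even (X.filter (· ∈ p.edges)).card ↔ (u ≠ v → w ≠ u ∧ w ≠ v) := by
  classical
  rw [← hp.even_countP_edges_iff w, List.countP_eq_length_filter,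
    ← List.toFinset_card_of_nodup (hp.edges_nodup.filter _)]
  have : X.filter (· ∈ p.edges) = (p.edges.filter fun e => decide (w ∈ e)).toFinset := by
    ext e
    simp only [Finset.mem_filter, List.mem_toFinset, List.mem_filter, decide_eq_true_eq]
    exact ⟨fun h => ⟨h.2, h2 e h.1⟩, fun h => ⟨h1 e h.1 h.2, h.1⟩⟩
  rw [this]

variable {A : Labeling G k} {c d : Fin k} {S T : Set (Sym2 V)} [Finite V]

theorem Balanced.isBoundary_trail (h : Balanced c d A) {u v : V}
    {p : (twoColor A c d).Walk u v} (hp : p.IsTrail) (w : V) :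
    IsBoundary A c d p.edgeSet w ↔ u ≠ v ∧ (w = u ∨ w = v) := by
  classical
  obtain ⟨e₁, e₂, hpair⟩ := h.exists_isPair w
  have := even_card_filter_trail hp w {e₁.1, e₂.1} (fun e he hw => by
      obtain ⟨he', hc⟩ := exists_of_mem_twoColor (p.edges_subset_edgeSet he)
      rcases (hpair.2 ⟨e, he'⟩).1 ⟨hw, hc⟩ with h | h <;> simp [← h]) (by
      simp [hpair.left.1, hpair.right.1])
  have hne : e₁.1 ≠ e₂.1 := fun h => hpair.1 (Subtype.ext h)
  have h1 : Even (Finset.filter (· ∈ p.edges) {e₁.1, e₂.1}).card ↔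
      (e₁.1 ∈ p.edges ↔ e₂.1 ∈ p.edges) := by
    by_cases h1 : e₁.1 ∈ p.edges <;> by_cases h2 : e₂.1 ∈ p.edges <;>
      simp [Finset.filter_insert, Finset.filter_singleton, h1, h2, hne]
  rw [hpair.isBoundary_iff]
  rw [h1] at this
  have e1 : ∀ e, e ∈ p.edgeSet ↔ e ∈ p.edges := fun e => Iff.rfl
  rw [e1, e1]
  tauto

/-- Two edge sets with the same boundary that agree on an edge at `x` agree on the whole
two-colored component of `x`. -/
theorem Balanced.agree_of_isBoundary_iff (h : Balanced c d A)
    (hST : ∀ w, IsBoundary A c d S w ↔ IsBoundary A c d T w) {x : V} {e : G.edgeSet}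
    (hx : x ∈ e.1) (hec : A e = c ∨ A e = d) (he : e.1 ∈ S ↔ e.1 ∈ T) {w : V}
    (hw : (twoColor A c d).Reachable x w) (g : G.edgeSet) (hwg : w ∈ g.1)
    (hgc : A g = c ∨ A g = d) : g.1 ∈ S ↔ g.1 ∈ T := by
  obtain ⟨p⟩ := hw
  -- agreement on one of the two edges at a vertex gives agreement on both
  have key : ∀ (w : V) (e g : G.edgeSet), w ∈ e.1 → (A e = c ∨ A e = d) → w ∈ g.1 →
      (A g = c ∨ A g = d) → (e.1 ∈ S ↔ e.1 ∈ T) → (g.1 ∈ S ↔ g.1 ∈ T) := by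
    intro w e g hwe hec hwg hgc he
    by_cases heg : g = e
    · rw [heg]; exact he
    obtain ⟨e', hp⟩ := h.exists_isPair_left hwe hec
    have : g = e' := ((hp.2 g).1 ⟨hwg, hgc⟩).resolve_left heg
    subst this
    have := hST w
    rw [hp.isBoundary_iff, hp.isBoundary_iff, he] at this
    by_cases h1 : e.1 ∈ T <;> simp only [h1, true_iff, false_iff, not_not] at this <;>
      simpa [not_iff_not] using this
  induction p generalizing e with
  | nil => exact key _ e g hx hec hwg hgc he
  | @cons u v w hadj p ih =>
    obtain ⟨he', hc⟩ := exists_of_mem_twoColor (show s(u, v) ∈ (twoColor A c d).edgeSet from hadj)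
    have := key u e ⟨s(u, v), he'⟩ hx hec (Sym2.mem_mk_left u v) hc he
    exact ih (e := ⟨s(u, v), he'⟩) (Sym2.mem_mk_right u v) hc this hwg

theorem Balanced.eq_of_isBoundary_iff (h : Balanced c d A)
    (hST : ∀ w, IsBoundary A c d S w ↔ IsBoundary A c d T w) {x : V} {e : G.edgeSet}
    (hx : x ∈ e.1) (hec : A e = c ∨ A e = d) (he : e.1 ∈ S ↔ e.1 ∈ T)
    (hS : ∀ g ∈ S, g ∈ (twoColor A c d).edgeSet ∧ ∃ w ∈ g, (twoColor A c d).Reachable x w)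
    (hT : ∀ g ∈ T, g ∈ (twoColor A c d).edgeSet ∧ ∃ w ∈ g, (twoColor A c d).Reachable x w) :
    S = T := by
  ext g
  constructor
  · intro hg
    obtain ⟨hgH, w, hwg, hw⟩ := hS g hg
    obtain ⟨hgG, hgc⟩ := exists_of_mem_twoColor hgH
    exact (h.agree_of_isBoundary_iff hST hx hec he hw ⟨g, hgG⟩ hwg hgc).1 hg
  · intro hg
    obtain ⟨hgH, w, hwg, hw⟩ := hT g hg
    obtain ⟨hgG, hgc⟩ := exists_of_mem_twoColor hgH
    exact (h.agree_of_isBoundary_iff hST hx hec he hw ⟨g, hgG⟩ hwg hgc).2 hg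

/-- `S` is the set of edges of a path from `x` to `y` in the colors `c` and `d`. -/
def IsPathSet (A : Labeling G k) (c d : Fin k) (x y : V) (S : Set (Sym2 V)) : Prop :=
  ∃ p : (twoColor A c d).Walk x y, p.IsPath ∧ p.edgeSet = S

end Trails

section Paths

variable {V : Type*} {G : SimpleGraph V} {k : ℕ} {A : Labeling G k} {c d : Fin k}
  {S T : Set (Sym2 V)} {x y : V}

theorem isPathSet_flip_iff : IsPathSet (flip c d T A) c d x y S ↔ IsPathSet A c d x y S := by
  rw [IsPathSet, IsPathSet, twoColor_flip]

theorem IsPathSet.symm_vertex (h : IsPathSet A c d x y S) : IsPathSet A c d y x S := by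
  obtain ⟨p, hp, rfl⟩ := h
  refine ⟨p.reverse, hp.reverse, ?_⟩
  ext e
  simp [SimpleGraph.Walk.edgeSet]

theorem edge_reachable_of_walk {F : SimpleGraph V} {u v : V} (p : F.Walk u v) {g : Sym2 V}
    (hg : g ∈ p.edgeSet) : g ∈ F.edgeSet ∧ ∃ w ∈ g, F.Reachable u w := by
  classical
  refine ⟨p.edges_subset_edgeSet hg, ?_⟩
  induction g using Sym2.ind with
  | _ a b => exact ⟨a, Sym2.mem_mk_left a b, ⟨p.takeUntil a (p.fst_mem_support_of_mem_edges hg)⟩⟩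

theorem IsPathSet.subset (h : IsPathSet A c d x y S) : S ⊆ (twoColor A c d).edgeSet := by
  obtain ⟨p, hp, rfl⟩ := h
  exact fun g hg => (edge_reachable_of_walk p hg).1

theorem exists_edge_of_walk {F : SimpleGraph V} {u v : V} (p : F.Walk u v) (huv : u ≠ v) :
    ∃ e ∈ p.edgeSet, u ∈ e := by
  cases p with
  | nil => exact absurd rfl huv
  | @cons u w v h p => exact ⟨s(u, w), by simp [SimpleGraph.Walk.edgeSet], Sym2.mem_mk_left u w⟩

variable [Finite V]

theorem Balanced.isBoundary_isPathSet (h : Balanced c d A) (hS : IsPathSet A c d x y S)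
    (hxy : x ≠ y) (w : V) : IsBoundary A c d S w ↔ w = x ∨ w = y := by
  obtain ⟨p, hp, rfl⟩ := hS
  rw [h.isBoundary_trail hp.isTrail]
  simp [hxy]

/-- A two-colored path is determined by its ends and its first edge. -/
theorem Balanced.isPathSet_unique (h : Balanced c d A) (hS : IsPathSet A c d x y S)
    (hT : IsPathSet A c d x y T) (hxy : x ≠ y) {e : G.edgeSet} (hx : x ∈ e.1)
    (hec : A e = c ∨ A e = d) (he : e.1 ∈ S ↔ e.1 ∈ T) : S = T := by
  refine h.eq_of_isBoundary_iff (fun w => ?_) hx hec he ?_ ?_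
  · rw [h.isBoundary_isPathSet hS hxy, h.isBoundary_isPathSet hT hxy]
  · obtain ⟨p, hp, rfl⟩ := hS
    exact fun g hg => edge_reachable_of_walk p hg
  · obtain ⟨p, hp, rfl⟩ := hT
    exact fun g hg => edge_reachable_of_walk p hg

end Paths

/-! ### Maximal alternating paths -/

section Elimination

variable {V : Type*} {G : SimpleGraph V} {k : ℕ} {A C : Labeling G k} {c d : Fin k}
  {S T : Set (Sym2 V)} {x y : V} {s : V → ℤ} [Finite V]

/-- The sign of an edge: `1` for the color `c`, `-1` for the color `d`, `0` for any other color. -/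
def colorSign (A : Labeling G k) (c d : Fin k) (e : G.edgeSet) : ℤ :=
  if A e = c then 1 else if A e = d then -1 else 0

/-- The two deficient vertices are joined by a path that avoids a given edge `f` at `x`. Otherwise,
after the removal of `f`, the only vertices in the component of `x` whose edges have a nonzero sum
of color signs are ends of `f`, and the signed count over this component would not vanish. -/
theorem TwoDeficient.reachable_deleteEdges (hs : IsSign G s) (h : TwoDeficient c d A x y)
    {e f : G.edgeSet} (hp : IsPair A c d x e f) :
    ((twoColor A c d).deleteEdges {f.1}).Reachable x y := by
  classical
  by_contra hxy
  set F := (twoColor A c d).deleteEdges {f.1} with hF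
  let ε : G.edgeSet → ℤ := fun g => if g = f then 0 else colorSign A c d g
  have hcd := h.ne
  have hxf : x ∈ f.1 := hp.right.1
  obtain ⟨w, hw⟩ := hxf
  have hxw : G.Adj x w := by
    have := f.2
    rwa [hw] at this
  have hx2 : A e = A f :=
    (h.isDeficient_iff_of_isPair hp).1 ((h.deficient_iff x).2 (Or.inl rfl))
  have hεF : ∀ g : G.edgeSet, g.1 ∉ F.edgeSet → ε g = 0 := by
    intro g hg
    by_cases hgf : g = f
    · simp [ε, hgf]
    · have : ¬ (A g = c ∨ A g = d) := by
        rw [← mem_twoColor]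
        intro hg'
        apply hg
        rw [hF, SimpleGraph.edgeSet_deleteEdges]
        exact ⟨hg', fun h => hgf (Subtype.ext h)⟩
      push Not at this
      simp [ε, colorSign, this]
  have hsum : ∀ v e₁ e₂, IsPair A c d v e₁ e₂ → incidentSum ε v = ε e₁ + ε e₂ := by
    intro v e₁ e₂ hq
    refine incidentSum_eq_pair hq.1 hq.left.1 hq.right.1 fun g hg h1 h2 => ?_
    have : ¬ (A g = c ∨ A g = d) := fun hc => by
      rcases (hq.2 g).1 ⟨hg, hc⟩ with h | h <;> contradiction
    push Not at this
    simp [ε, colorSign, this]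
  have hsign : ∀ g g' : G.edgeSet, (A g = c ∨ A g = d) → (A g' = c ∨ A g' = d) → A g ≠ A g' →
      colorSign A c d g + colorSign A c d g' = 0 := by
    intro g g' h1 h2 hne
    rcases h1 with h1 | h1 <;> rcases h2 with h2 | h2 <;>
      simp [colorSign, h1, h2, hcd.symm] at hne ⊢
  have hxsum : incidentSum ε x = colorSign A c d f := by
    rw [hsum x e f hp]
    simp [ε, hp.1, colorSign, hx2]
  have hf1 : colorSign A c d f = 1 ∨ colorSign A c d f = -1 := by
    rcases hp.right.2 with h | h <;> simp [colorSign, h, hcd.symm]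
  have hnd : ∀ v, v ≠ x → v ≠ y → ¬ IsDeficient A v := fun v h1 h2 h3 => by
    rcases (h.deficient_iff v).1 h3 with h | h <;> contradiction
  have hX : ∀ v, v ≠ x → v ≠ w → F.Reachable x v → incidentSum ε v = 0 := by
    intro v hvx hvw hr
    have hvy : v ≠ y := fun h => hxy (h ▸ hr)
    obtain ⟨e₁, e₂, hq⟩ := h.exists_isPair v
    have hvf : v ∉ f.1 := by
      rw [hw]
      simp [hvx, hvw]
    have h1 : e₁ ≠ f := fun h => hvf (h ▸ hq.left.1)
    have h2 : e₂ ≠ f := fun h => hvf (h ▸ hq.right.1)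
    rw [hsum v e₁ e₂ hq]
    simp only [ε, h1, h2, if_false]
    exact hsign e₁ e₂ hq.left.2 hq.right.2
      fun h' => hnd v hvx hvy ((h.isDeficient_iff_of_isPair hq).2 h')
  by_cases hrw : F.Reachable x w
  · have hwy : w ≠ y := fun h => hxy (h ▸ hrw)
    have hwsum : incidentSum ε w = - colorSign A c d f := by
      obtain ⟨f', hq⟩ := h.exists_isPair_left (v := w) (e := f) (by simp [hw]) hp.right.2
      have hne : A f ≠ A f' := fun h' =>
        hnd w hxw.ne' hwy ((h.isDeficient_iff_of_isPair hq).2 h')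
      rw [hsum w f f' hq]
      simp only [ε, if_true, hq.1.symm, if_false]
      linarith [hsign f f' hq.left.2 hq.right.2 hne]
    have := sum_sign_mul_incidentSum_component hs x ε hεF {x, w}
      (by simp [hrw]) (fun v hv hr => by
        simp only [Finset.mem_insert, Finset.mem_singleton, not_or] at hv
        exact hX v hv.1 hv.2 hr)
    rw [Finset.sum_pair hxw.ne, hxsum, hwsum] at this
    have h2 := hs.adj x w hxw
    rcases hs.eq_or x with h3 | h3 <;> rcases hf1 with h4 | h4 <;> rw [h3, h4] at this <;>
      omega
  · have := sum_sign_mul_incidentSum_component hs x ε hεF {x}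
      (by simp) (fun v hv hr => by
        simp only [Finset.mem_singleton] at hv
        exact hX v hv (fun h => hrw (h ▸ hr)) hr)
    rw [Finset.sum_singleton, hxsum] at this
    rcases hs.eq_or x with h3 | h3 <;> rcases hf1 with h4 | h4 <;> rw [h3, h4] at this <;>
      omega

/-- A path between the two deficient vertices alternates. -/
theorem TwoDeficient.properOn_isPathSet (h : TwoDeficient c d A x y)
    (hS : IsPathSet A c d x y S) : ProperOn A S := by
  rintro a b ha hb hab ⟨v, hva, hvb⟩ hc
  have hac := (mem_twoColor a).1 (hS.subset ha)
  have hbc := (mem_twoColor b).1 (hS.subset hb)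
  obtain ⟨b', hq⟩ := h.exists_isPair_left hva hac
  obtain rfl : b = b' := ((hq.2 b).1 ⟨hvb, hbc⟩).resolve_left hab.symm
  have hv := (h.deficient_iff v).1 ((h.isDeficient_iff_of_isPair hq).2 hc)
  have := (h.isBoundary_isPathSet hS h.ne_vertex v).2 hv
  rw [hq.isBoundary_iff] at this
  exact this.1 ha hb

/-- From a deficient vertex, a path to the other one can be started with either of the two edges. -/
theorem TwoDeficient.exists_isPathSet (hs : IsSign G s) (h : TwoDeficient c d A x y)
    {e : G.edgeSet} (hx : x ∈ e.1) (hec : A e = c ∨ A e = d) :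
    ∃ S, IsPathSet A c d x y S ∧ e.1 ∈ S := by
  obtain ⟨f, hp⟩ := h.exists_isPair_left hx hec
  obtain ⟨p, hpath⟩ := (h.reachable_deleteEdges hs hp).exists_isPath
  have hS : IsPathSet A c d x y (p.mapLe (SimpleGraph.deleteEdges_le _)).edgeSet :=
    ⟨_, hpath.mapLe _, rfl⟩
  refine ⟨_, hS, ?_⟩
  obtain ⟨g, hg, hxg⟩ := exists_edge_of_walk p h.ne_vertex
  have hgF := p.edges_subset_edgeSet hg
  rw [SimpleGraph.edgeSet_deleteEdges] at hgF
  obtain ⟨hgG, hgc⟩ := exists_of_mem_twoColor hgF.1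
  rcases (hp.2 ⟨g, hgG⟩).1 ⟨hxg, hgc⟩ with h1 | h1
  · rw [← h1]
    simpa [SimpleGraph.Walk.edgeSet] using hg
  · exact absurd (congrArg Subtype.val h1) hgF.2

/-- An alternating walk that enters a path between the deficient vertices does not leave it. -/
theorem TwoDeficient.edges_subset_of_alternating (h : TwoDeficient c d A x y)
    (hS : IsPathSet A c d x y S) {a b : V} (q : (twoColor A c d).Walk a b)
    (hx : x ∉ q.support) {e : G.edgeSet} (he : e.1 ∈ S) (hae : a ∈ e.1) (heq : e.1 ∉ q.edges)
    (hnd : q.edges.Nodup) (hq : ProperOn A (insert e.1 q.edgeSet)) : q.edgeSet ⊆ S := by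
  induction q generalizing e with
  | nil => intro g hg; simp [SimpleGraph.Walk.edgeSet] at hg
  | @cons a a' b hadj q ih =>
    rw [SimpleGraph.Walk.support_cons, List.mem_cons, not_or] at hx
    rw [SimpleGraph.Walk.edges_cons, List.mem_cons, not_or] at heq
    rw [SimpleGraph.Walk.edges_cons, List.nodup_cons] at hnd
    obtain ⟨hgG, hgc⟩ := exists_of_mem_twoColor
      (show s(a, a') ∈ (twoColor A c d).edgeSet from hadj)
    set g : G.edgeSet := ⟨s(a, a'), hgG⟩ with hg
    have hag : a ∈ g.1 := Sym2.mem_mk_left a a'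
    have heg : e ≠ g := fun h => heq.1 (congrArg Subtype.val h)
    have hec := (mem_twoColor e).1 (hS.subset he)
    obtain ⟨g', hp⟩ := h.exists_isPair_left hae hec
    obtain rfl : g = g' := ((hp.2 g).1 ⟨hag, hgc⟩).resolve_left heg.symm
    have hcne : A e ≠ A g := hq e g (Or.inl rfl)
      (Or.inr (by simp [SimpleGraph.Walk.edgeSet, hg])) heg ⟨a, hae, hag⟩
    have hgS : g.1 ∈ S := by
      have := h.isBoundary_isPathSet hS h.ne_vertex a
      have h1 : ¬ (a = x ∨ a = y) := fun h' =>
        hcne ((h.isDeficient_iff_of_isPair hp).1 ((h.deficient_iff a).2 h'))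
      rw [hp.isBoundary_iff] at this
      by_contra hgS
      exact h1 (this.1 (iff_of_true he hgS))
    have hrest : q.edgeSet ⊆ S := by
      refine ih hx.2 hgS (Sym2.mem_mk_right a a') hnd.1 hnd.2 ?_
      intro e₁ e₂ h1 h2
      refine hq e₁ e₂ (Or.inr ?_) (Or.inr ?_)
      · rcases h1 with h1 | h1
        · simp [SimpleGraph.Walk.edgeSet, h1, hg]
        · simp only [SimpleGraph.Walk.edgeSet, SimpleGraph.Walk.edges_cons]
          exact List.mem_cons_of_mem _ h1
      · rcases h2 with h1 | h1
        · simp [SimpleGraph.Walk.edgeSet, h1, hg]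
        · simp only [SimpleGraph.Walk.edgeSet, SimpleGraph.Walk.edges_cons]
          exact List.mem_cons_of_mem _ h1
    intro g' hg'
    simp only [SimpleGraph.Walk.edgeSet, SimpleGraph.Walk.edges_cons] at hg'
    rcases List.mem_cons.1 hg' with rfl | h'
    · exact hgS
    · exact hrest h'

/-- The elimination flips a path between the deficient vertices, since every alternating path that
starts with the same edge is contained in it. -/
theorem TwoDeficient.altPath_eq (h : TwoDeficient c d A x y) (hS : IsPathSet A c d x y S)
    {e : G.edgeSet} (hx : x ∈ e.1) (he : e.1 ∈ S) : altPath A c d x e = S := by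
  apply Set.Subset.antisymm
  · rintro g ⟨w, q, hq, hprop, heq, hgq⟩
    cases q with
    | nil => simp [SimpleGraph.Walk.edgeSet] at heq
    | @cons _ u _ hadj q =>
      rw [SimpleGraph.Walk.cons_isPath_iff] at hq
      have he' : e.1 = s(x, u) := by
        have heq' : e.1 = s(x, u) ∨ e.1 ∈ q.edges := by
          simpa [SimpleGraph.Walk.edgeSet] using heq
        refine heq'.resolve_right fun h' => hq.2 ?_
        exact q.mem_support_of_mem_edges h' hx
      have hsub : q.edgeSet ⊆ S := by
        refine h.edges_subset_of_alternating hS q hq.2 he (by simp [he']) ?_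
          hq.1.isTrail.edges_nodup ?_
        · exact fun h' => hq.2 (q.mem_support_of_mem_edges h' hx)
        · intro e₁ e₂ h1 h2
          refine hprop e₁ e₂ ?_ ?_
          · simpa [SimpleGraph.Walk.edgeSet, he'] using h1
          · simpa [SimpleGraph.Walk.edgeSet, he'] using h2
      have hgq' : g = s(x, u) ∨ g ∈ q.edges := by
        simpa [SimpleGraph.Walk.edgeSet] using hgq
      rcases hgq' with rfl | h'
      · rwa [← he']
      · exact hsub h'
  · intro g hg
    obtain ⟨p, hp, rfl⟩ := hS
    exact ⟨y, p, hp, h.properOn_isPathSet ⟨p, hp, rfl⟩, he, hg⟩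

/-- Flipping a path between the two deficient vertices eliminates both deficiencies. -/
theorem TwoDeficient.isEdgeColoring_flip (h : TwoDeficient c d A x y)
    (hS : IsPathSet A c d x y S) : IsEdgeColoring (LatinChain.flip c d S A) := by
  rw [(h.toBalanced.flip S).isEdgeColoring_iff]
  intro v
  rw [h.isDeficient_flip, h.deficient_iff, h.isBoundary_isPathSet hS h.ne_vertex, not_not]

/-- Flipping a path in an edge coloring creates deficiencies at its two ends. -/
theorem Balanced.twoDeficient_flip (h : Balanced c d C) (hC : IsEdgeColoring C) (hxy : x ≠ y)
    (hS : IsPathSet C c d x y S) : TwoDeficient c d (LatinChain.flip c d S C) x y := by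
  refine ⟨h.flip S, hxy, fun v => ?_⟩
  rw [h.isDeficient_flip, h.isBoundary_isPathSet hS hxy]
  have := hC.not_isDeficient v
  tauto

end Elimination

/-! ### Connected pieces and even paths -/

section Pieces

variable {V : Type*} {G : SimpleGraph V} {k : ℕ} {A C : Labeling G k} {c d : Fin k}
  {S T : Set (Sym2 V)} {x y : V} {s : V → ℤ}

theorem connectedPieces_flip : connectedPieces (flip c d T A) c d = connectedPieces A c d := by
  rw [connectedPieces, connectedPieces, twoColor_flip]

theorem subset_of_mem_connectedPieces (hS : S ∈ connectedPieces A c d) :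
    S ⊆ (twoColor A c d).edgeSet ∧ S.Nonempty := by
  obtain ⟨K, hK, hne, rfl⟩ := hS
  exact ⟨K.edgeSet_subset, hne⟩

theorem IsPathSet.mem_connectedPieces (hS : IsPathSet A c d x y S) (hxy : x ≠ y) :
    S ∈ connectedPieces A c d := by
  obtain ⟨p, hp, rfl⟩ := hS
  refine ⟨p.toSubgraph, p.toSubgraph_connected, ?_, p.edgeSet_toSubgraph⟩
  rw [p.edgeSet_toSubgraph]
  obtain ⟨e, he, -⟩ := exists_edge_of_walk p hxy
  exact ⟨e, he⟩

theorem isPathSet_singleton {u w : V} {e : G.edgeSet} (he : e.1 = s(u, w))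
    (hec : A e = c ∨ A e = d) : IsPathSet A c d u w {e.1} := by
  have hadj : (twoColor A c d).Adj u w := by
    rw [← SimpleGraph.mem_edgeSet, ← he, mem_twoColor]
    exact hec
  refine ⟨hadj.toWalk, ?_, ?_⟩
  · simp [hadj.ne]
  · ext g
    simp [SimpleGraph.Walk.edgeSet, he]

theorem IsSign.even_length_iff (hs : IsSign G s) {F : SimpleGraph V} (hF : F ≤ G) {u v : V}
    (p : F.Walk u v) : Even p.length ↔ s u = s v := by
  induction p with
  | nil => simp
  | @cons u v w h p ih =>
    rw [SimpleGraph.Walk.length_cons, Nat.even_add_one, ih]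
    have h1 := hs.adj u v (hF h)
    rcases hs.eq_or u with h2 | h2 <;> rcases hs.eq_or v with h3 | h3 <;>
      rcases hs.eq_or w with h4 | h4 <;> rw [h2, h3] at h1 <;> simp [h2, h3, h4] at h1 ⊢

theorem mem_evenPaths_iff (hs : IsSign G s) :
    S ∈ evenPaths A c d ↔ ∃ u v, u ≠ v ∧ s u = s v ∧ IsPathSet A c d u v S := by
  constructor
  · rintro ⟨u, v, p, hp, h0, heven, rfl⟩
    refine ⟨u, v, ?_, (hs.even_length_iff (twoColor_le A c d) p).1 heven, p, hp, rfl⟩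
    rintro rfl
    rw [SimpleGraph.Walk.length_eq_zero_iff.2 (SimpleGraph.Walk.isPath_iff_nil.1 hp)] at h0
    exact lt_irrefl 0 h0
  · rintro ⟨u, v, huv, hsuv, p, hp, rfl⟩
    refine ⟨u, v, p, hp, ?_, (hs.even_length_iff (twoColor_le A c d) p).2 hsuv, rfl⟩
    rw [Nat.pos_iff_ne_zero]
    intro h0
    exact huv (SimpleGraph.Walk.eq_of_length_eq_zero h0)

theorem induction_on_connected {F : SimpleGraph V} {K : F.Subgraph} (hK : K.Connected)
    {Q : V → Prop} {u : V} (hu : u ∈ K.verts) (h0 : Q u)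
    (hstep : ∀ a b, K.Adj a b → Q a → Q b) {w : V} (hw : w ∈ K.verts) : Q w := by
  obtain ⟨p⟩ := hK.coe.preconnected ⟨u, hu⟩ ⟨w, hw⟩
  have : ∀ (a b : K.verts) (_ : K.coe.Walk a b), Q a → Q b := by
    intro a b p
    induction p with
    | nil => exact id
    | cons h p ih => exact fun ha => ih (hstep _ _ h ha)
  exact this _ _ p h0

theorem reachable_of_mem_connectedPieces (hS : S ∈ connectedPieces A c d) {e g : Sym2 V}
    (he : e ∈ S) {w : V} (hw : w ∈ e) (hg : g ∈ S) :
    ∃ w' ∈ g, (twoColor A c d).Reachable w w' := by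
  obtain ⟨K, hK, -, rfl⟩ := hS
  induction g using Sym2.ind with
  | _ a b =>
    have hab : K.Adj a b := hg
    refine ⟨a, Sym2.mem_mk_left a b, ?_⟩
    exact induction_on_connected hK (Q := fun w' => (twoColor A c d).Reachable w w')
      (SimpleGraph.Subgraph.mem_verts_of_mem_edge he hw) (SimpleGraph.Reachable.refl _)
      (fun a b hab h => h.trans (K.adj_sub hab).reachable) hab.fst_mem

variable [Finite V]

/-- The boundary of an edge set does not consist of a single vertex, since the signed count of its
edges is even. -/
theorem Balanced.exists_ne_isBoundary (hs : IsSign G s) (h : Balanced c d A)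
    (hS : S ⊆ (twoColor A c d).edgeSet) {u : V} (hu : IsBoundary A c d S u) :
    ∃ v, v ≠ u ∧ IsBoundary A c d S v := by
  classical
  have := Fintype.ofFinite V
  by_contra hno
  push Not at hno
  let ε : G.edgeSet → ℤ := fun e => if e.1 ∈ S then 1 else 0
  have hsum : ∀ v e₁ e₂, IsPair A c d v e₁ e₂ → incidentSum ε v = ε e₁ + ε e₂ := by
    intro v e₁ e₂ hq
    refine incidentSum_eq_pair hq.1 hq.left.1 hq.right.1 fun g hg h1 h2 => if_neg fun hgS => ?_
    rcases (hq.2 g).1 ⟨hg, (mem_twoColor g).1 (hS hgS)⟩ with h | h <;> contradiction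
  have h0 := sum_sign_mul_incidentSum hs ε Finset.univ (by simp)
  rw [← Finset.add_sum_erase _ _ (Finset.mem_univ u)] at h0
  have h2 : (2 : ℤ) ∣ ∑ v ∈ Finset.univ.erase u, s v * incidentSum ε v := by
    refine Finset.dvd_sum fun v hv => Dvd.dvd.mul_left ?_ _
    obtain ⟨e₁, e₂, hq⟩ := h.exists_isPair v
    have hv' := hno v (Finset.ne_of_mem_erase hv)
    rw [hq.isBoundary_iff] at hv'
    rw [hsum v e₁ e₂ hq]
    by_cases h1 : e₁.1 ∈ S <;> by_cases h2 : e₂.1 ∈ S <;> simp [ε, h1, h2] at hv' ⊢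
  have h3 : incidentSum ε u = 1 := by
    obtain ⟨e₁, e₂, hq⟩ := h.exists_isPair u
    rw [hq.isBoundary_iff] at hu
    rw [hsum u e₁ e₂ hq]
    by_cases h1 : e₁.1 ∈ S <;> by_cases h2 : e₂.1 ∈ S <;> simp [ε, h1, h2] at hu ⊢
  rw [h3, mul_one] at h0
  rcases hs.eq_or u with h4 | h4 <;> rw [h4] at h0 <;> omega

/-- A connected piece is a union of whole cycles or the edge set of a path. -/
theorem Balanced.isPathSet_of_mem_connectedPieces (hs : IsSign G s) (h : Balanced c d A)
    (hS : S ∈ connectedPieces A c d) :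
    (∀ v, ¬ IsBoundary A c d S v) ∨ ∃ u v, u ≠ v ∧ IsPathSet A c d u v S := by
  classical
  by_contra hno
  push Not at hno
  obtain ⟨⟨u, hu⟩, hno⟩ := hno
  obtain ⟨v, hvu, hv⟩ := h.exists_ne_isBoundary hs (subset_of_mem_connectedPieces hS).1 hu
  obtain ⟨K, hK, -, rfl⟩ := hS
  have hverts : ∀ w, IsBoundary A c d K.edgeSet w → w ∈ K.verts := by
    rintro w ⟨e, -, hwe, -, -, -, he, -⟩
    exact SimpleGraph.Subgraph.mem_verts_of_mem_edge he hwe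
  obtain ⟨p, hp⟩ := (hK.coe.preconnected ⟨u, hverts u hu⟩ ⟨v, hverts v hv⟩).exists_isPath
  have hP : IsPathSet A c d u v (p.map K.hom).edgeSet :=
    ⟨_, hp.map K.hom_injective, rfl⟩
  have hPS : (p.map K.hom).edgeSet ⊆ K.edgeSet := by
    intro g hg
    simp only [SimpleGraph.Walk.edgeSet, SimpleGraph.Walk.edges_map] at hg
    obtain ⟨g', hg', rfl⟩ := List.mem_map.1 hg
    have := p.edges_subset_edgeSet hg'
    induction g' using Sym2.ind with
    | _ a b => exact this
  refine hno u v hvu.symm ?_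
  convert! hP using 1
  refine Set.Subset.antisymm ?_ hPS
  generalize (p.map K.hom).edgeSet = P at hP hPS
  -- all edges of the piece at a vertex of the piece lie on the path
  have key : ∀ w ∈ K.verts, ∀ g : G.edgeSet, w ∈ g.1 → g.1 ∈ K.edgeSet → g.1 ∈ P := by
    intro w hw
    refine induction_on_connected hK
      (Q := fun w => ∀ g : G.edgeSet, w ∈ g.1 → g.1 ∈ K.edgeSet → g.1 ∈ P)
      (hverts u hu) ?_ ?_ hw
    · intro g hug hgK
      obtain ⟨f, hq⟩ := h.exists_isPair_left hug ((mem_twoColor g).1 (K.edgeSet_subset hgK))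
      have h1 := (h.isBoundary_isPathSet hP hvu.symm u).2 (Or.inl rfl)
      rw [hq.isBoundary_iff] at h1 hu
      by_contra hgP
      have hfP : f.1 ∈ P := by tauto
      exact hu.1 hgK (hPS hfP)
    · intro a b hab ha g hbg hgK
      have habK : s(a, b) ∈ K.edgeSet := hab
      obtain ⟨habG, habc⟩ := exists_of_mem_twoColor (K.edgeSet_subset habK)
      have habP := ha ⟨s(a, b), habG⟩ (Sym2.mem_mk_left a b) habK
      by_cases hg : g = ⟨s(a, b), habG⟩
      · rw [hg]; exact habP
      obtain ⟨f, hq⟩ := h.exists_isPair_left (v := b) (e := ⟨s(a, b), habG⟩)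
        (Sym2.mem_mk_right a b) habc
      obtain rfl : g = f :=
        ((hq.2 g).1 ⟨hbg, (mem_twoColor g).1 (K.edgeSet_subset hgK)⟩).resolve_left hg
      have hb : ¬ (b = u ∨ b = v) := by
        have h1 : ¬ IsBoundary A c d K.edgeSet b := by
          rw [hq.isBoundary_iff]
          exact fun h' => h'.1 habK hgK
        rintro (rfl | rfl) <;> contradiction
      rw [← h.isBoundary_isPathSet hP hvu.symm b, hq.isBoundary_iff] at hb
      by_contra hgP
      exact hb (iff_of_true habP hgP)
  intro g hg
  obtain ⟨hgG, -⟩ := exists_of_mem_twoColor (K.edgeSet_subset hg)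
  obtain ⟨w, hw⟩ : ∃ w, w ∈ g := by
    induction g using Sym2.ind with
    | _ a b => exact ⟨a, Sym2.mem_mk_left a b⟩
  exact key w (SimpleGraph.Subgraph.mem_verts_of_mem_edge hg hw) ⟨g, hgG⟩ hw hg

/-- Changing the color of an edge at a deficient vertex moves the deficiency along this edge,
or removes both deficiencies. -/
theorem TwoDeficient.flip_singleton (h : TwoDeficient c d A x y) {e : G.edgeSet} {w : V}
    (he : e.1 = s(x, w)) (hec : A e = c ∨ A e = d) :
    (w = y ∧ IsEdgeColoring (LatinChain.flip c d {e.1} A)) ∨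
      (w ≠ y ∧ TwoDeficient c d (LatinChain.flip c d {e.1} A) w y) := by
  have hdef : ∀ v, IsDeficient (LatinChain.flip c d {e.1} A) v ↔
      ¬((v = x ∨ v = y) ↔ (v = x ∨ v = w)) := fun v => by
    rw [h.isDeficient_flip, h.deficient_iff, isBoundary_singleton_iff h.toBalanced hec, he,
      Sym2.mem_iff]
  have hxw : x ≠ w := by
    have := e.2
    rw [he] at this
    exact SimpleGraph.Adj.ne this
  by_cases hwy : w = y
  · refine Or.inl ⟨hwy, ?_⟩
    rw [(h.toBalanced.flip {e.1}).isEdgeColoring_iff]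
    intro v
    rw [hdef, hwy]
    tauto
  · refine Or.inr ⟨hwy, h.toBalanced.flip _, hwy, fun v => ?_⟩
    rw [hdef]
    have := h.ne_vertex
    constructor
    · tauto
    · rintro (rfl | rfl)
      · simp [hxw.symm, hwy]
      · simp [this.symm, Ne.symm hwy]

end Pieces

/-! ### The numbers of connected pieces and of even paths -/

section Counting

variable {V : Type*} {G : SimpleGraph V} {k : ℕ} {A C : Labeling G k} {c d : Fin k}
  {s : V → ℤ} [Fintype V]

/-- The factor `2` comes from the two edges with which a path can start. -/
theorem Balanced.ncard_isPathSet_le (h : Balanced c d A) :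
    {S | ∃ u v, u ≠ v ∧ IsPathSet A c d u v S}.ncard ≤
      2 * (Fintype.card V * (Fintype.card V - 1)) := by
  classical
  choose e₁ e₂ hpair using h.exists_isPair
  -- a path is determined by its ends and the choice of the first edge
  let φ : (V × V) × Bool → Set (Sym2 V) := fun t =>
    if ht : ∃ S, IsPathSet A c d t.1.1 t.1.2 S ∧ ((e₁ t.1.1).1 ∈ S ↔ t.2 = true) then ht.choose
    else ∅
  have hsub : {S | ∃ u v, u ≠ v ∧ IsPathSet A c d u v S} ⊆
      ((Finset.univ.offDiag ×ˢ Finset.univ).image φ : Finset (Set (Sym2 V))) := by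
    rintro S ⟨u, v, huv, hS⟩
    rw [Finset.coe_image, Set.mem_image]
    refine ⟨((u, v), decide ((e₁ u).1 ∈ S)), ?_, ?_⟩
    · rw [Finset.mem_coe, Finset.mem_product, Finset.mem_offDiag]
      exact ⟨⟨Finset.mem_univ _, Finset.mem_univ _, huv⟩, Finset.mem_univ _⟩
    have ht : ∃ T, IsPathSet A c d u v T ∧
        ((e₁ u).1 ∈ T ↔ decide ((e₁ u).1 ∈ S) = true) := ⟨S, hS, by simp⟩
    have := ht.choose_spec
    simp only [φ, dif_pos ht]
    exact h.isPathSet_unique this.1 hS huv (hpair u).left.1 (hpair u).left.2 (by simpa using this.2)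
  calc _ ≤ _ := Set.ncard_le_ncard hsub (Finset.finite_toSet _)
    _ ≤ _ := by
      rw [Set.ncard_coe_finset]
      refine Finset.card_image_le.trans ?_
      rw [Finset.card_product, Finset.offDiag_card, Finset.card_univ, Finset.card_univ,
        Fintype.card_bool, Nat.mul_sub_one, mul_comm]

theorem Balanced.ncard_evenPaths_le (hs : IsSign G s) (h : Balanced c d A) :
    (evenPaths A c d).ncard ≤ 2 * (Fintype.card V * (Fintype.card V - 1)) := by
  refine le_trans (Set.ncard_le_ncard ?_ (Set.toFinite _)) h.ncard_isPathSet_le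
  intro S hS
  obtain ⟨u, v, huv, -, hS⟩ := (mem_evenPaths_iff hs).1 hS
  exact ⟨u, v, huv, hS⟩

/-- Besides the paths, the connected pieces are the two-colored components, of which there are at
most as many as vertices. -/
theorem Balanced.ncard_connectedPieces_le (hs : IsSign G s) (h : Balanced c d A) :
    (connectedPieces A c d).ncard ≤
      2 * (Fintype.card V * (Fintype.card V - 1)) + Fintype.card V := by
  classical
  let Z : Set (Set (Sym2 V)) := {S ∈ connectedPieces A c d | ∀ v, ¬ IsBoundary A c d S v}
  have hsub : connectedPieces A c d ⊆ {S | ∃ u v, u ≠ v ∧ IsPathSet A c d u v S} ∪ Z := by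
    intro S hS
    rcases h.isPathSet_of_mem_connectedPieces hs hS with h' | h'
    · exact Or.inr ⟨hS, h'⟩
    · exact Or.inl h'
  -- a piece without boundary is determined by any of its vertices
  let φ : V → Set (Sym2 V) := fun v =>
    if hv : ∃ S ∈ Z, ∃ e : G.edgeSet, v ∈ e.1 ∧ e.1 ∈ S then hv.choose else ∅
  have hZ : Z ⊆ (Finset.univ.image φ : Finset (Set (Sym2 V))) := by
    intro S hS
    obtain ⟨hSH, g, hg⟩ := subset_of_mem_connectedPieces hS.1
    obtain ⟨hgG, hgc⟩ := exists_of_mem_twoColor (hSH hg)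
    obtain ⟨w, hw⟩ : ∃ w, w ∈ g := by
      induction g using Sym2.ind with
      | _ a b => exact ⟨a, Sym2.mem_mk_left a b⟩
    rw [Finset.coe_image, Set.mem_image]
    refine ⟨w, by simp, ?_⟩
    have hv : ∃ S ∈ Z, ∃ e : G.edgeSet, w ∈ e.1 ∧ e.1 ∈ S := ⟨S, hS, ⟨g, hgG⟩, hw, hg⟩
    obtain ⟨hT, e, hwe, heT⟩ := hv.choose_spec
    simp only [φ, dif_pos hv]
    generalize hv.choose = T at hT heT
    have hTH := (subset_of_mem_connectedPieces hT.1).1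
    have hec := (mem_twoColor e).1 (hTH heT)
    have heS : e.1 ∈ S := by
      by_contra heS
      exact hS.2 w ⟨⟨g, hgG⟩, e, hw, hwe, hgc, hec, hg, heS⟩
    exact h.eq_of_isBoundary_iff (fun v => iff_of_false (hT.2 v) (hS.2 v)) hwe hec
      (iff_of_true heT heS)
      (fun f hf => ⟨hTH hf, reachable_of_mem_connectedPieces hT.1 heT hwe hf⟩)
      (fun f hf => ⟨hSH hf, reachable_of_mem_connectedPieces hS.1 heS hwe hf⟩)
  have hZcard : Z.ncard ≤ Fintype.card V := by
    refine (Set.ncard_le_ncard hZ (Finset.finite_toSet _)).trans ?_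
    rw [Set.ncard_coe_finset]
    exact Finset.card_image_le
  calc _ ≤ _ := Set.ncard_le_ncard hsub (Set.toFinite _)
    _ ≤ _ := Set.ncard_union_le _ _
    _ ≤ _ := Nat.add_le_add h.ncard_isPathSet_le hZcard

end Counting

/-! ### Alternating cycles -/

section AltCycle

variable {V : Type*} {G : SimpleGraph V} {k : ℕ} {A : Labeling G k} {a b : Fin k}
  {Z Z' : Set (Sym2 V)} {u v : V} {s : V → ℤ}

theorem eq_of_ne_of_ne {x y z : Fin k} (hx : x = a ∨ x = b) (hy : y = a ∨ y = b)
    (hz : z = a ∨ z = b) (hxy : x ≠ y) (hzy : z ≠ y) : x = z := by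
  rcases hx with rfl | rfl <;> rcases hy with rfl | rfl <;> rcases hz with rfl | rfl <;> simp_all

theorem swap_eq_of_ne {x y : Fin k} (hx : x = a ∨ x = b) (hy : y = a ∨ y = b) (hxy : x ≠ y) :
    Equiv.swap a b x = y := by
  rcases hx with rfl | rfl <;> rcases hy with rfl | rfl <;> simp_all

/-- `Z` is the edge set of a cycle through `v` with alternating colors `a` and `b`. -/
def IsAltCycle (A : Labeling G k) (a b : Fin k) (v : V) (Z : Set (Sym2 V)) : Prop :=
  ∃ p : (twoColor A a b).Walk v v, p.IsCycle ∧ ProperOn A p.edgeSet ∧ p.edgeSet = Z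

theorem mem_altCycle {g : Sym2 V} : g ∈ altCycle A a b v ↔ ∃ Z, IsAltCycle A a b v Z ∧ g ∈ Z := by
  constructor
  · rintro ⟨p, hp, h1, h2⟩
    exact ⟨_, ⟨p, hp, h1, rfl⟩, h2⟩
  · rintro ⟨_, ⟨p, hp, h1, rfl⟩, h2⟩
    exact ⟨p, hp, h1, h2⟩

theorem IsAltCycle.subset (h : IsAltCycle A a b v Z) : Z ⊆ (twoColor A a b).edgeSet := by
  obtain ⟨p, -, -, rfl⟩ := h
  exact fun g hg => p.edges_subset_edgeSet hg

theorem IsAltCycle.properOn (h : IsAltCycle A a b v Z) : ProperOn A Z := by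
  obtain ⟨p, -, hp, rfl⟩ := h
  exact hp

/-- An alternating cycle contains with each edge another one, of the other color, at each
of its ends. -/
theorem IsAltCycle.exists_partner (h : IsAltCycle A a b v Z) {w : V} {e : G.edgeSet}
    (hw : w ∈ e.1) (he : e.1 ∈ Z) : ∃ g : G.edgeSet, w ∈ g.1 ∧ g.1 ∈ Z ∧ A g ≠ A e := by
  classical
  by_contra hno
  push Not at hno
  have hZ := h.properOn
  obtain ⟨p, hp, -, rfl⟩ := h
  have hodd := even_card_filter_trail hp.isTrail w {e.1} (fun g hg hwg => by
    obtain ⟨hgG, -⟩ := exists_of_mem_twoColor (p.edges_subset_edgeSet hg)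
    by_contra hge
    have hne : (⟨g, hgG⟩ : G.edgeSet) ≠ e := fun h' => hge (by simp [← h'])
    exact hZ ⟨g, hgG⟩ e hg he hne ⟨w, hwg, hw⟩ (hno ⟨g, hgG⟩ hwg hg)) (by simpa using hw)
  have he' : e.1 ∈ p.edges := he
  simp [Finset.filter_singleton, he'] at hodd

/-- An alternating cycle contains exactly one edge of each of the two colors at `v`. -/
theorem IsAltCycle.exists_pair (h : IsAltCycle A a b v Z) :
    ∃ e g : G.edgeSet, v ∈ e.1 ∧ v ∈ g.1 ∧ e.1 ∈ Z ∧ g.1 ∈ Z ∧ A e = a ∧ A g = b := by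
  have hpart := @IsAltCycle.exists_partner _ _ _ _ _ _ _ _ h
  have hsub := h.subset
  obtain ⟨p, hp, -, rfl⟩ := h
  obtain ⟨e, he, hve⟩ : ∃ e ∈ p.edgeSet, v ∈ e := by
    cases p with
    | nil => exact absurd hp (by simp)
    | @cons _ w _ h p => exact ⟨s(v, w), by simp [SimpleGraph.Walk.edgeSet], Sym2.mem_mk_left v w⟩
  obtain ⟨heG, hec⟩ := exists_of_mem_twoColor (hsub he)
  obtain ⟨g, hvg, hg, hne⟩ := hpart (e := ⟨e, heG⟩) hve he
  have hgc := (mem_twoColor g).1 (hsub hg)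
  rcases hec with hec | hec
  · exact ⟨⟨e, heG⟩, g, hve, hvg, he, hg, hec, hgc.resolve_left (hec ▸ hne)⟩
  · exact ⟨g, ⟨e, heG⟩, hvg, hve, hg, he, hgc.resolve_right (hec ▸ hne), hec⟩

/-- Flipping an alternating cycle does not change the numbers of edges of each color at the
vertices. -/
theorem IsAltCycle.colorDegree_flip (h : IsAltCycle A a b v Z) (w : V) (f : Fin k) :
    colorDegree (flip a b Z A) w f = colorDegree A w f := by
  classical
  by_cases hw : ∃ e : G.edgeSet, w ∈ e.1 ∧ e.1 ∈ Z
  · obtain ⟨e, hwe, he⟩ := hw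
    obtain ⟨g, hwg, hg, hne⟩ := h.exists_partner hwe he
    have hec := (mem_twoColor e).1 (h.subset he)
    have hgc := (mem_twoColor g).1 (h.subset hg)
    -- at `w`, flipping amounts to interchanging the edges `e` and `g`
    have key : ∀ x : G.edgeSet, w ∈ x.1 → flip a b Z A x = A (Equiv.swap e g x) := by
      intro x hwx
      by_cases hxe : x = e
      · rw [hxe, Equiv.swap_apply_left, flip_apply_mem he,
          swap_eq_of_ne hec hgc hne.symm]
      by_cases hxg : x = g
      · rw [hxg, Equiv.swap_apply_right, flip_apply_mem hg,
          swap_eq_of_ne hgc hec hne]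
      rw [Equiv.swap_apply_of_ne_of_ne hxe hxg, flip_apply_notMem]
      intro hx
      have hxc := (mem_twoColor x).1 (h.subset hx)
      have h1 := h.properOn x e hx he hxe ⟨w, hwx, hwe⟩
      have h2 := h.properOn x g hx hg hxg ⟨w, hwx, hwg⟩
      exact hne (eq_of_ne_of_ne hgc hxc hec h2.symm h1.symm)
    have hmem : ∀ x : G.edgeSet, w ∈ (Equiv.swap e g x).1 ↔ w ∈ x.1 := by
      intro x
      by_cases hxe : x = e
      · simp [hxe, hwe, hwg]
      by_cases hxg : x = g
      · simp [hxg, hwe, hwg]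
      rw [Equiv.swap_apply_of_ne_of_ne hxe hxg]
    have hset : {x : G.edgeSet | w ∈ x.1 ∧ flip a b Z A x = f} =
        Equiv.swap e g '' {x : G.edgeSet | w ∈ x.1 ∧ A x = f} := by
      ext x
      rw [Equiv.image_eq_preimage_symm, Equiv.symm_swap]
      simp only [Set.mem_ofPred_eq, Set.mem_preimage, hmem]
      exact and_congr_right fun hx => by rw [key x hx]
    rw [colorDegree, colorDegree, hset, Set.ncard_image_of_injective _ (Equiv.injective _)]
  · push Not at hw
    rw [colorDegree, colorDegree]
    congr 1
    ext x
    exact and_congr_right fun hx => by rw [flip_apply_notMem (hw x hx)]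

theorem IsAltCycle.flip (h : IsAltCycle A a b v Z) :
    IsAltCycle (LatinChain.flip a b Z A) a b v Z := by
  have hprop : ProperOn (LatinChain.flip a b Z A) Z := by
    intro e f he hf hne hv heq
    rw [flip_apply_mem he, flip_apply_mem hf] at heq
    exact h.properOn e f he hf hne hv ((Equiv.swap a b).injective heq)
  obtain ⟨p, hp, -, hpZ⟩ := h
  rw [IsAltCycle, twoColor_flip]
  exact ⟨p, hp, hpZ.symm ▸ hprop, hpZ⟩

/-- The situation in which the alternating cycle through `v` with the colors `a` and `b` is well
defined: either (`u = v`) both colors occur exactly once at every vertex, or `a` occurs twice at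
`v` and is missing at `u`, and otherwise both colors occur exactly once. -/
structure CycleBase (A : Labeling G k) (a b : Fin k) (v u : V) : Prop where
  ne : a ≠ b
  right : ∀ w, colorDegree A w b = 1
  left : ∀ w, w ≠ v → w ≠ u → colorDegree A w a = 1
  ends : (u = v ∧ colorDegree A v a = 1) ∨
    (u ≠ v ∧ colorDegree A u a = 0 ∧ colorDegree A v a = 2)

theorem CycleBase.left_le (h : CycleBase A a b v u) {w : V} (hw : w ≠ v) :
    colorDegree A w a ≤ 1 := by
  by_cases hwu : w = u
  · rcases h.ends with h' | h'
    · exact absurd (hwu.trans h'.1) hw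
    · rw [hwu, h'.2.1]; omega
  · exact (h.left w hw hwu).le

variable [Finite V]

theorem incidentSum_colorSign (hab : a ≠ b) (A : Labeling G k) (w : V) :
    incidentSum (colorSign A a b) w = colorDegree A w a - colorDegree A w b := by
  classical
  rw [incidentSum]
  have h1 : ∀ e, colorSign A a b e = (if A e = a then 1 else 0) - (if A e = b then 1 else 0) := by
    intro e
    by_cases ha : A e = a
    · simp [colorSign, ha, hab]
    · by_cases hb : A e = b <;> simp [colorSign, ha, hb, hab.symm]
  simp only [h1]
  rw [Finset.sum_sub_distrib, Finset.sum_boole, Finset.sum_boole]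
  have h2 : ∀ f, ((Finset.filter (fun e => A e = f)
      (Set.toFinite {e : G.edgeSet | w ∈ e.1}).toFinset).card) = colorDegree A w f := by
    intro f
    rw [colorDegree, ← Set.ncard_coe_finset]
    congr 1
    ext e
    simp
  rw [h2, h2]

theorem incidentSum_update (η : G.edgeSet → ℤ) (g : G.edgeSet) (w : V)
    [DecidableEq G.edgeSet] [Decidable (w ∈ g.1)] :
    incidentSum (fun e => if e = g then 0 else η e) w =
      incidentSum η w - if w ∈ g.1 then η g else 0 := by
  have h1 : ∀ e, (if e = g then 0 else η e) = η e - if e = g then η g else 0 := by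
    intro e
    by_cases h : e = g <;> simp [h]
  simp only [incidentSum, h1]
  rw [Finset.sum_sub_distrib, Finset.sum_ite_eq']
  simp

theorem CycleBase.eq_of_color_eq (h : CycleBase A a b v u) {w : V} (hw : w ≠ v)
    {e f : G.edgeSet} (he : w ∈ e.1) (hf : w ∈ f.1) (hec : A e = a ∨ A e = b)
    (heq : A e = A f) : e = f := by
  rcases hec with hc | hc
  · exact colorDegree_le_one_iff.1 (h.left_le hw) e f he hf hc (heq ▸ hc)
  · exact colorDegree_le_one_iff.1 (h.right w).le e f he hf hc (heq ▸ hc)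

theorem CycleBase.sign_eq (hs : IsSign G s) (h : CycleBase A a b v u) : s u = s v := by
  classical
  rcases h.ends with h' | h'
  · rw [h'.1]
  · have := sum_sign_mul_incidentSum hs (colorSign A a b) {v, u} (fun w hw => by
      simp only [Finset.mem_insert, Finset.mem_singleton, not_or] at hw
      rw [incidentSum_colorSign h.ne, h.left w hw.1 hw.2, h.right]
      norm_num)
    rw [Finset.sum_pair h'.1.symm, incidentSum_colorSign h.ne, incidentSum_colorSign h.ne,
      h'.2.1, h'.2.2, h.right, h.right] at this
    push_cast at this
    linarith

/-- The two ends of the edge of color `b` at `v` are joined by another two-colored path: otherwise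
the signed count of edges in a component would not vanish. -/
theorem CycleBase.reachable_deleteEdges (hs : IsSign G s) (h : CycleBase A a b v u)
    {g : G.edgeSet} {w : V} (hg : g.1 = s(v, w)) (hgb : A g = b) :
    ((twoColor A a b).deleteEdges {g.1}).Reachable w v := by
  classical
  by_contra hwv
  set F := (twoColor A a b).deleteEdges {g.1} with hF
  have hvw : G.Adj v w := by
    have := g.2
    rwa [hg] at this
  let ε : G.edgeSet → ℤ := fun e => if e = g then 0 else colorSign A a b e
  have hεF : ∀ e : G.edgeSet, e.1 ∉ F.edgeSet → ε e = 0 := by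
    intro e he
    by_cases heg : e = g
    · simp [ε, heg]
    · have : ¬ (A e = a ∨ A e = b) := by
        rw [← mem_twoColor]
        intro he'
        apply he
        rw [hF, SimpleGraph.edgeSet_deleteEdges]
        exact ⟨he', fun h => heg (Subtype.ext h)⟩
      push Not at this
      simp [ε, colorSign, this]
  have hsum : ∀ z, incidentSum ε z =
      colorDegree A z a - colorDegree A z b + if z ∈ g.1 then 1 else 0 := by
    intro z
    rw [incidentSum_update, incidentSum_colorSign h.ne]
    have : colorSign A a b g = -1 := by simp [colorSign, hgb, h.ne.symm]
    rw [this]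
    split_ifs <;> ring
  have hsv : s v + s w = 0 := hs.adj v w hvw
  have hsu : s u = s v := h.sign_eq hs
  have huw : u ≠ w := by
    rintro rfl
    rcases hs.eq_or v with h1 | h1 <;> omega
  have hw1 : incidentSum ε w = 1 := by
    rw [hsum, h.left w hvw.ne' huw.symm, h.right, if_pos (by simp [hg])]
    norm_num
  have hX : ∀ z, z ≠ w → z ≠ u → F.Reachable w z → incidentSum ε z = 0 := by
    intro z hzw hzu hr
    have hzv : z ≠ v := fun h' => hwv (h' ▸ hr)
    rw [hsum, h.left z hzv hzu, h.right, if_neg (by simp [hg, hzv, hzw])]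
    norm_num
  by_cases hru : F.Reachable w u
  · have huv : u ≠ v := fun h' => hwv (h' ▸ hru)
    have hu0 : colorDegree A u a = 0 := by
      rcases h.ends with h' | h'
      · exact absurd h'.1 huv
      · exact h'.2.1
    have hu1 : incidentSum ε u = -1 := by
      rw [hsum, hu0, h.right, if_neg (by simp [hg, huv, huw])]
      norm_num
    have := sum_sign_mul_incidentSum_component hs w ε hεF {w, u} (by simp [hru])
      (fun z hz hr => by
        simp only [Finset.mem_insert, Finset.mem_singleton, not_or] at hz
        exact hX z hz.1 hz.2 hr)
    rw [Finset.sum_pair huw.symm, hw1, hu1] at this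
    rcases hs.eq_or v with h1 | h1 <;> omega
  · have := sum_sign_mul_incidentSum_component hs w ε hεF {w} (by simp)
      (fun z hz hr => by
        simp only [Finset.mem_singleton] at hz
        exact hX z hz (fun h' => hru (h' ▸ hr)) hr)
    rw [Finset.sum_singleton, hw1] at this
    rcases hs.eq_or w with h1 | h1 <;> omega

/-- The edge of color `b` at `v` closes the path between its ends to a cycle. This cycle alternates
even if `a` occurs twice at `v`, since a path has only one edge at its end. -/
theorem CycleBase.exists_isAltCycle (hs : IsSign G s) (h : CycleBase A a b v u) :
    ∃ Z, IsAltCycle A a b v Z := by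
  classical
  obtain ⟨g, ⟨hvg, hgb⟩, hguniq⟩ := colorDegree_eq_one_iff.1 (h.right v)
  obtain ⟨w, hg⟩ := hvg
  have hvg : v ∈ g.1 := by simp [hg]
  obtain ⟨p, hp⟩ := (h.reachable_deleteEdges hs hg hgb).exists_isPath
  have hadj : (twoColor A a b).Adj v w := by
    rw [← SimpleGraph.mem_edgeSet, ← hg, mem_twoColor]
    exact Or.inr hgb
  have hpF : ∀ e ∈ p.edges, e ∈ (twoColor A a b).edgeSet ∧ e ≠ g.1 := by
    intro e he
    have := p.edges_subset_edgeSet he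
    rw [SimpleGraph.edgeSet_deleteEdges] at this
    exact this
  have hle : (twoColor A a b).deleteEdges {g.1} ≤ twoColor A a b := SimpleGraph.deleteEdges_le _
  have hcyc : (SimpleGraph.Walk.cons hadj (p.mapLe hle)).IsCycle := by
    rw [SimpleGraph.Walk.cons_isCycle_iff]
    refine ⟨hp.mapLe hle, fun h' => ?_⟩
    rw [SimpleGraph.Walk.edges_mapLe_eq_edges, ← hg] at h'
    exact (hpF _ h').2 rfl
  have hmem : ∀ e : G.edgeSet, e.1 ∈ (SimpleGraph.Walk.cons hadj (p.mapLe hle)).edgeSet ↔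
      e = g ∨ e.1 ∈ p.edges := by
    intro e
    simp [SimpleGraph.Walk.edgeSet, Subtype.ext_iff, hg]
  refine ⟨_, _, hcyc, ?_, rfl⟩
  rintro e f he hf hef ⟨z, hze, hzf⟩ hc
  have hec := (mem_twoColor e).1
    ((SimpleGraph.Walk.cons hadj (p.mapLe hle)).edges_subset_edgeSet he)
  by_cases hzv : z = v
  · subst hzv
    rcases hec with hec | hec
    · -- the path would have two edges at its end
      have hfc : A f = a := hc ▸ hec
      have hgne : ∀ x : G.edgeSet, A x = a → x ≠ g := by
        rintro x hx rfl
        exact h.ne (hx.symm.trans hgb)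
      have hep := ((hmem e).1 he).resolve_left (hgne e hec)
      have hfp := ((hmem f).1 hf).resolve_left (hgne f hfc)
      have h2 : colorDegree A z a = 2 := by
        have h3 : ¬ colorDegree A z a ≤ 1 := fun h' =>
          hef (colorDegree_le_one_iff.1 h' e f hze hzf hec hfc)
        rcases h.ends with h' | h' <;> omega
      have hpair : ({e, f} : Set G.edgeSet) = {x : G.edgeSet | z ∈ x.1 ∧ A x = a} := by
        refine Set.eq_of_subset_of_ncard_le ?_ ?_
        · rintro x (rfl | rfl)
          · exact ⟨hze, hec⟩
          · exact ⟨hzf, hfc⟩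
        · rw [Set.ncard_pair hef]
          exact h2.le
      have hodd := even_card_filter_trail hp.isTrail z {e.1, f.1} (fun x hx hzx => by
        obtain ⟨hxG, hxc⟩ := exists_of_mem_twoColor (hpF x hx).1
        have hxa : A ⟨x, hxG⟩ = a := hxc.resolve_right fun hxb =>
          (hpF x hx).2 (congrArg Subtype.val (hguniq ⟨x, hxG⟩ ⟨hzx, hxb⟩))
        have : (⟨x, hxG⟩ : G.edgeSet) ∈ ({e, f} : Set G.edgeSet) := by
          rw [hpair]
          exact ⟨hzx, hxa⟩
        rcases this with rfl | rfl <;> simp) (by simp [hze, hzf])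
      have hne : e.1 ≠ f.1 := fun h' => hef (Subtype.ext h')
      have hwz : w ≠ z := by
        rintro rfl
        exact hadj.ne rfl
      simp [Finset.filter_insert, Finset.filter_singleton, hep, hfp, hne, hwz] at hodd
    · exact hef (colorDegree_le_one_iff.1 (h.right z).le e f hze hzf hec (hc ▸ hec))
  · exact hef (h.eq_of_color_eq hzv hze hzf hec hc)

/-- Two alternating cycles through `v` contain the same edges at `v`: the symmetric difference
would otherwise violate the signed count of edges. -/
theorem CycleBase.eq_of_isAltCycle_left (hs : IsSign G s) (h : CycleBase A a b v u)
    (hZ : IsAltCycle A a b v Z) (hZ' : IsAltCycle A a b v Z') {e e' : G.edgeSet}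
    (hve : v ∈ e.1) (hve' : v ∈ e'.1) (he : e.1 ∈ Z) (he' : e'.1 ∈ Z') (hea : A e = a)
    (hea' : A e' = a) : e = e' := by
  classical
  by_contra hne
  let ε : G.edgeSet → ℤ := fun x => if x.1 ∈ Z ↔ x.1 ∈ Z' then 0 else colorSign A a b x
  have hε : ∀ x : G.edgeSet, ε x ≠ 0 → ¬ (x.1 ∈ Z ↔ x.1 ∈ Z') := by
    intro x hx h'
    exact hx (if_pos h')
  have hcol : ∀ (Z : Set (Sym2 V)), IsAltCycle A a b v Z → ∀ w (x y : G.edgeSet), w ∈ x.1 →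
      w ∈ y.1 → x.1 ∈ Z → y.1 ∈ Z → A x = A y → x = y := by
    intro Z hZ w x y hx hy hxZ hyZ hxy
    by_contra hne
    exact hZ.properOn x y hxZ hyZ hne ⟨w, hx, hy⟩ hxy
  -- away from `v`, the symmetric difference contains both edges of a cycle or none
  have hoff : ∀ (Z Z' : Set (Sym2 V)), IsAltCycle A a b v Z → IsAltCycle A a b v Z' → ∀ w,
      w ≠ v → ∀ x : G.edgeSet, w ∈ x.1 → x.1 ∈ Z → x.1 ∉ Z' →
      ∃ y : G.edgeSet, w ∈ y.1 ∧ y.1 ∈ Z ∧ y.1 ∉ Z' ∧ A y ≠ A x := by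
    intro Z Z' hZ hZ' w hwv x hwx hxZ hxZ'
    obtain ⟨y, hwy, hyZ, hyx⟩ := hZ.exists_partner hwx hxZ
    refine ⟨y, hwy, hyZ, fun hyZ' => ?_, hyx⟩
    obtain ⟨x', hwx', hx'Z', hx'y⟩ := hZ'.exists_partner hwy hyZ'
    have hxc := (mem_twoColor x).1 (hZ.subset hxZ)
    have hyc := (mem_twoColor y).1 (hZ.subset hyZ)
    have hx'c := (mem_twoColor x').1 (hZ'.subset hx'Z')
    have : A x = A x' := eq_of_ne_of_ne hxc hyc hx'c hyx.symm hx'y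
    exact hxZ' (h.eq_of_color_eq hwv hwx hwx' hxc this ▸ hx'Z')
  have hzero : ∀ w, w ∉ ({v} : Finset V) → incidentSum ε w = 0 := by
    intro w hw
    rw [Finset.mem_singleton] at hw
    by_cases hex : ∃ x : G.edgeSet, w ∈ x.1 ∧ ε x ≠ 0
    · obtain ⟨x, hwx, hx⟩ := hex
      have hxor := hε x hx
      obtain ⟨y, hwy, hyor, hyc, hxc, hyx⟩ : ∃ y : G.edgeSet, w ∈ y.1 ∧
          ¬ (y.1 ∈ Z ↔ y.1 ∈ Z') ∧ (A y = a ∨ A y = b) ∧ (A x = a ∨ A x = b) ∧ A y ≠ A x := by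
        by_cases hxZ : x.1 ∈ Z
        · have hxZ' : x.1 ∉ Z' := fun h' => hxor (iff_of_true hxZ h')
          obtain ⟨y, h1, h2, h3, h4⟩ := hoff Z Z' hZ hZ' w hw x hwx hxZ hxZ'
          exact ⟨y, h1, by tauto, (mem_twoColor y).1 (hZ.subset h2),
            (mem_twoColor x).1 (hZ.subset hxZ), h4⟩
        · have hxZ' : x.1 ∈ Z' := by tauto
          obtain ⟨y, h1, h2, h3, h4⟩ := hoff Z' Z hZ' hZ w hw x hwx hxZ' hxZ
          exact ⟨y, h1, by tauto, (mem_twoColor y).1 (hZ'.subset h2),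
            (mem_twoColor x).1 (hZ'.subset hxZ'), h4⟩
      have hxy : x ≠ y := fun h' => hyx (h' ▸ rfl)
      rw [incidentSum_eq_pair hxy hwx hwy]
      · simp only [ε, if_neg hxor, if_neg hyor, colorSign]
        rcases hxc with h1 | h1 <;> rcases hyc with h2 | h2 <;> rw [h1, h2] at hyx ⊢ <;>
          simp [h.ne.symm] at hyx ⊢
      · intro z hwz hzx hzy
        by_contra hz
        have hzor := hε z hz
        have hzc : A z = a ∨ A z = b := by
          by_cases hzZ : z.1 ∈ Z
          · exact (mem_twoColor z).1 (hZ.subset hzZ)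
          · exact (mem_twoColor z).1 (hZ'.subset (by tauto))
        have h1 : A z ≠ A x := fun h' => hzx (h.eq_of_color_eq hw hwz hwx hzc h')
        have h2 : A z ≠ A y := fun h' => hzy (h.eq_of_color_eq hw hwz hwy hzc h')
        exact hyx (eq_of_ne_of_ne hyc hzc hxc h2.symm h1.symm)
    · push Not at hex
      exact incidentSum_eq_zero hex
  have h0 := sum_sign_mul_incidentSum hs ε {v} hzero
  have heZ' : e.1 ∉ Z' := fun h' => hne (hcol Z' hZ' v e e' hve hve' h' he' (hea.trans hea'.symm))
  have he'Z : e'.1 ∉ Z := fun h' => hne (hcol Z hZ v e e' hve hve' he h' (hea.trans hea'.symm))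
  have hv : incidentSum ε v = 2 := by
    rw [incidentSum_eq_pair hne hve hve']
    · simp [ε, he, he', heZ', he'Z, colorSign, hea, hea']
    · intro z hvz hze hze'
      by_contra hz
      have hzor := hε z hz
      -- both cycles contain the only edge of color `b` at `v`
      have key : ∀ (Y Y' : Set (Sym2 V)) (x : G.edgeSet), IsAltCycle A a b v Y →
          IsAltCycle A a b v Y' → v ∈ x.1 → x.1 ∈ Y → A x = a → z.1 ∈ Y → z.1 ∉ Y' → z = x := by
        intro Y Y' x hY hY' hvx hx hxa hzY hzY'
        rcases (mem_twoColor z).1 (hY.subset hzY) with hza | hzb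
        · exact hcol Y hY v z x hvz hvx hzY hx (hza.trans hxa.symm)
        · obtain ⟨-, g, -, hvg, -, hg, -, hgb⟩ := hY'.exists_pair
          exact absurd (colorDegree_le_one_iff.1 (h.right v).le z g hvz hvg hzb hgb ▸ hg) hzY'
      by_cases hzZ : z.1 ∈ Z
      · exact hze (key Z Z' e hZ hZ' hve he hea hzZ (by tauto))
      · exact hze' (key Z' Z e' hZ' hZ hve' he' hea' (by tauto) hzZ)
  rw [Finset.sum_singleton, hv] at h0
  rcases hs.eq_or v with h1 | h1 <;> omega

/-- Starting from the common edges at `v`, a cycle is followed edge by edge: away from `v`, the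
continuation in the other color is unique. -/
theorem CycleBase.subset_of_isAltCycle (hs : IsSign G s) (h : CycleBase A a b v u)
    (hZ : IsAltCycle A a b v Z) (hZ' : IsAltCycle A a b v Z') : Z ⊆ Z' := by
  obtain ⟨e, g, hve, hvg, he, hg, hea, hgb⟩ := hZ.exists_pair
  obtain ⟨e', g', hve', hvg', he', hg', hea', hgb'⟩ := hZ'.exists_pair
  obtain rfl := h.eq_of_isAltCycle_left hs hZ hZ' hve hve' he he' hea hea'
  obtain rfl := colorDegree_le_one_iff.1 (h.right v).le g g' hvg hvg' hgb hgb'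
  have hZp := hZ.properOn
  have hZs := hZ.subset
  have hpart := @IsAltCycle.exists_partner _ _ _ _ _ _ _ _ hZ'
  obtain ⟨p, hp, hprop, rfl⟩ := hZ
  have hv : ∀ x : G.edgeSet, v ∈ x.1 → x.1 ∈ p.edgeSet → x.1 ∈ Z' := by
    intro x hvx hx
    rcases (mem_twoColor x).1 (hZs hx) with hc | hc
    · by_cases hxe : x = e
      · rwa [hxe]
      · exact absurd (hc.trans hea.symm) (hZp x e hx he hxe ⟨v, hvx, hve⟩)
    · rwa [colorDegree_le_one_iff.1 (h.right v).le x g hvx hvg hc hgb]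
  have key : ∀ w ∈ p.toSubgraph.verts, ∀ x : G.edgeSet, w ∈ x.1 → x.1 ∈ p.edgeSet →
      x.1 ∈ Z' := by
    intro w hw
    refine induction_on_connected p.toSubgraph_connected
      (Q := fun w => ∀ x : G.edgeSet, w ∈ x.1 → x.1 ∈ p.edgeSet → x.1 ∈ Z')
      p.start_mem_verts_toSubgraph hv ?_ hw
    intro c d hcd hc x hdx hx
    by_cases hdv : d = v
    · exact hv x (hdv ▸ hdx) hx
    have hcdp : s(c, d) ∈ p.edgeSet := by
      rw [← p.edgeSet_toSubgraph]
      exact hcd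
    obtain ⟨hcdG, hcdc⟩ := exists_of_mem_twoColor (hZs hcdp)
    set y : G.edgeSet := ⟨s(c, d), hcdG⟩ with hy
    have hdy : d ∈ y.1 := Sym2.mem_mk_right c d
    have hyZ' := hc y (Sym2.mem_mk_left c d) hcdp
    by_cases hxy : x = y
    · rwa [hxy]
    obtain ⟨x', hdx', hx', hne⟩ := hpart hdy hyZ'
    have hxc := (mem_twoColor x).1 (hZs hx)
    have hx'c := (mem_twoColor x').1 (hZ'.subset hx')
    have hxy' := hZp x y hx hcdp hxy ⟨d, hdx, hdy⟩
    have : A x = A x' := eq_of_ne_of_ne hxc hcdc hx'c hxy' hne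
    rwa [h.eq_of_color_eq hdv hdx hdx' hxc this]
  intro x hx
  obtain ⟨hxG, -⟩ := exists_of_mem_twoColor (hZs hx)
  obtain ⟨w, hw⟩ : ∃ w, w ∈ x := by
    induction x using Sym2.ind with
    | _ a b => exact ⟨a, Sym2.mem_mk_left a b⟩
  refine key w ?_ ⟨x, hxG⟩ hw hx
  rw [p.mem_verts_toSubgraph]
  exact p.mem_support_of_mem_edges hx hw

theorem CycleBase.altCycle_eq (hs : IsSign G s) (h : CycleBase A a b v u)
    (hZ : IsAltCycle A a b v Z) : altCycle A a b v = Z := by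
  ext g
  rw [mem_altCycle]
  constructor
  · rintro ⟨Z', hZ', hg⟩
    exact h.subset_of_isAltCycle hs hZ' hZ hg
  · exact fun hg => ⟨Z, hZ, hg⟩

theorem CycleBase.isAltCycle_altCycle (hs : IsSign G s) (h : CycleBase A a b v u) :
    IsAltCycle A a b v (altCycle A a b v) := by
  obtain ⟨Z, hZ⟩ := h.exists_isAltCycle hs
  rwa [h.altCycle_eq hs hZ]

theorem CycleBase.colorDegree_flip (hs : IsSign G s) (h : CycleBase A a b v u) (w : V)
    (f : Fin k) : colorDegree (flip a b (altCycle A a b v) A) w f = colorDegree A w f :=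
  (h.isAltCycle_altCycle hs).colorDegree_flip w f

theorem CycleBase.flip (hs : IsSign G s) (h : CycleBase A a b v u) :
    CycleBase (LatinChain.flip a b (altCycle A a b v) A) a b v u := by
  refine ⟨h.ne, ?_, ?_, ?_⟩ <;> simp only [h.colorDegree_flip hs]
  exacts [h.right, h.left, h.ends]

theorem CycleBase.altCycle_flip (hs : IsSign G s) (h : CycleBase A a b v u) :
    altCycle (LatinChain.flip a b (altCycle A a b v) A) a b v = altCycle A a b v :=
  (h.flip hs).altCycle_eq hs (h.isAltCycle_altCycle hs).flip

end AltCycle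

/-! ### Probabilities of random choices -/

section Random

variable {α β : Type*}

theorem coin_bind_apply (p q : PMF β) (y : β) :
    (coin.bind fun b => if b then p else q) y = 2⁻¹ * p y + 2⁻¹ * q y := by
  rw [PMF.bind_apply, tsum_bool]
  simp [coin, PMF.uniformOfFintype_apply, add_comm]

variable [Finite α] {s : Set α} {d : β} {f : α → PMF β} {y : β}

theorem pick_of_empty (h : ¬ s.Nonempty) : pick s d f = PMF.pure d := by
  simp [pick, h]

theorem pick_apply (h : s.Nonempty) :
    pick s d f y = ∑' x, s.indicator (fun x => (s.ncard : ℝ≥0∞)⁻¹ * f x y) x := by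
  classical
  rw [pick, dif_pos h, PMF.bind_apply]
  refine tsum_congr fun x => ?_
  rw [PMF.uniformOfFinset_apply, ← Set.ncard_eq_toFinset_card]
  by_cases hx : x ∈ s <;> simp [hx]

theorem le_pick {x : α} (hx : x ∈ s) : (s.ncard : ℝ≥0∞)⁻¹ * f x y ≤ pick s d f y := by
  rw [pick_apply ⟨x, hx⟩]
  refine le_trans ?_ (ENNReal.le_tsum x)
  rw [Set.indicator_of_mem hx]

theorem le_pick_of_le {x : α} (hx : x ∈ s) {n : ℕ} (hn : s.ncard ≤ n) {q : ℝ≥0∞} (hq : q ≤ f x y) :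
    (n : ℝ≥0∞)⁻¹ * q ≤ pick s d f y :=
  (mul_le_mul' (ENNReal.inv_le_inv.2 (by exact_mod_cast hn)) hq).trans (le_pick hx)

theorem le_pick_pure {x : α} (hx : x ∈ s) {g : α → β} {n : ℕ} (hn : s.ncard ≤ n) :
    (n : ℝ≥0∞)⁻¹ ≤ pick s d (fun x => PMF.pure (g x)) (g x) := by
  have := le_pick_of_le (d := d) (f := fun x => PMF.pure (g x)) (y := g x) hx hn (q := 1) (by simp)
  rwa [mul_one] at this

theorem exists_of_pick_ne_zero (h : pick s d f y ≠ 0) :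
    (¬ s.Nonempty ∧ y = d) ∨ ∃ x ∈ s, f x y ≠ 0 := by
  by_cases hs : s.Nonempty
  · right
    rw [pick_apply hs] at h
    by_contra hno
    push Not at hno
    refine h (ENNReal.tsum_eq_zero.2 fun x => ?_)
    by_cases hx : x ∈ s <;> simp [hx, hno]
  · left
    rw [pick_of_empty hs, PMF.pure_apply] at h
    exact ⟨hs, by by_contra h'; simp [h'] at h⟩

theorem pick_pure_le (hs : s.Nonempty) {g : α → β}
    (huniq : ∀ x ∈ s, ∀ x' ∈ s, g x = y → g x' = y → x = x') :
    pick s d (fun x => PMF.pure (g x)) y ≤ (s.ncard : ℝ≥0∞)⁻¹ := by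
  classical
  rw [pick_apply hs]
  by_cases hex : ∃ x ∈ s, g x = y
  · obtain ⟨x, hx, hxy⟩ := hex
    rw [tsum_eq_single x]
    · rw [Set.indicator_of_mem hx]
      simp [hxy]
    · intro x' hne
      by_cases hx' : x' ∈ s
      · have : y ≠ g x' := fun h' => hne (huniq x' hx' x hx h'.symm hxy)
        simp [hx', PMF.pure_apply, this]
      · simp [hx']
  · push Not at hex
    rw [ENNReal.tsum_eq_zero.2]
    · exact zero_le
    · intro x
      by_cases hx : x ∈ s
      · have : y ≠ g x := (hex x hx).symm
        simp [hx, PMF.pure_apply, this]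
      · simp [hx]

end Random

theorem pure_ne_zero_iff {β : Type*} {x y : β} : (PMF.pure x) y ≠ 0 ↔ y = x := by
  classical
  rw [PMF.pure_apply]
  simp

/-! ### The phases of a step -/

section Phases

variable {V : Type*} {G : SimpleGraph V} {k : ℕ} {A C D : Labeling G k}
  {c d f : Fin k} {S T : Set (Sym2 V)} {x y v : V} {s : V → ℤ}

theorem TwoDeficient.setOf_isDeficient (h : TwoDeficient c d A x y) :
    {v | IsDeficient A v} = {x, y} := by
  ext v
  simp [h.deficient_iff]

theorem TwoDeficient.ncard_isDeficient (h : TwoDeficient c d A x y) :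
    {v | IsDeficient A v}.ncard = 2 := by
  rw [h.setOf_isDeficient, Set.ncard_pair h.ne_vertex]

theorem TwoDeficient.exists_isDeficient (h : TwoDeficient c d A x y) : ∃ v, IsDeficient A v :=
  ⟨x, (h.deficient_iff x).2 (Or.inl rfl)⟩

theorem altPath_comm (A : Labeling G k) (c d : Fin k) (v : V) (e : G.edgeSet) :
    altPath A c d v e = altPath A d c v e := by
  rw [altPath, altPath, twoColor_comm]

variable [Finite V]

theorem inv_two_le_create_self (q : Choice k) (C : Labeling G k) : 2⁻¹ ≤ create q C C := by
  cases q with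
  | stay => simp [create]
  | two c d =>
    rw [create, coin_bind_apply]
    refine le_trans ?_ le_self_add
    simp
  | three c d f =>
    rw [create, coin_bind_apply]
    refine le_trans ?_ le_self_add
    simp

theorem le_create_two (hS : S ∈ connectedPieces C c d) :
    2⁻¹ * ((connectedPieces C c d).ncard : ℝ≥0∞)⁻¹ ≤ create (.two c d) C (flip c d S C) := by
  rw [create, coin_bind_apply]
  refine le_trans ?_ le_add_self
  gcongr
  exact le_pick_pure hS le_rfl

theorem le_create_three (hS : S ∈ evenPaths C c d) {n : ℕ} (hn : (evenPaths C c d).ncard ≤ n) :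
    2⁻¹ * (n : ℝ≥0∞)⁻¹ ≤ create (.three c d f) C (flip c d S C) := by
  rw [create, coin_bind_apply]
  refine le_trans ?_ le_add_self
  gcongr
  exact le_pick_pure hS hn

theorem exists_of_create_two (h : create (.two c d) C A ≠ 0) :
    A = C ∨ ∃ S ∈ connectedPieces C c d, A = flip c d S C := by
  by_contra hno
  push Not at hno
  apply h
  rw [create, coin_bind_apply]
  have h1 : (PMF.pure C) A = 0 := by
    by_contra h1
    exact hno.1 (pure_ne_zero_iff.1 h1)
  rw [h1, mul_zero, zero_add]
  by_contra h2
  rcases exists_of_pick_ne_zero (right_ne_zero_of_mul h2) with h3 | ⟨S, hS, h3⟩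
  · exact hno.1 h3.2
  · exact hno.2 S hS (pure_ne_zero_iff.1 h3)

theorem exists_of_create_three (h : create (.three c d f) C A ≠ 0) :
    A = C ∨ ∃ S ∈ evenPaths C c d, A = flip c d S C := by
  by_contra hno
  push Not at hno
  apply h
  rw [create, coin_bind_apply]
  have h1 : (PMF.pure C) A = 0 := by
    by_contra h1
    exact hno.1 (pure_ne_zero_iff.1 h1)
  rw [h1, mul_zero, zero_add]
  by_contra h2
  rcases exists_of_pick_ne_zero (right_ne_zero_of_mul h2) with h3 | ⟨S, hS, h3⟩
  · exact hno.1 h3.2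
  · exact hno.2 S hS (pure_ne_zero_iff.1 h3)

theorem create_two_le (hcd : c ≠ d) (hA : A ≠ C) :
    create (.two c d) C A ≤ 2⁻¹ * ((connectedPieces C c d).ncard : ℝ≥0∞)⁻¹ := by
  classical
  rw [create, coin_bind_apply, PMF.pure_apply, if_neg hA, mul_zero, zero_add]
  gcongr
  by_cases hne : (connectedPieces C c d).Nonempty
  · refine pick_pure_le hne fun S hS T hT h1 h2 => ?_
    exact eq_of_flip_eq hcd (subset_of_mem_connectedPieces hS).1
      (subset_of_mem_connectedPieces hT).1 (h1.trans h2.symm)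
  · rw [pick_of_empty hne, PMF.pure_apply, if_neg hA]
    exact zero_le

theorem create_three_le (hA : A ≠ C) : create (.three c d f) C A ≤ 2⁻¹ := by
  classical
  rw [create, coin_bind_apply, PMF.pure_apply, if_neg hA, mul_zero, zero_add]
  exact mul_le_of_le_one_right' (PMF.coe_le_one _ _)

theorem Balanced.ncard_repeatedEdges (h : Balanced c d A) (hv : IsDeficient A v) :
    (repeatedEdges A v).ncard = 2 := by
  obtain ⟨e₁, e₂, hp⟩ := h.exists_isPair v
  rw [h.repeatedEdges_eq hv hp, Set.ncard_pair hp.1]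

theorem inv_two_mul_inv_two : ((2 : ℕ) : ℝ≥0∞)⁻¹ * ((2 : ℕ) : ℝ≥0∞)⁻¹ = 4⁻¹ := by
  rw [← ENNReal.mul_inv (by simp) (by simp)]
  norm_num

/-- The random choice of a deficient vertex and of an edge of the repeated color. -/
theorem TwoDeficient.le_pick_pick (h : TwoDeficient c d A x y) (hv : v = x ∨ v = y)
    {e : G.edgeSet} (hve : v ∈ e.1) (hec : A e = c ∨ A e = d) (g : V → G.edgeSet → Labeling G k)
    (hD : D = g v e) :
    4⁻¹ ≤ (pick {v | IsDeficient A v} A fun v =>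
      pick (repeatedEdges A v) A fun e => PMF.pure (g v e)) D := by
  have hdef := (h.deficient_iff v).2 hv
  rw [← inv_two_mul_inv_two]
  refine le_pick_of_le (x := v) hdef h.ncard_isDeficient.le ?_
  rw [hD]
  exact le_pick_pure (g := g v) ((h.mem_repeatedEdges_iff hdef).2 ⟨hve, hec⟩)
    (h.ncard_repeatedEdges hdef).le

theorem TwoDeficient.exists_of_pick_pick (h : TwoDeficient c d A x y)
    (g : V → G.edgeSet → Labeling G k)
    (hD : (pick {v | IsDeficient A v} A fun v =>
      pick (repeatedEdges A v) A fun e => PMF.pure (g v e)) D ≠ 0) :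
    ∃ v e, (v = x ∨ v = y) ∧ v ∈ e.1 ∧ (A e = c ∨ A e = d) ∧ D = g v e := by
  rcases exists_of_pick_ne_zero hD with h1 | ⟨v, hv, h1⟩
  · exact absurd h.exists_isDeficient h1.1
  rcases exists_of_pick_ne_zero h1 with h2 | ⟨e, he, h2⟩
  · refine absurd ?_ h2.1
    obtain ⟨e₁, e₂, hp⟩ := h.exists_isPair v
    exact ⟨e₁, (h.mem_repeatedEdges_iff hv).2 hp.left⟩
  · have he' := (h.mem_repeatedEdges_iff hv).1 he
    exact ⟨v, e, (h.deficient_iff v).1 hv, he'.1, he'.2, pure_ne_zero_iff.1 h2⟩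

theorem TwoDeficient.perturb_two (h : TwoDeficient c d A x y) :
    perturb (.two c d) A = pick {v | IsDeficient A v} A fun v =>
      pick (repeatedEdges A v) A fun e => PMF.pure (LatinChain.flip c d {e.1} A) := by
  rw [perturb, if_pos h.exists_isDeficient]

theorem IsEdgeColoring.perturb_two (h : IsEdgeColoring A) (D : Labeling G k) :
    perturb (.two c d) A D = 2⁻¹ * (PMF.pure A) D + 2⁻¹ *
      (pick {e : G.edgeSet | A e = c ∨ A e = d} A
        fun e => PMF.pure (LatinChain.flip c d {e.1} A)) D := by
  rw [perturb, if_neg (fun ⟨v, hv⟩ => h.not_isDeficient v hv), coin_bind_apply]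

theorem IsEdgeColoring.inv_two_le_perturb_two (h : IsEdgeColoring A) :
    2⁻¹ ≤ perturb (.two c d) A A := by
  rw [h.perturb_two]
  refine le_trans ?_ le_self_add
  simp

theorem IsEdgeColoring.le_perturb_two (h : IsEdgeColoring A) {e : G.edgeSet}
    (he : A e = c ∨ A e = d) {n : ℕ} (hn : Nat.card G.edgeSet ≤ n) :
    2⁻¹ * (n : ℝ≥0∞)⁻¹ ≤ perturb (.two c d) A (LatinChain.flip c d {e.1} A) := by
  rw [h.perturb_two]
  refine le_trans ?_ le_add_self
  gcongr
  refine le_pick_pure (s := {e : G.edgeSet | A e = c ∨ A e = d}) he (le_trans ?_ hn)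
  exact Set.ncard_le_card _

theorem IsEdgeColoring.perturb_two_le (h : IsEdgeColoring A) (hD : D ≠ A) :
    perturb (.two c d) A D ≤ 2⁻¹ := by
  classical
  rw [h.perturb_two, PMF.pure_apply, if_neg hD, mul_zero, zero_add]
  exact mul_le_of_le_one_right' (PMF.coe_le_one _ _)

theorem IsEdgeColoring.exists_of_perturb_two (h : IsEdgeColoring A)
    (hD : perturb (.two c d) A D ≠ 0) :
    D = A ∨ ∃ e : G.edgeSet, (A e = c ∨ A e = d) ∧ D = LatinChain.flip c d {e.1} A := by
  by_contra hno
  push Not at hno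
  apply hD
  have h1 : (PMF.pure A) D = 0 := by
    by_contra h1
    exact hno.1 (pure_ne_zero_iff.1 h1)
  rw [h.perturb_two, h1, mul_zero, zero_add]
  by_contra h2
  rcases exists_of_pick_ne_zero (right_ne_zero_of_mul h2) with h3 | ⟨e, he, h3⟩
  · exact hno.1 h3.2
  · exact hno.2 e he (pure_ne_zero_iff.1 h3)

theorem IsEdgeColoring.eliminateColors (h : IsEdgeColoring A) :
    eliminateColors c d A = PMF.pure A := by
  rw [LatinChain.eliminateColors, pick_of_empty]
  rintro ⟨v, hv⟩
  exact h.not_isDeficient v hv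

theorem eliminateColors_comm (c d : Fin k) (A : Labeling G k) :
    eliminateColors c d A = eliminateColors d c A := by
  simp only [eliminateColors, flip_comm_colors c d, altPath_comm A c d]

/-- Every elimination flips a path between the deficient vertices. -/
theorem TwoDeficient.exists_of_eliminateColors (hs : IsSign G s) (h : TwoDeficient c d A x y)
    (hD : LatinChain.eliminateColors c d A D ≠ 0) :
    ∃ S, IsPathSet A c d x y S ∧ D = LatinChain.flip c d S A := by
  obtain ⟨v, e, hv, hve, hec, rfl⟩ := h.exists_of_pick_pick
    (fun v e => LatinChain.flip c d (altPath A c d v e) A) hD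
  rcases hv with rfl | rfl
  · obtain ⟨S, hS, he⟩ := h.exists_isPathSet hs hve hec
    exact ⟨S, hS, by rw [h.altPath_eq hS hve he]⟩
  · obtain ⟨S, hS, he⟩ := h.symm_vertex.exists_isPathSet hs hve hec
    exact ⟨S, hS.symm_vertex, by rw [h.symm_vertex.altPath_eq hS hve he]⟩

/-- Every path between the deficient vertices can be flipped by the elimination. -/
theorem TwoDeficient.le_eliminateColors (h : TwoDeficient c d A x y)
    (hS : IsPathSet A c d x y S) :
    4⁻¹ ≤ LatinChain.eliminateColors c d A (LatinChain.flip c d S A) := by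
  obtain ⟨p, hp, hpS⟩ := id hS
  obtain ⟨e, he, hxe⟩ := exists_edge_of_walk p h.ne_vertex
  rw [hpS] at he
  obtain ⟨heG, hec⟩ := exists_of_mem_twoColor (hS.subset he)
  refine h.le_pick_pick (Or.inl rfl) (e := ⟨e, heG⟩) hxe hec
    (fun v e => LatinChain.flip c d (altPath A c d v e) A) ?_
  rw [h.altPath_eq hS hxe he]

end Phases

/-! ### The second phase for three colors -/

section ThreeColors

variable {V : Type*} {G : SimpleGraph V} {k : ℕ} {A C D : Labeling G k}
  {a c d f : Fin k} {S T : Set (Sym2 V)} {x y v : V} {s : V → ℤ}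

theorem isEdgeColoring_of_colorDegree_eq [Finite V]
    (h : ∀ v f, colorDegree D v f = colorDegree A v f)
    (hA : IsEdgeColoring A) : IsEdgeColoring D := by
  rw [isEdgeColoring_iff] at hA ⊢
  intro v f
  rw [h]
  exact hA v f

theorem TwoDeficient.of_colorDegree_eq (h : TwoDeficient c d A x y)
    (hD : ∀ v f, colorDegree D v f = colorDegree A v f) : TwoDeficient c d D x y := by
  refine ⟨⟨h.ne, ?_, ?_⟩, h.ne_vertex, fun v => ?_⟩
  · simpa only [hD] using h.pair
  · simpa only [hD] using h.other
  · rw [← h.deficient_iff v]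
    simp only [IsDeficient, HasDeficiency, hD]

theorem IsEdgeColoring.cycleBase [Finite V] (hreg : ∀ v, {e : G.edgeSet | v ∈ e.1}.ncard = k)
    (hA : IsEdgeColoring A) (hac : a ≠ c) (v : V) : CycleBase A a c v v :=
  ⟨hac, fun w => hA.colorDegree_eq_one hreg w c, fun w _ _ => hA.colorDegree_eq_one hreg w a,
    Or.inl ⟨rfl, hA.colorDegree_eq_one hreg v a⟩⟩

variable [Finite V]

/-- If the two deficient vertices are in the same class of the bipartition, then the color that
is repeated at one of them is missing at the other. -/
theorem TwoDeficient.colorDegree_eq_zero (hs : IsSign G s) (h : TwoDeficient c d A x y)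
    (hxy : s x = s y) (hx : colorDegree A x c = 2) : colorDegree A y c = 0 := by
  classical
  have hsum := sum_sign_mul_incidentSum hs (colorSign A c d) {x, y} (fun w hw => by
    simp only [Finset.mem_insert, Finset.mem_singleton, not_or] at hw
    have hnd : ¬ IsDeficient A w := fun h' => by
      rcases (h.deficient_iff w).1 h' with h1 | h1
      exacts [hw.1 h1, hw.2 h1]
    rw [h.isDeficient_iff, not_not] at hnd
    have := h.pair w
    rw [incidentSum_colorSign h.ne]
    omega)
  rw [Finset.sum_pair h.ne_vertex, incidentSum_colorSign h.ne, incidentSum_colorSign h.ne,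
    hxy] at hsum
  have h1 := h.pair x
  have h2 := h.pair y
  rcases hs.eq_or y with h3 | h3 <;> rw [h3] at hsum <;> omega

/-- With a third color, the repeated color of a deficient vertex forms a unique alternating cycle
through this vertex, provided that the other deficient vertex is in the same class of the
bipartition. -/
theorem TwoDeficient.cycleBase (hs : IsSign G s) (h : TwoDeficient c d A x y) (hxy : s x = s y)
    (hfc : f ≠ c) (hfd : f ≠ d) (ha : a = c ∨ a = d) (hx : colorDegree A x a = 2) :
    CycleBase A a f x y := by
  have key : ∀ c d, TwoDeficient c d A x y → f ≠ c → f ≠ d → colorDegree A x c = 2 →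
      CycleBase A c f x y := by
    intro c d h hfc hfd hx
    refine ⟨hfc.symm, fun w => h.other w f hfc hfd, fun w hwx hwy => ?_,
      Or.inr ⟨h.ne_vertex.symm, h.colorDegree_eq_zero hs hxy hx, hx⟩⟩
    have hnd : ¬ IsDeficient A w := fun h' => by
      rcases (h.deficient_iff w).1 h' with h1 | h1
      exacts [hwx h1, hwy h1]
    rwa [h.isDeficient_iff, not_not] at hnd
  rcases ha with rfl | rfl
  · exact key _ _ h hfc hfd hx
  · exact key _ _ h.symm_colors hfd hfc hx

theorem TwoDeficient.le_perturb_three (h : TwoDeficient c d A x y) (hv : v = x ∨ v = y)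
    (ha : a = c ∨ a = d) (hva : colorDegree A v a = 2) :
    2⁻¹ ≤ perturb (.three c d f) A (LatinChain.flip a f (altCycle A a f v) A) := by
  rw [perturb, if_pos h.exists_isDeficient]
  have hA : a = if colorDegree A v c = 2 then c else d := by
    have := h.pair v
    rcases ha with rfl | rfl
    · rw [if_pos hva]
    · rw [if_neg (by omega)]
  have := le_pick_pure (d := A) (s := {v | IsDeficient A v}) ((h.deficient_iff v).2 hv)
    (g := fun v => LatinChain.flip (if colorDegree A v c = 2 then c else d) f
      (altCycle A (if colorDegree A v c = 2 then c else d) f v) A) h.ncard_isDeficient.le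
  rw [← hA] at this
  exact this

theorem TwoDeficient.exists_of_perturb_three (h : TwoDeficient c d A x y)
    (hD : perturb (.three c d f) A D ≠ 0) :
    ∃ v a, (v = x ∨ v = y) ∧ (a = c ∨ a = d) ∧ colorDegree A v a = 2 ∧
      D = LatinChain.flip a f (altCycle A a f v) A := by
  rw [perturb, if_pos h.exists_isDeficient] at hD
  rcases exists_of_pick_ne_zero hD with h1 | ⟨v, hv, h1⟩
  · exact absurd h.exists_isDeficient h1.1
  refine ⟨v, if colorDegree A v c = 2 then c else d, (h.deficient_iff v).1 hv, ?_, ?_,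
    pure_ne_zero_iff.1 h1⟩
  · split_ifs <;> simp
  · have h2 := h.isDeficient_iff.1 hv
    have := h.pair v
    split_ifs with h3
    · exact h3
    · omega

theorem IsEdgeColoring.perturb_three (h : IsEdgeColoring A) :
    perturb (.three c d f) A = pick {v | ¬ IsDeficient A v} A fun v =>
      pick {g : G.edgeSet | v ∈ g.1 ∧ (A g = c ∨ A g = d)} A fun g =>
        PMF.pure (LatinChain.flip (A g) f (altCycle A (A g) f v) A) := by
  rw [perturb, if_neg (fun ⟨v, hv⟩ => h.not_isDeficient v hv)]

theorem IsEdgeColoring.le_perturb_three (h : IsEdgeColoring A) (hb : Balanced c d A)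
    {g : G.edgeSet} (hv : v ∈ g.1) (hg : A g = c ∨ A g = d) :
    (Nat.card V : ℝ≥0∞)⁻¹ * 2⁻¹ ≤
      perturb (.three c d f) A (LatinChain.flip (A g) f (altCycle A (A g) f v) A) := by
  rw [h.perturb_three]
  refine le_pick_of_le (x := v) (h.not_isDeficient v) (Set.ncard_le_card _) ?_
  have hn : {g : G.edgeSet | v ∈ g.1 ∧ (A g = c ∨ A g = d)}.ncard ≤ 2 := by
    rw [← colorDegree_add hb.ne, hb.pair]
  exact le_pick_pure (s := {g : G.edgeSet | v ∈ g.1 ∧ (A g = c ∨ A g = d)})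
    (g := fun g => LatinChain.flip (A g) f (altCycle A (A g) f v) A) ⟨hv, hg⟩ hn

theorem IsEdgeColoring.exists_of_perturb_three [Nonempty V] (h : IsEdgeColoring A)
    (hb : Balanced c d A) (hD : perturb (.three c d f) A D ≠ 0) :
    ∃ v, ∃ g : G.edgeSet, v ∈ g.1 ∧ (A g = c ∨ A g = d) ∧
      D = LatinChain.flip (A g) f (altCycle A (A g) f v) A := by
  rw [h.perturb_three] at hD
  rcases exists_of_pick_ne_zero hD with h1 | ⟨v, -, h1⟩
  · exact absurd ⟨Classical.arbitrary V, h.not_isDeficient _⟩ h1.1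
  rcases exists_of_pick_ne_zero h1 with h2 | ⟨g, hg, h2⟩
  · refine absurd ?_ h2.1
    obtain ⟨e₁, e₂, hp⟩ := hb.exists_isPair v
    exact ⟨e₁, hp.left⟩
  · exact ⟨v, g, hg.1, hg.2, pure_ne_zero_iff.1 h2⟩

end ThreeColors

/-! ### Selection of the colors -/

section Selection

variable {k : ℕ} {c d f : Fin k}

theorem lt_of_selectColors_two (h : selectColors k (.two c d) ≠ 0) : c < d := by
  rw [selectColors, coin_bind_apply, coin_bind_apply] at h
  by_contra hcd
  apply h
  have h1 : ∀ q : Fin k × Fin k × Fin k,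
      (PMF.pure (Choice.three q.1 q.2.1 q.2.2)) (.two c d) = 0 := fun q => by
      by_contra h1
      simpa using pure_ne_zero_iff.1 h1
  have h2 : (PMF.pure (Choice.stay : Choice k)) (.two c d) = 0 := by
    by_contra h1
    simpa using pure_ne_zero_iff.1 h1
  simp only [mul_eq_zero, add_eq_zero, ENNReal.inv_eq_zero, ENNReal.ofNat_ne_top, false_or, h2,
    true_and]
  constructor
  · by_contra h3
    rcases exists_of_pick_ne_zero h3 with h4 | ⟨q, hq, h4⟩
    · simpa using h4.2
    · have h5 := pure_ne_zero_iff.1 h4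
      injection h5 with h5 h6
      exact hcd (h5 ▸ h6 ▸ hq)
  · by_contra h3
    rcases exists_of_pick_ne_zero h3 with h4 | ⟨q, hq, h4⟩
    · simpa using h4.2
    · exact h4 (h1 q)

theorem lt_of_selectColors_three (h : selectColors k (.three c d f) ≠ 0) :
    c < d ∧ f ≠ c ∧ f ≠ d := by
  rw [selectColors, coin_bind_apply, coin_bind_apply] at h
  by_contra hcd
  apply h
  have h1 : ∀ q : Fin k × Fin k, (PMF.pure (Choice.two q.1 q.2)) (.three c d f) = 0 :=
    fun q => by
      by_contra h1
      simpa using pure_ne_zero_iff.1 h1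
  have h2 : (PMF.pure (Choice.stay : Choice k)) (.three c d f) = 0 := by
    by_contra h1
    simpa using pure_ne_zero_iff.1 h1
  simp only [mul_eq_zero, add_eq_zero, ENNReal.inv_eq_zero, ENNReal.ofNat_ne_top, false_or, h2,
    true_and]
  constructor
  · by_contra h3
    rcases exists_of_pick_ne_zero h3 with h4 | ⟨q, hq, h4⟩
    · simpa using h4.2
    · exact h4 (h1 q)
  · by_contra h3
    rcases exists_of_pick_ne_zero h3 with h4 | ⟨q, hq, h4⟩
    · simpa using h4.2
    · have h5 := pure_ne_zero_iff.1 h4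
      injection h5 with h5 h6 h7
      apply hcd
      rw [h5, h6, h7]
      exact hq

theorem selectColors_two_ne_zero (h : c < d) : selectColors k (.two c d) ≠ 0 := by
  rw [selectColors, coin_bind_apply, coin_bind_apply]
  have := le_pick_pure (d := Choice.stay) (s := {q : Fin k × Fin k | q.1 < q.2}) (x := (c, d)) h
    (g := fun q => Choice.two q.1 q.2) le_rfl
  have h1 := (lt_of_lt_of_le (ENNReal.inv_pos.2 (ENNReal.natCast_ne_top _)) this).ne'
  simp [h1]

theorem selectColors_three_ne_zero (h : c < d) (hc : f ≠ c) (hd : f ≠ d) :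
    selectColors k (.three c d f) ≠ 0 := by
  rw [selectColors, coin_bind_apply, coin_bind_apply]
  have := le_pick_pure (d := Choice.stay)
    (s := {q : Fin k × Fin k × Fin k | q.1 < q.2.1 ∧ q.2.2 ≠ q.1 ∧ q.2.2 ≠ q.2.1})
    (x := (c, d, f)) ⟨h, hc, hd⟩ (g := fun q => Choice.three q.1 q.2.1 q.2.2) le_rfl
  have h1 := (lt_of_lt_of_le (ENNReal.inv_pos.2 (ENNReal.natCast_ne_top _)) this).ne'
  simp [h1]

end Selection

/-! ### Ways and their inverses -/

section Ratio

theorem le_natCast_mul {n : ℕ} (hn : n ≠ 0) {q q' : ℝ≥0∞} (hq : q ≤ 1)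
    (hq' : (n : ℝ≥0∞)⁻¹ ≤ q') : q ≤ n * q' := by
  refine hq.trans ?_
  calc (1 : ℝ≥0∞) = n * (n : ℝ≥0∞)⁻¹ :=
        (ENNReal.mul_inv_cancel (by exact_mod_cast hn) (ENNReal.natCast_ne_top n)).symm
    _ ≤ n * q' := by gcongr

theorem inv_two_mul_inv (n : ℕ) : (2 : ℝ≥0∞)⁻¹ * (n : ℝ≥0∞)⁻¹ = ((2 * n : ℕ) : ℝ≥0∞)⁻¹ := by
  rw [← ENNReal.mul_inv (by simp) (by simp)]
  push_cast
  rfl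

theorem mul_le_of_ratios {p a b e a' b' e' : ℝ≥0∞} {α β γ B : ℕ} (ha : a ≤ α * a')
    (hb : b ≤ β * b') (he : e ≤ γ * e') (hB : α * β * γ ≤ B) :
    p * a * b * e ≤ B * (p * a' * b' * e') := by
  have hB' : (α : ℝ≥0∞) * β * γ ≤ B := by exact_mod_cast hB
  calc p * a * b * e ≤ p * (α * a') * (β * b') * (γ * e') := by gcongr
    _ = α * β * γ * (p * a' * b' * e') := by ring
    _ ≤ B * (p * a' * b' * e') := by gcongr

end Ratio

section Ways

variable {V : Type*} {G : SimpleGraph V} {k : ℕ} {A C D : Labeling G k}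
  {c d f : Fin k} {S T : Set (Sym2 V)} {x y v : V} {s : V → ℤ}

theorem redo_self (A D : Labeling G k) : redo A A D = D := by
  funext e
  simp [redo]

/-- The difference between `C` and a labeling obtained by a flip tells where and how `redo` has to
interchange colors. -/
theorem redo_flip (hS : S ⊆ (twoColor C c d).edgeSet) (D : Labeling G k) :
    redo C (flip c d S C) D = flip c d S D := by
  funext e
  by_cases he : e.1 ∈ S
  · rw [redo, flip_apply_mem he, flip_apply_mem he]
    rcases (mem_twoColor e).1 (hS he) with h | h
    · rw [h, Equiv.swap_apply_left]
    · rw [h, Equiv.swap_apply_right, Equiv.swap_comm]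
  · rw [redo, flip_apply_notMem he, flip_apply_notMem he, Equiv.swap_self]
    rfl

theorem inverseWay_of_isEdgeColoring (q : Choice k) {A₁ A₂ : Labeling G k} (h : A₁ ≠ C)
    (h' : IsEdgeColoring A₁) : inverseWay C ⟨q, A₁, A₂⟩ D =
      ⟨q, redo C A₁ D, redo A₁ A₂ (redo C A₁ D)⟩ := by
  rw [inverseWay, if_pos ⟨h, h'⟩]

theorem inverseWay_of_not (q : Choice k) {A₁ A₂ : Labeling G k}
    (h : ¬ (A₁ ≠ C ∧ IsEdgeColoring A₁)) : inverseWay C ⟨q, A₁, A₂⟩ D = ⟨q, A₂, A₁⟩ := by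
  rw [inverseWay, if_neg h]

theorem exists_eq_mk (e : G.edgeSet) : ∃ u w, e.1 = s(u, w) := by
  obtain ⟨e, he⟩ := e
  induction e using Sym2.ind with
  | _ a b => exact ⟨a, b, rfl⟩

variable [Finite V]

/-- The claim on a single way: it is inverse to its inverse, and its probability exceeds that of
the inverse at most by the factor `B`. -/
def WayBound (B : ℕ) (C : Labeling G k) (w : Way G k) (D : Labeling G k) : Prop :=
  inverseWay D (inverseWay C w D) C = w ∧
    wayProb C w D ≤ B * wayProb D (inverseWay C w D) C

/-- The claim on a way that is reversed by running through the same labelings backwards. The first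
phase of the way is compared with the first phase of the inverse way, which undoes the elimination,
and the elimination with the one that undoes the first phase. The selections of colors have the
same probability. -/
theorem wayBound_of_ratios {q : Choice k} {A₁ A₂ : Labeling G k} {α β γ B : ℕ}
    (h1 : ¬ (A₁ ≠ C ∧ IsEdgeColoring A₁)) (h2 : ¬ (A₂ ≠ D ∧ IsEdgeColoring A₂))
    (hα : create q C A₁ ≤ α * create q D A₂) (hβ : perturb q A₁ A₂ ≤ β * perturb q A₂ A₁)
    (hγ : eliminate q A₂ D ≤ γ * eliminate q A₁ C) (hB : α * β * γ ≤ B) :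
    WayBound B C ⟨q, A₁, A₂⟩ D := by
  rw [WayBound, inverseWay_of_not q h1, inverseWay_of_not q h2]
  exact ⟨rfl, mul_le_of_ratios hα hβ hγ hB⟩

theorem create_le_two_mul (q : Choice k) (C A D : Labeling G k) :
    create q C A ≤ (2 : ℕ) * create q D D :=
  le_natCast_mul two_ne_zero (PMF.coe_le_one _ _) (by simpa using inv_two_le_create_self q D)

theorem Balanced.isEdgeColoring_flip_of_not_isBoundary (hb : Balanced c d C)
    (hC : IsEdgeColoring C) (hS : ∀ v, ¬ IsBoundary C c d S v) :
    IsEdgeColoring (LatinChain.flip c d S C) := by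
  rw [(hb.flip S).isEdgeColoring_iff]
  intro v
  rw [hb.isDeficient_flip, not_not]
  exact iff_of_false (hC.not_isDeficient v) (hS v)

/-- One of two deficient vertices and one of two edges are drawn, hence the factor `4`. -/
theorem TwoDeficient.eliminate_le (h : TwoDeficient c d A x y) (hS : IsPathSet A c d x y S)
    (hC : C = LatinChain.flip c d S A) {q : ℝ≥0∞} (hq : q ≤ 1) :
    q ≤ (4 : ℕ) * LatinChain.eliminateColors c d A C := by
  subst hC
  exact le_natCast_mul (by norm_num) hq (by simpa using h.le_eliminateColors hS)

theorem IsEdgeColoring.le_eliminateColors (hC : IsEdgeColoring C) {q : ℝ≥0∞} (hq : q ≤ 1) :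
    q ≤ (1 : ℕ) * LatinChain.eliminateColors c d C C := by
  rw [hC.eliminateColors]
  simpa using hq

theorem TwoDeficient.perturb_le (h : TwoDeficient c d A x y) (hv : v = x ∨ v = y)
    {e : G.edgeSet} (hve : v ∈ e.1) (hec : A e = c ∨ A e = d)
    (hD : D = LatinChain.flip c d {e.1} A) {q : ℝ≥0∞} (hq : q ≤ 1) :
    q ≤ (4 : ℕ) * perturb (.two c d) A D := by
  refine le_natCast_mul (by norm_num) hq ?_
  rw [h.perturb_two]
  simpa using h.le_pick_pick hv hve hec (fun _ e => LatinChain.flip c d {e.1} A) hD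

theorem IsEdgeColoring.twoDeficient_flip_singleton (hC : IsEdgeColoring C) (hb : Balanced c d C)
    {e : G.edgeSet} (he : e.1 = s(x, y)) (hec : C e = c ∨ C e = d) :
    TwoDeficient c d (LatinChain.flip c d {e.1} C) x y := by
  refine hb.twoDeficient_flip hC ?_ (isPathSet_singleton he hec)
  have := e.2
  rw [he] at this
  exact SimpleGraph.Adj.ne this

theorem eq_of_eliminateColors_ne_zero (hA : IsEdgeColoring A)
    (h : eliminateColors c d A D ≠ 0) : D = A := by
  rw [hA.eliminateColors] at h
  exact pure_ne_zero_iff.1 h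

end Ways

/-! ### The bounds for the ways -/

section WayBounds

variable {V : Type*} [Fintype V] {G : SimpleGraph V} {k : ℕ} {A₁ A₂ C D : Labeling G k}
  {c d f : Fin k} {S T : Set (Sym2 V)} {x y v : V} {s : V → ℤ}

theorem card_edgeSet_le (G : SimpleGraph V) :
    Nat.card G.edgeSet ≤ Fintype.card V * (Fintype.card V - 1) := by
  classical
  rw [Nat.card_eq_fintype_card, ← SimpleGraph.edgeFinset_card]
  refine G.card_edgeFinset_le_card_choose_two.trans ?_
  rw [Nat.choose_two_right]
  exact Nat.div_le_self _ _

/-- The ways whose first phase does nothing, for two colors. If an edge changes its color and a path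
is flipped to eliminate the deficiencies, then the inverse way has to draw this path from all
connected pieces. -/
theorem wayBound_two_of_create_self (hV : 2 ≤ Fintype.card V) (hs : IsSign G s)
    (hb : Balanced c d C) (hC : IsEdgeColoring C)
    (hp : perturb (.two c d) C A₂ ≠ 0) (he : eliminateColors c d A₂ D ≠ 0) :
    WayBound (16 * Fintype.card V * (Fintype.card V - 1)) C ⟨.two c d, C, A₂⟩ D := by
  have hn : 1 ≤ Fintype.card V - 1 := by omega
  rcases hC.exists_of_perturb_two hp with rfl | ⟨e, hec, rfl⟩
  · obtain rfl := eq_of_eliminateColors_ne_zero hC he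
    refine wayBound_of_ratios (α := 1) (β := 1) (γ := 1) (by simp) (by simp) (by simp) (by simp)
      (by simp) ?_
    nlinarith
  · obtain ⟨u, w, huw⟩ := exists_eq_mk e
    have hA := hC.twoDeficient_flip_singleton hb huw hec
    obtain ⟨P, hP, rfl⟩ := hA.exists_of_eliminateColors hs he
    set A₂ := flip c d {e.1} C with hA₂
    -- a bound for the number of connected pieces
    set N := 2 * (Fintype.card V * (Fintype.card V - 1)) + Fintype.card V with hN
    refine wayBound_of_ratios (α := 2 * N) (β := 2) (γ := 1) (by simp)
      (fun h => hA.not_isEdgeColoring h.2) ?_ ?_ ?_ ?_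
    · refine le_natCast_mul (by omega) (PMF.coe_le_one _ _) ?_
      have hP' : P ∈ connectedPieces (flip c d P A₂) c d :=
        (isPathSet_flip_iff.2 hP).mem_connectedPieces hA.ne_vertex
      have h1 := le_create_two hP'
      rw [flip_flip] at h1
      refine le_trans ?_ h1
      rw [inv_two_mul_inv]
      refine ENNReal.inv_le_inv.2 ?_
      have := (hA.toBalanced.flip P).ncard_connectedPieces_le hs
      exact_mod_cast Nat.mul_le_mul_left 2 this
    · have h1 := hC.perturb_two_le (c := c) (d := d) (D := A₂)
        (flip_ne_self hb.ne (by simpa using (mem_twoColor e).2 hec) ⟨_, rfl⟩)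
      have h2 := hA.perturb_le (D := C) (Or.inl rfl) (e := e) (by simp [huw]) (flip_eq_or_iff.2 hec)
        (by rw [hA₂, flip_flip]) (q := 1) le_rfl
      calc perturb (.two c d) C A₂ ≤ 2⁻¹ * 1 := by rwa [mul_one]
        _ ≤ 2⁻¹ * ((4 : ℕ) * perturb (.two c d) A₂ C) := by gcongr
        _ = (2 : ℕ) * perturb (.two c d) A₂ C := by
          rw [← mul_assoc]
          congr 1
          have : ((4 : ℕ) : ℝ≥0∞) = 2 * 2 := by norm_num
          rw [this, ← mul_assoc, ENNReal.inv_mul_cancel (by simp) (by simp)]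
          simp
    · exact hC.le_eliminateColors (PMF.coe_le_one _ _)
    · rw [hN]
      nlinarith

/-- The ways whose first phase flips whole cycles. The inverse way flips the same cycles, then the
same edge, and then the same path. -/
theorem wayBound_two_of_cycles (hV : 2 ≤ Fintype.card V) (hs : IsSign G s)
    (hb : Balanced c d C) (hC : IsEdgeColoring C) (hS : S ∈ connectedPieces C c d)
    (hS0 : ∀ v, ¬ IsBoundary C c d S v)
    (hp : perturb (.two c d) (flip c d S C) A₂ ≠ 0) (he : eliminateColors c d A₂ D ≠ 0) :
    WayBound (16 * Fintype.card V * (Fintype.card V - 1)) C ⟨.two c d, flip c d S C, A₂⟩ D := by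
  have hn : 1 ≤ Fintype.card V - 1 := by omega
  obtain ⟨hSH, hSne⟩ := subset_of_mem_connectedPieces hS
  have hcol0 := hb.isEdgeColoring_flip_of_not_isBoundary hC hS0
  have hne := flip_ne_self hb.ne hSH hSne
  have hα : ∀ D : Labeling G k, connectedPieces D c d = connectedPieces C c d →
      create (.two c d) C (flip c d S C) ≤ (1 : ℕ) * create (.two c d) D (flip c d S D) := by
    intro D hD
    rw [Nat.cast_one, one_mul]
    refine (create_two_le hb.ne hne).trans ?_
    rw [← hD] at hS ⊢
    exact le_create_two hS
  rw [WayBound, inverseWay_of_isEdgeColoring _ hne hcol0, redo_flip hSH]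
  rcases hcol0.exists_of_perturb_two hp with rfl | ⟨e, hec, rfl⟩
  · obtain rfl := eq_of_eliminateColors_ne_zero hcol0 he
    rw [redo_self, flip_flip]
    constructor
    · rw [inverseWay_of_isEdgeColoring _ hne.symm hC, redo_self]
      have : redo (flip c d S C) C C = flip c d S C := by
        have := redo_flip (C := flip c d S C) (S := S) (by rwa [twoColor_flip]) C
        rwa [flip_flip] at this
      rw [this]
    · refine mul_le_of_ratios (α := 1) (β := 2) (γ := 1) ?_ ?_ ?_ ?_
      · have := hα (flip c d S C) connectedPieces_flip
        rwa [flip_flip] at this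
      · exact le_natCast_mul two_ne_zero (PMF.coe_le_one _ _)
          (by simpa using hC.inv_two_le_perturb_two)
      · exact hC.le_eliminateColors (PMF.coe_le_one _ _)
      · nlinarith
  · obtain ⟨u, w, huw⟩ := exists_eq_mk e
    have hA := hcol0.twoDeficient_flip_singleton (hb.flip S) huw hec
    obtain ⟨P, hP, rfl⟩ := hA.exists_of_eliminateColors hs he
    have hD := hA.isEdgeColoring_flip hP
    set D := flip c d P (flip c d {e.1} (flip c d S C)) with hDdef
    have heSub : ({e.1} : Set (Sym2 V)) ⊆ (twoColor (flip c d S C) c d).edgeSet := by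
      simpa using (mem_twoColor e).2 hec
    have htwo : twoColor D c d = twoColor C c d := by
      rw [hDdef, twoColor_flip, twoColor_flip, twoColor_flip]
    have hpieces : connectedPieces D c d = connectedPieces C c d := by
      rw [hDdef, connectedPieces_flip, connectedPieces_flip, connectedPieces_flip]
    have hbD : Balanced c d D := hA.toBalanced.flip P
    have hSD : S ⊆ (twoColor D c d).edgeSet := by rwa [htwo]
    have hneX := flip_ne_self hb.ne hSD hSne
    have hX : IsEdgeColoring (flip c d S D) := by
      refine hbD.isEdgeColoring_flip_of_not_isBoundary hD fun v => ?_
      rw [hDdef, isBoundary_flip_iff, isBoundary_flip_iff, isBoundary_flip_iff]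
      exact hS0 v
    have heX : flip c d S D e = c ∨ flip c d S D e = d := by
      simp only [hDdef, flip_eq_or_iff] at hec ⊢
      exact hec
    have heSubX : ({e.1} : Set (Sym2 V)) ⊆ (twoColor (flip c d S D) c d).edgeSet := by
      simpa using (mem_twoColor e).2 heX
    have hAX := hX.twoDeficient_flip_singleton (hbD.flip S) huw heX
    rw [redo_flip heSub]
    constructor
    · rw [inverseWay_of_isEdgeColoring _ hneX hX, redo_flip hSD, redo_flip heSubX]
    · refine mul_le_of_ratios (α := 1) (β := 2 * (Fintype.card V * (Fintype.card V - 1))) (γ := 4)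
        (hα D hpieces) ?_ ?_ ?_
      · refine le_natCast_mul (by positivity) (PMF.coe_le_one _ _) ?_
        rw [← inv_two_mul_inv]
        exact hX.le_perturb_two heX (card_edgeSet_le G)
      · refine hAX.eliminate_le (S := P) ?_ ?_ (PMF.coe_le_one _ _)
        · simp only [hDdef, isPathSet_flip_iff] at hP ⊢
          exact hP
        · rw [hDdef, flip_flip_comm c d S P, flip_flip_comm c d {e.1} P, flip_flip,
            flip_flip_comm c d S {e.1}, flip_flip, flip_flip]
      · nlinarith

/-- The ways whose first phase creates deficiencies, for two colors. If the second phase removes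
them, then the inverse way has to draw the edge from all edges of the two colors; if it moves a
deficiency, then the first phases draw from equally many connected pieces. -/
theorem wayBound_two_of_twoDeficient (hV : 2 ≤ Fintype.card V) (hs : IsSign G s)
    (hb : Balanced c d C) (hC : IsEdgeColoring C) (hxy : x ≠ y) (hS : IsPathSet C c d x y S)
    (hp : perturb (.two c d) (flip c d S C) A₂ ≠ 0) (he : eliminateColors c d A₂ D ≠ 0) :
    WayBound (16 * Fintype.card V * (Fintype.card V - 1)) C ⟨.two c d, flip c d S C, A₂⟩ D := by
  have hn : 1 ≤ Fintype.card V - 1 := by omega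
  have hA := hb.twoDeficient_flip hC hxy hS
  rw [hA.perturb_two] at hp
  obtain ⟨v, e, hv, ⟨w, hw⟩, hec, rfl⟩ :=
    hA.exists_of_pick_pick (fun _ e => flip c d {e.1} (flip c d S C)) hp
  wlog hvx : v = x generalizing x y
  · exact this hxy.symm hS.symm_vertex hA.symm_vertex hv.symm (hv.resolve_left hvx)
  subst hvx
  have hγ : eliminate (.two c d) (flip c d {e.1} (flip c d S C)) D ≤
      (4 : ℕ) * eliminate (.two c d) (flip c d S C) C :=
    hA.eliminate_le (isPathSet_flip_iff.2 hS) (flip_flip c d S C).symm (PMF.coe_le_one _ _)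
  have h1 : ¬ (flip c d S C ≠ C ∧ IsEdgeColoring (flip c d S C)) :=
    fun h => hA.not_isEdgeColoring h.2
  set A₁ := flip c d S C with hA₁
  have hec' : flip c d {e.1} A₁ e = c ∨ flip c d {e.1} A₁ e = d := flip_eq_or_iff.2 hec
  rcases hA.flip_singleton hw hec with ⟨rfl, hA₂⟩ | ⟨hwy, hA₂⟩
  · obtain rfl := eq_of_eliminateColors_ne_zero hA₂ he
    refine wayBound_of_ratios (α := 2) (β := 2 * (Fintype.card V * (Fintype.card V - 1))) (γ := 4)
      h1 (by simp) (create_le_two_mul _ _ _ _) ?_ hγ (by nlinarith)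
    refine le_natCast_mul (by positivity) (PMF.coe_le_one _ _) ?_
    have := hA₂.le_perturb_two hec' (card_edgeSet_le G)
    rwa [flip_flip, inv_two_mul_inv] at this
  · obtain ⟨P, hP, rfl⟩ := hA₂.exists_of_eliminateColors hs he
    refine wayBound_of_ratios (α := 1) (β := 4) (γ := 4) h1
      (fun h => hA₂.not_isEdgeColoring h.2) ?_ ?_ hγ (by nlinarith)
    · rw [Nat.cast_one, one_mul]
      refine (create_two_le hb.ne (flip_ne_self hb.ne hS.subset ?_)).trans ?_
      · exact (subset_of_mem_connectedPieces (hS.mem_connectedPieces hxy)).2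
      · have hP' : P ∈ connectedPieces (flip c d P (flip c d {e.1} A₁)) c d :=
          (isPathSet_flip_iff.2 hP).mem_connectedPieces hwy
        have := le_create_two hP'
        rwa [flip_flip, connectedPieces_flip, connectedPieces_flip, hA₁, connectedPieces_flip,
          ← hA₁] at this
    · exact hA₂.perturb_le (Or.inl rfl) (e := e) (by simp [hw]) hec' (flip_flip _ _ _ _).symm
        (PMF.coe_le_one _ _)

theorem wayBound_two (hV : 2 ≤ Fintype.card V) (hs : IsSign G s)
    (hb : Balanced c d C) (hC : IsEdgeColoring C) (h1 : create (.two c d) C A₁ ≠ 0)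
    (hp : perturb (.two c d) A₁ A₂ ≠ 0) (he : eliminateColors c d A₂ D ≠ 0) :
    WayBound (16 * Fintype.card V * (Fintype.card V - 1)) C ⟨.two c d, A₁, A₂⟩ D := by
  rcases exists_of_create_two h1 with rfl | ⟨S, hS, rfl⟩
  · exact wayBound_two_of_create_self hV hs hb hC hp he
  · rcases hb.isPathSet_of_mem_connectedPieces hs hS with h0 | ⟨x, y, hxy, hP⟩
    · exact wayBound_two_of_cycles hV hs hb hC hS h0 hp he
    · exact wayBound_two_of_twoDeficient hV hs hb hC hxy hP hp he

/-- For three colors, the inverse way flips the same alternating cycle. If the first phase does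
nothing, then the inverse way has to draw a vertex of this cycle; otherwise it has to draw a path
from all even paths, which may be more numerous in `D` than in `C`, because the cycle has changed
the two-colored subgraph. -/
theorem wayBound_three (hreg : ∀ v, {e : G.edgeSet | v ∈ e.1}.ncard = k)
    (hV : 2 ≤ Fintype.card V) (hs : IsSign G s)
    (hb : Balanced c d C) (hfc : f ≠ c) (hfd : f ≠ d) (hC : IsEdgeColoring C)
    (h1 : create (.three c d f) C A₁ ≠ 0)
    (hp : perturb (.three c d f) A₁ A₂ ≠ 0) (he : eliminateColors c d A₂ D ≠ 0) :
    WayBound (16 * Fintype.card V * (Fintype.card V - 1)) C ⟨.three c d f, A₁, A₂⟩ D := by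
  have hn : 1 ≤ Fintype.card V - 1 := by omega
  have : Nonempty V := Fintype.card_pos_iff.1 (by omega)
  rcases exists_of_create_three h1 with rfl | ⟨S, hS, rfl⟩
  · obtain ⟨v, g, hvg, hgc, rfl⟩ := hC.exists_of_perturb_three hb hp
    have haf : A₁ g ≠ f := by
      rintro h
      rcases hgc with h' | h'
      exacts [hfc (h.symm.trans h'), hfd (h.symm.trans h')]
    generalize ha : A₁ g = a at *
    have hcyc := hC.cycleBase hreg haf v
    have hA₂ : IsEdgeColoring (flip a f (altCycle A₁ a f v) A₁) :=
      isEdgeColoring_of_colorDegree_eq (hcyc.colorDegree_flip hs) hC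
    obtain rfl := eq_of_eliminateColors_ne_zero hA₂ he
    have hb₂ := hA₂.balanced hreg hb.ne
    refine wayBound_of_ratios (α := 2) (β := 2 * Fintype.card V) (γ := 1) (by simp) (by simp)
      (create_le_two_mul _ _ _ _) ?_ (hC.le_eliminateColors (PMF.coe_le_one _ _)) (by nlinarith)
    refine le_natCast_mul (by omega) (PMF.coe_le_one _ _) ?_
    obtain ⟨g', ⟨hvg', hg'⟩, -⟩ := colorDegree_eq_one_iff.1 (hA₂.colorDegree_eq_one hreg v a)
    have := hA₂.le_perturb_three (f := f) hb₂ hvg' (by rwa [hg'])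
    rw [hg', hcyc.altCycle_flip hs, flip_flip, mul_comm, Nat.card_eq_fintype_card,
      inv_two_mul_inv] at this
    exact this
  · obtain ⟨x, y, hxy, hsxy, hP⟩ := (mem_evenPaths_iff hs).1 hS
    have hA := hb.twoDeficient_flip hC hxy hP
    obtain ⟨v, a, hv, ha, hva, rfl⟩ := hA.exists_of_perturb_three hp
    wlog hvx : v = x generalizing x y
    · exact this y x hxy.symm hsxy.symm hP.symm_vertex hA.symm_vertex hv.symm
        (hv.resolve_left hvx)
    subst hvx
    have hcyc := hA.cycleBase hs hsxy hfc hfd ha hva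
    have hA₂ := hA.of_colorDegree_eq (hcyc.colorDegree_flip hs)
    obtain ⟨P, hP', rfl⟩ := hA₂.exists_of_eliminateColors hs he
    have hne : flip c d S C ≠ C := flip_ne_self hb.ne hP.subset
      (subset_of_mem_connectedPieces (hP.mem_connectedPieces hxy)).2
    -- a bound for the number of even paths
    set N := 2 * (Fintype.card V * (Fintype.card V - 1)) with hN
    refine wayBound_of_ratios (α := N) (β := 2) (γ := 4) (fun h => hA.not_isEdgeColoring h.2)
      (fun h => hA₂.not_isEdgeColoring h.2) ?_ ?_ ?_ (by rw [hN]; nlinarith)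
    · refine (create_three_le hne).trans ?_
      have hP'' : P ∈ evenPaths (flip c d P (flip a f (altCycle (flip c d S C) a f v)
          (flip c d S C))) c d :=
        (mem_evenPaths_iff hs).2 ⟨v, y, hxy, hsxy, isPathSet_flip_iff.2 hP'⟩
      have h2 := le_create_three (f := f) hP'' ((hA₂.toBalanced.flip P).ncard_evenPaths_le hs)
      rw [flip_flip] at h2
      have hN0 : N ≠ 0 := by rw [hN]; positivity
      calc (2⁻¹ : ℝ≥0∞) = N * (2⁻¹ * (N : ℝ≥0∞)⁻¹) := by
            rw [mul_comm (2⁻¹ : ℝ≥0∞), ← mul_assoc,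
              ENNReal.mul_inv_cancel (by exact_mod_cast hN0) (ENNReal.natCast_ne_top N), one_mul]
        _ ≤ _ := by gcongr
    · refine le_natCast_mul two_ne_zero (PMF.coe_le_one _ _) ?_
      have h2 := hA₂.le_perturb_three (f := f) (Or.inl rfl) ha
        (by rw [hcyc.colorDegree_flip hs]; exact hva)
      rw [hcyc.altCycle_flip hs, flip_flip] at h2
      simpa using h2
    · exact hA.eliminate_le (isPathSet_flip_iff.2 hP) (flip_flip c d S C).symm (PMF.coe_le_one _ _)

/-- The bound for the variant of the algorithm that works with single ways. -/
theorem wayBound_of_ne_zero (hreg : ∀ v, {e : G.edgeSet | v ∈ e.1}.ncard = k)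
    (hV : 2 ≤ Fintype.card V) (hs : IsSign G s) (hC : IsEdgeColoring C) {w : Way G k}
    (hw : wayProb C w D ≠ 0) :
    WayBound (16 * Fintype.card V * (Fintype.card V - 1)) C w D := by
  obtain ⟨q, A₁, A₂⟩ := w
  simp only [wayProb, mul_ne_zero_iff] at hw
  obtain ⟨⟨⟨hq, h1⟩, h2⟩, h3⟩ := hw
  cases q with
  | stay =>
    obtain rfl := pure_ne_zero_iff.1 h1
    obtain rfl := pure_ne_zero_iff.1 h2
    obtain rfl := pure_ne_zero_iff.1 h3
    refine wayBound_of_ratios (α := 1) (β := 1) (γ := 1) (by simp) (by simp) (by simp) (by simp)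
      (by simp) ?_
    have hn : 1 ≤ Fintype.card V - 1 := by omega
    nlinarith
  | two c d =>
    exact wayBound_two hV hs (hC.balanced hreg (lt_of_selectColors_two hq).ne) hC h1 h2 h3
  | three c d f =>
    obtain ⟨hcd, hfc, hfd⟩ := lt_of_selectColors_three hq
    exact wayBound_three hreg hV hs (hC.balanced hreg hcd.ne) hfc hfd hC h1 h2 h3

end WayBounds

/-! ### Transition probabilities and acceptance -/

section Step

variable {V : Type*} [Finite V] {G : SimpleGraph V} {k : ℕ} {A A₁ A₂ C D : Labeling G k}
  {c d f : Fin k} {s : V → ℤ}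

/-- The components of a way. -/
def wayEquiv (G : SimpleGraph V) (k : ℕ) :
    Way G k ≃ Choice k × Labeling G k × Labeling G k where
  toFun w := (w.colors, w.first, w.second)
  invFun t := ⟨t.1, t.2.1, t.2.2⟩
  left_inv _ := rfl
  right_inv _ := rfl

theorem step_apply (C D : Labeling G k) : step C D = ∑' w : Way G k, wayProb C w D := by
  rw [← (wayEquiv G k).symm.tsum_eq, ENNReal.tsum_prod', step, PMF.bind_apply]
  refine tsum_congr fun q => ?_
  rw [ENNReal.tsum_prod', PMF.bind_apply, ← ENNReal.tsum_mul_left]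
  refine tsum_congr fun A₁ => ?_
  rw [PMF.bind_apply, ← ENNReal.tsum_mul_left, ← ENNReal.tsum_mul_left]
  refine tsum_congr fun A₂ => ?_
  simp only [wayEquiv, Equiv.coe_fn_symm_mk, wayProb, mul_assoc]

theorem step_ne_zero_iff : step C D ≠ 0 ↔ ∃ w, wayProb C w D ≠ 0 := by
  rw [step_apply, Ne, ENNReal.tsum_eq_zero]
  push Not
  rfl

theorem TwoDeficient.isEdgeColoring_of_eliminateColors {x y : V} (hs : IsSign G s)
    (h : TwoDeficient c d A x y) (hD : eliminateColors c d A D ≠ 0) : IsEdgeColoring D := by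
  obtain ⟨S, hS, rfl⟩ := h.exists_of_eliminateColors hs hD
  exact h.isEdgeColoring_flip hS

theorem isEdgeColoring_of_two (hs : IsSign G s) (hb : Balanced c d C) (hC : IsEdgeColoring C)
    (h1 : create (.two c d) C A₁ ≠ 0) (hp : perturb (.two c d) A₁ A₂ ≠ 0)
    (he : eliminateColors c d A₂ D ≠ 0) : IsEdgeColoring D := by
  -- a step that creates no deficiencies in the first phase
  have hcol : Balanced c d A₁ → IsEdgeColoring A₁ → IsEdgeColoring D := by
    intro hb₁ hA₁
    rcases hA₁.exists_of_perturb_two hp with rfl | ⟨e, hec, rfl⟩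
    · rwa [eq_of_eliminateColors_ne_zero hA₁ he]
    · obtain ⟨u, w, huw⟩ := exists_eq_mk e
      exact (hA₁.twoDeficient_flip_singleton hb₁ huw hec).isEdgeColoring_of_eliminateColors hs he
  rcases exists_of_create_two h1 with rfl | ⟨S, hS, rfl⟩
  · exact hcol hb hC
  rcases hb.isPathSet_of_mem_connectedPieces hs hS with h0 | ⟨x, y, hxy, hP⟩
  · exact hcol (hb.flip S) (hb.isEdgeColoring_flip_of_not_isBoundary hC h0)
  have hA := hb.twoDeficient_flip hC hxy hP
  have hmove : ∀ x y, TwoDeficient c d (flip c d S C) x y → ∀ e : G.edgeSet, x ∈ e.1 →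
      (flip c d S C e = c ∨ flip c d S C e = d) → A₂ = flip c d {e.1} (flip c d S C) →
      IsEdgeColoring D := by
    rintro x y hA e ⟨w, hw⟩ hec rfl
    rcases hA.flip_singleton hw hec with ⟨-, hA₂⟩ | ⟨-, hA₂⟩
    · rwa [eq_of_eliminateColors_ne_zero hA₂ he]
    · exact hA₂.isEdgeColoring_of_eliminateColors hs he
  rw [hA.perturb_two] at hp
  obtain ⟨v, e, hv, hve, hec, hA₂⟩ :=
    hA.exists_of_pick_pick (fun _ e => flip c d {e.1} (flip c d S C)) hp
  rcases hv with rfl | rfl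
  · exact hmove _ _ hA e hve hec hA₂
  · exact hmove _ _ hA.symm_vertex e hve hec hA₂

theorem isEdgeColoring_of_three [Nonempty V]
    (hreg : ∀ v, {e : G.edgeSet | v ∈ e.1}.ncard = k) (hs : IsSign G s) (hb : Balanced c d C)
    (hfc : f ≠ c) (hfd : f ≠ d) (hC : IsEdgeColoring C) (h1 : create (.three c d f) C A₁ ≠ 0)
    (hp : perturb (.three c d f) A₁ A₂ ≠ 0) (he : eliminateColors c d A₂ D ≠ 0) :
    IsEdgeColoring D := by
  rcases exists_of_create_three h1 with rfl | ⟨S, hS, rfl⟩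
  · obtain ⟨v, g, hvg, hgc, rfl⟩ := hC.exists_of_perturb_three hb hp
    have haf : A₁ g ≠ f := by
      rintro h
      rcases hgc with h' | h'
      exacts [hfc (h.symm.trans h'), hfd (h.symm.trans h')]
    have hA₂ : IsEdgeColoring (flip (A₁ g) f (altCycle A₁ (A₁ g) f v) A₁) :=
      isEdgeColoring_of_colorDegree_eq ((hC.cycleBase hreg haf v).colorDegree_flip hs) hC
    rwa [eq_of_eliminateColors_ne_zero hA₂ he]
  · obtain ⟨x, y, hxy, hsxy, hP⟩ := (mem_evenPaths_iff hs).1 hS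
    have hA := hb.twoDeficient_flip hC hxy hP
    obtain ⟨v, a, hv, ha, hva, rfl⟩ := hA.exists_of_perturb_three hp
    rcases hv with rfl | rfl
    · have hcyc := hA.cycleBase hs hsxy hfc hfd ha hva
      exact (hA.of_colorDegree_eq
        (hcyc.colorDegree_flip hs)).isEdgeColoring_of_eliminateColors hs he
    · have hcyc := hA.symm_vertex.cycleBase hs hsxy.symm hfc hfd ha hva
      exact (hA.of_colorDegree_eq
        (hcyc.colorDegree_flip hs)).isEdgeColoring_of_eliminateColors hs he

/-- The chain does not leave the set of edge colorings. -/
theorem isEdgeColoring_of_step [Nonempty V] (hreg : ∀ v, {e : G.edgeSet | v ∈ e.1}.ncard = k)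
    (hs : IsSign G s) (hC : IsEdgeColoring C) (hD : step C D ≠ 0) : IsEdgeColoring D := by
  obtain ⟨⟨q, A₁, A₂⟩, hw⟩ := step_ne_zero_iff.1 hD
  simp only [wayProb, mul_ne_zero_iff] at hw
  obtain ⟨⟨⟨hq, h1⟩, h2⟩, h3⟩ := hw
  cases q with
  | stay =>
    rw [pure_ne_zero_iff.1 h3, pure_ne_zero_iff.1 h2, pure_ne_zero_iff.1 h1]
    exact hC
  | two c d =>
    exact isEdgeColoring_of_two hs (hC.balanced hreg (lt_of_selectColors_two hq).ne) hC h1 h2 h3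
  | three c d f =>
    obtain ⟨hcd, hfc, hfd⟩ := lt_of_selectColors_three hq
    exact isEdgeColoring_of_three hreg hs (hC.balanced hreg hcd.ne) hfc hfd hC h1 h2 h3

/-- A bound for the ways carries over to the transition probabilities, since taking inverses is
injective on the ways of positive probability. -/
theorem step_le_mul_of_wayBound {B : ℕ} (h : ∀ w, wayProb C w D ≠ 0 → WayBound B C w D) :
    step C D ≤ B * step D C := by
  rw [step_apply, step_apply, ← tsum_subtype_support]
  have hinj : Function.Injective fun w : Function.support fun w => wayProb C w D =>
      inverseWay C w.1 D := by
    intro w w' heq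
    apply Subtype.ext
    rw [← (h w.1 w.2).1, ← (h w'.1 w'.2).1]
    exact congrArg (fun w => inverseWay D w C) heq
  calc ∑' w : Function.support fun w => wayProb C w D, wayProb C w.1 D
      ≤ ∑' w : Function.support fun w => wayProb C w D, B * wayProb D (inverseWay C w.1 D) C :=
        ENNReal.tsum_le_tsum fun w => (h w.1 w.2).2
    _ = B * ∑' w : Function.support fun w => wayProb C w D, wayProb D (inverseWay C w.1 D) C :=
        ENNReal.tsum_mul_left
    _ ≤ B * ∑' w, wayProb D w C := by
        gcongr
        exact ENNReal.tsum_comp_le_tsum_of_injective hinj fun w => wayProb D w C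

/-- The inverse of an acceptance ratio for the uniform target distribution. -/
theorem inv_min_one_div_le {p p' : ℝ≥0∞} {B : ℕ} (hB : 1 ≤ B) (hp : p ≠ 0) (hp' : p ≠ ⊤)
    (h : p ≤ B * p') : (min 1 (1 * p' / (1 * p)))⁻¹ ≤ B := by
  have hB0 : (B : ℝ≥0∞) ≠ 0 := by
    exact_mod_cast (by omega : B ≠ 0)
  rw [one_mul, one_mul, ENNReal.inv_le_iff_inv_le, le_min_iff]
  constructor
  · rw [ENNReal.inv_le_one]
    exact_mod_cast hB
  · rw [ENNReal.le_div_iff_mul_le (Or.inl hp) (Or.inl hp')]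
    calc (B : ℝ≥0∞)⁻¹ * p ≤ (B : ℝ≥0∞)⁻¹ * (B * p') := by gcongr
      _ = p' := by
        rw [← mul_assoc, ENNReal.inv_mul_cancel hB0 (ENNReal.natCast_ne_top B), one_mul]

theorem wayProb_ne_top (C : Labeling G k) (w : Way G k) (D : Labeling G k) :
    wayProb C w D ≠ ⊤ :=
  ENNReal.mul_ne_top (ENNReal.mul_ne_top (ENNReal.mul_ne_top (PMF.apply_ne_top _ _)
    (PMF.apply_ne_top _ _)) (PMF.apply_ne_top _ _)) (PMF.apply_ne_top _ _)

end Step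

/-! ### The diameter -/

section Iterate

variable {α : Type*} {K : α → PMF α} {x y z : α} {m n : ℕ}

theorem mem_support_iterate_add (h1 : y ∈ (iterate K m x).support)
    (h2 : z ∈ (iterate K n y).support) : z ∈ (iterate K (m + n) x).support := by
  induction n generalizing z with
  | zero =>
    rw [iterate, PMF.support_pure, Set.mem_singleton_iff] at h2
    rwa [h2]
  | succ n ih =>
    rw [iterate, PMF.mem_support_bind_iff] at h2
    obtain ⟨w, hw, hz⟩ := h2
    rw [← add_assoc, iterate, PMF.mem_support_bind_iff]
    exact ⟨w, ih hw, hz⟩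

theorem mem_support_iterate_one (h : K x y ≠ 0) : y ∈ (iterate K 1 x).support := by
  rw [iterate, iterate, PMF.pure_bind]
  exact h

theorem chainDist_le (h : y ∈ (iterate K n x).support) : chainDist K x y ≤ n :=
  iInf₂_le n h

end Iterate

section Agreement

variable {V : Type*} {G : SimpleGraph V} {k : ℕ} {A T : Labeling G k} {c d : Fin k}

/-- On the colors in `F`, the labeling `A` agrees with the target `T`. -/
def AgreeOn (T : Labeling G k) (F : Finset (Fin k)) (A : Labeling G k) : Prop :=
  ∀ t ∈ F, ∀ e, A e = t ↔ T e = t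

theorem AgreeOn.flip {F : Finset (Fin k)} (h : AgreeOn T F A) (hc : c ∉ F) (hd : d ∉ F)
    (S : Set (Sym2 V)) : AgreeOn T F (LatinChain.flip c d S A) := by
  intro t ht e
  have hct : c ≠ t := fun h' => hc (h' ▸ ht)
  have hdt : d ≠ t := fun h' => hd (h' ▸ ht)
  rw [flip_eq_iff_of_ne hct.symm hdt.symm, h t ht]

theorem colorDegree_flip_singleton_of_notMem {e : G.edgeSet} {v : V} (hv : v ∉ e.1)
    (t : Fin k) : colorDegree (flip c d {e.1} A) v t = colorDegree A v t := by
  rw [colorDegree, colorDegree]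
  congr 1
  ext g
  refine and_congr_right fun hg => ?_
  rw [flip_apply_notMem]
  intro h
  rw [Set.mem_singleton_iff] at h
  exact hv (h ▸ hg)

end Agreement

section Diameter

variable {V : Type*} [Finite V] {G : SimpleGraph V} {k : ℕ} {A A' C D T : Labeling G k}
  {c d f : Fin k} {x y z w : V} {s : V → ℤ} {Q : Labeling G k → Prop} {m n : ℕ}

/-- From `C` the chain can get into `Q` in at most `n` steps. -/
def CanReach (Q : Labeling G k → Prop) (n : ℕ) (C : Labeling G k) : Prop :=
  ∃ j ≤ n, ∃ D, Q D ∧ D ∈ (iterate step j C).support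

/-- After every elimination of the deficiencies of `A`, the chain can get into `Q` in at most `n`
steps. -/
def CanReachAfter (Q : Labeling G k → Prop) (c d : Fin k) (n : ℕ) (A : Labeling G k) : Prop :=
  ∀ D, eliminateColors c d A D ≠ 0 → CanReach Q n D

theorem CanReach.mono (h : CanReach Q m C) (hmn : m ≤ n) : CanReach Q n C := by
  obtain ⟨j, hj, hD⟩ := h
  exact ⟨j, hj.trans hmn, hD⟩

theorem CanReachAfter.mono (h : CanReachAfter Q c d m A) (hmn : m ≤ n) :
    CanReachAfter Q c d n A :=
  fun D hD => (h D hD).mono hmn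

theorem canReachAfter_comm : CanReachAfter Q c d n A ↔ CanReachAfter Q d c n A := by
  rw [CanReachAfter, CanReachAfter, eliminateColors_comm]

theorem CanReach.canReachAfter (h : CanReach Q n A) (hA : IsEdgeColoring A) :
    CanReachAfter Q c d n A := by
  intro D hD
  rwa [eq_of_eliminateColors_ne_zero hA hD]

theorem CanReach.of_step (hCD : step C D ≠ 0) (h : CanReach Q n D) : CanReach Q (n + 1) C := by
  obtain ⟨j, hj, E, hE, hm⟩ := h
  refine ⟨1 + j, by omega, E, hE, mem_support_iterate_add (mem_support_iterate_one hCD) hm⟩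

/-- A step through given first and second labelings ends in some elimination of the second one. -/
theorem canReach_of_phases {q : Choice k} (hq : selectColors k q ≠ 0) (h1 : create q C A ≠ 0)
    (h2 : perturb q A A' ≠ 0) (h : ∀ D, eliminate q A' D ≠ 0 → CanReach Q n D) :
    CanReach Q (n + 1) C := by
  obtain ⟨D, hD⟩ := (eliminate q A').support_nonempty
  refine CanReach.of_step (D := D) (step_ne_zero_iff.2 ⟨⟨q, A, A'⟩, ?_⟩) (h D hD)
  exact mul_ne_zero (mul_ne_zero (mul_ne_zero hq h1) h2) hD

theorem ne_zero_of_inv_le {p : ℝ≥0∞} (n : ℕ) (h : (n : ℝ≥0∞)⁻¹ ≤ p) : p ≠ 0 :=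
  (lt_of_lt_of_le (ENNReal.inv_pos.2 (ENNReal.natCast_ne_top n)) h).ne'

/-- From an edge coloring, an edge can change its color in the second phase if the first phase does
nothing. -/
theorem CanReach.of_flip_edge (hC : IsEdgeColoring C) (hcd : c ≠ d) {e : G.edgeSet}
    (hec : C e = c ∨ C e = d) (h : CanReachAfter Q c d n (flip c d {e.1} C)) :
    CanReach Q (n + 1) C := by
  wlog hlt : c < d generalizing c d
  · refine this hcd.symm hec.symm ?_ (lt_of_le_of_ne (not_lt.1 hlt) hcd.symm)
    rwa [canReachAfter_comm, flip_comm_colors]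
  refine canReach_of_phases (selectColors_two_ne_zero hlt)
    (ne_zero_of_inv_le 2 (by simpa using inv_two_le_create_self (.two c d) C)) ?_ h
  have := hC.le_perturb_two hec le_rfl
  rw [inv_two_mul_inv] at this
  exact ne_zero_of_inv_le _ this

/-- The deficiencies that an elimination removes can be created again in the next step, and then
moved along an edge. -/
theorem CanReachAfter.of_flip_edge (hs : IsSign G s) (hA : TwoDeficient c d A x y)
    {e : G.edgeSet} (hxe : x ∈ e.1) (hec : A e = c ∨ A e = d)
    (h : CanReachAfter Q c d n (flip c d {e.1} A)) : CanReachAfter Q c d (n + 1) A := by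
  wlog hlt : c < d generalizing c d
  · rw [canReachAfter_comm]
    refine this hA.symm_colors hec.symm ?_ (lt_of_le_of_ne (not_lt.1 hlt) hA.ne.symm)
    rwa [canReachAfter_comm, flip_comm_colors]
  intro D hD
  obtain ⟨S, hS, rfl⟩ := hA.exists_of_eliminateColors hs hD
  refine canReach_of_phases (A := A) (selectColors_two_ne_zero hlt) ?_ ?_ h
  · have hS' : S ∈ connectedPieces (flip c d S A) c d :=
      (isPathSet_flip_iff.2 hS).mem_connectedPieces hA.ne_vertex
    have := le_create_two hS'
    rw [flip_flip, inv_two_mul_inv] at this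
    exact ne_zero_of_inv_le _ this
  · rw [hA.perturb_two]
    exact ne_zero_of_inv_le 4 (by
      simpa using hA.le_pick_pick (Or.inl rfl) hxe hec (fun _ e => flip c d {e.1} A) rfl)

/-- If the deficient vertices are in the same class of the bipartition, an alternating cycle
through one of them, with its repeated color and a third color, can be flipped. -/
theorem CanReachAfter.of_flip_altCycle (hs : IsSign G s) (hA : TwoDeficient c d A x y)
    (hxy : s x = s y) (hfc : f ≠ c) (hfd : f ≠ d) {a : Fin k} (ha : a = c ∨ a = d)
    (hxa : colorDegree A x a = 2)
    (h : CanReachAfter Q c d n (flip a f (altCycle A a f x) A)) :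
    CanReachAfter Q c d (n + 1) A := by
  wlog hlt : c < d generalizing c d
  · rw [canReachAfter_comm]
    refine this hA.symm_colors hfd hfc ha.symm ?_ (lt_of_le_of_ne (not_lt.1 hlt) hA.ne.symm)
    rwa [canReachAfter_comm]
  intro D hD
  obtain ⟨S, hS, rfl⟩ := hA.exists_of_eliminateColors hs hD
  refine canReach_of_phases (A := A) (selectColors_three_ne_zero hlt hfc hfd) ?_ ?_ h
  · have hS' : S ∈ evenPaths (flip c d S A) c d :=
      (mem_evenPaths_iff hs).2 ⟨x, y, hA.ne_vertex, hxy, isPathSet_flip_iff.2 hS⟩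
    have := le_create_three (f := f) hS' le_rfl
    rw [flip_flip, inv_two_mul_inv] at this
    exact ne_zero_of_inv_le _ this
  · exact ne_zero_of_inv_le 2 (by simpa using hA.le_perturb_three (Or.inl rfl) ha hxa)

/-- The number of edges that have color `c` in `T`, but not in `A`. -/
noncomputable def missing (T : Labeling G k) (c : Fin k) (A : Labeling G k) : ℕ :=
  {e | T e = c ∧ A e ≠ c}.ncard

theorem missing_flip_le {e : G.edgeSet} (he : T e ≠ c) :
    missing T c (flip c d {e.1} A) ≤ missing T c A := by
  refine Set.ncard_le_ncard ?_ (Set.toFinite _)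
  rintro g ⟨h1, h2⟩
  refine ⟨h1, ?_⟩
  rwa [flip_apply_notMem] at h2
  intro h
  rw [Set.mem_singleton_iff] at h
  exact he (Subtype.ext h ▸ h1)

theorem missing_flip_lt {e : G.edgeSet} (he : T e = c) (hne : A e ≠ c) (hed : A e = d) :
    missing T c (flip c d {e.1} A) < missing T c A := by
  have hec : flip c d {e.1} A e = c := by
    rw [flip_apply_mem (Set.mem_singleton e.1), hed, Equiv.swap_apply_right]
  refine Set.ncard_lt_ncard ⟨?_, ?_⟩ (Set.toFinite _)
  · rintro g ⟨h1, h2⟩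
    refine ⟨h1, ?_⟩
    rwa [flip_apply_notMem] at h2
    intro h
    rw [Set.mem_singleton_iff] at h
    exact h2 (Subtype.ext h ▸ hec)
  · intro hsub
    exact (hsub (show e ∈ {e | T e = c ∧ A e ≠ c} from ⟨he, hne⟩)).2 hec

/-- The state between two corrections: the color `c` is repeated at `x` and missing at `z`, the
color `d` is repeated at `z` and missing at `x`, and `A` is correct for the colors in `F`. -/
structure Pending (s : V → ℤ) (T : Labeling G k) (F : Finset (Fin k)) (c d : Fin k)
    (A : Labeling G k) (x z : V) : Prop where
  two : TwoDeficient c d A x z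
  sign : s x = s z
  degree : colorDegree A x c = 2
  agree : AgreeOn T F A
  notMem : d ∉ F

/-- The edge `f` at `w` has just received its correct color `c`. Now the other edge of color `c`
at `w` is recolored. -/
theorem canReachAfter_of_corrected (hs : IsSign G s) (hT : IsEdgeColoring T)
    {F : Finset (Fin k)} (hcF : c ∉ F) (hdF : d ∉ F)
    (hcol : ∀ C, IsEdgeColoring C → AgreeOn T F C → missing T c C ≤ m → CanReach Q (3 * m) C)
    (hpend : ∀ d A x z, Pending s T F c d A x z → missing T c A ≤ m →
      CanReachAfter Q c d (3 * m) A)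
    (hA : TwoDeficient c d A w x) {f : G.edgeSet} (hwf : w ∈ f.1) (hf : A f = c) (hTf : T f = c)
    (hx : colorDegree A x c = 2) (hsw : s w + s x = 0) (hag : AgreeOn T F A)
    (hm : missing T c A ≤ m) : CanReachAfter Q c d (3 * m + 1) A := by
  obtain ⟨g, hp⟩ := hA.exists_isPair_left hwf (Or.inl hf)
  have hwdef : IsDeficient A w := (hA.deficient_iff w).2 (Or.inl rfl)
  have hgc : A g = c := by
    rw [← (hA.isDeficient_iff_of_isPair hp).1 hwdef, hf]
  have hTg : T g ≠ c := fun h => hp.1 (by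
    by_contra hne
    exact hT f g trivial trivial hne ⟨w, hwf, hp.right.1⟩ (hTf.trans h.symm))
  obtain ⟨w', hw'⟩ := hp.right.1
  have hag' := hag.flip hcF hdF {g.1}
  have hm' : missing T c (flip c d {g.1} A) ≤ m := (missing_flip_le hTg).trans hm
  refine CanReachAfter.of_flip_edge hs hA hp.right.1 hp.right.2 ?_
  rcases hA.flip_singleton hw' hp.right.2 with ⟨-, hA'⟩ | ⟨hne, hA'⟩
  · exact (hcol _ hA' hag' hm').canReachAfter hA'
  · have hadj : G.Adj w w' := by
      have := g.2
      rwa [hw'] at this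
    have hsw' := hs.adj w w' hadj
    refine hpend d _ x w' ⟨hA'.symm_vertex, by linarith, ?_, hag', hdF⟩ hm'
    rw [colorDegree_flip_singleton_of_notMem, hx]
    rw [hw', Sym2.mem_iff]
    rintro (h | h)
    exacts [hA.ne_vertex h.symm, hne h.symm]

/-- An edge coloring that agrees with the target on `F` can be corrected for a further color `c`
in three steps per missing edge; so can a pending labeling. -/
theorem canReach_of_missing_le (hreg : ∀ v, {e : G.edgeSet | v ∈ e.1}.ncard = k)
    (hs : IsSign G s) (hT : IsEdgeColoring T) {F : Finset (Fin k)} (hcF : c ∉ F)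
    (hQ : ∀ C, IsEdgeColoring C → AgreeOn T F C → missing T c C = 0 → Q C) (m : ℕ) :
    (∀ C, IsEdgeColoring C → AgreeOn T F C → missing T c C ≤ m → CanReach Q (3 * m) C) ∧
    (∀ d A x z, Pending s T F c d A x z → missing T c A ≤ m →
      CanReachAfter Q c d (3 * m) A) := by
  -- at the second vertex of a pending labeling, the target edge of color `c` is missing
  have hedge : ∀ {d A x z}, Pending s T F c d A x z → ∃ f : G.edgeSet, z ∈ f.1 ∧ T f = c ∧
      A f ≠ c := by
    intro d A x z h
    obtain ⟨f, ⟨hzf, hTf⟩, -⟩ := colorDegree_eq_one_iff.1 (hT.colorDegree_eq_one hreg z c)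
    exact ⟨f, hzf, hTf, colorDegree_eq_zero_iff.1
      (h.two.colorDegree_eq_zero hs h.sign h.degree) f hzf⟩
  have hself : ∀ C, Q C → CanReach Q 0 C := by
    intro C hC
    exact ⟨0, le_rfl, C, hC, by simp [iterate]⟩
  induction m with
  | zero =>
    refine ⟨fun C hC hag hm => hself C (hQ C hC hag (by omega)), fun d A x z h hm => ?_⟩
    obtain ⟨f, -, hTf, hf⟩ := hedge h
    have h0 : missing T c A = 0 := by omega
    rw [missing, Set.ncard_eq_zero] at h0
    exact absurd (show f ∈ {e | T e = c ∧ A e ≠ c} from ⟨hTf, hf⟩) (by simp [h0])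
  | succ m ih =>
    obtain ⟨ih1, ih2⟩ := ih
    constructor
    · intro C hC hag hm
      by_cases h0 : missing T c C = 0
      · exact (hself C (hQ C hC hag h0)).mono (by omega)
      obtain ⟨e, hTe, hec⟩ : {e | T e = c ∧ C e ≠ c}.Nonempty := by
        rw [Set.nonempty_iff_ne_empty]
        intro h
        exact h0 (by rw [missing, h, Set.ncard_empty])
      have hb : Balanced c (C e) C := hC.balanced hreg (Ne.symm hec)
      have hdF : C e ∉ F := fun h => hcF (by rw [← hTe, (hag _ h e).1 rfl]; exact h)
      obtain ⟨u, w, huw⟩ := exists_eq_mk e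
      have hA := hC.twoDeficient_flip_singleton hb huw (Or.inr rfl)
      have hlt := missing_flip_lt (d := C e) hTe hec rfl
      have heA : flip c (C e) {e.1} C e = c := by
        rw [flip_apply_mem (Set.mem_singleton e.1), Equiv.swap_apply_right]
      have hadj : G.Adj u w := by
        have := e.2
        rwa [huw] at this
      have hsw := hs.adj u w hadj
      refine (CanReach.of_flip_edge (n := 3 * m + 1) hC hb.ne (Or.inr rfl) ?_).mono (by omega)
      refine canReachAfter_of_corrected hs hT hcF hdF ih1 ih2 hA.symm_vertex (f := e)
        (by simp [huw]) heA hTe ?_ (by linarith) (hag.flip hcF hdF _) (by omega)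
      -- the recolored edge has color `c`, so `c` is the repeated color at its end
      have h1 := hA.isDeficient_iff.1 ((hA.deficient_iff u).2 (Or.inl rfl))
      have h2 := hA.pair u
      have h3 : colorDegree (flip c (C e) {e.1} C) u c ≠ 0 := fun h =>
        colorDegree_eq_zero_iff.1 h e (by simp [huw]) heA
      omega
    · -- the case in which the target edge has color `d`
      have hmain : ∀ d A x z, Pending s T F c d A x z → missing T c A ≤ m + 1 →
          ∀ f : G.edgeSet, z ∈ f.1 → T f = c → A f = d → CanReachAfter Q c d (3 * m + 2) A := by
        rintro d A x z h hm f ⟨w, hzw⟩ hTf hfd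
        have hzf : z ∈ f.1 := by simp [hzw]
        have hfc : A f ≠ c := hfd ▸ h.two.ne.symm
        have hwx : w ≠ x := by
          rintro rfl
          have h1 := h.two.pair w
          rw [h.degree] at h1
          have h2 : colorDegree A w d = 0 := by omega
          exact colorDegree_eq_zero_iff.1 h2 f (by simp [hzw]) hfd
        have hadj : G.Adj z w := by
          have := f.2
          rwa [hzw] at this
        have hsw := hs.adj z w hadj
        have hA := h.two.symm_vertex
        have hlt := missing_flip_lt (d := d) hTf hfc hfd
        refine CanReachAfter.of_flip_edge hs hA hzf (Or.inr hfd) ?_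
        rcases hA.flip_singleton hzw (Or.inr hfd) with ⟨h', -⟩ | ⟨-, hA'⟩
        · exact absurd h' hwx
        refine canReachAfter_of_corrected hs hT hcF h.notMem ih1 ih2 hA' (f := f)
          (by simp [hzw]) ?_ hTf ?_ ?_ (h.agree.flip hcF h.notMem _) (by omega)
        · rw [flip_apply_mem (Set.mem_singleton f.1), hfd, Equiv.swap_apply_right]
        · rw [colorDegree_flip_singleton_of_notMem, h.degree]
          rw [hzw, Sym2.mem_iff]
          rintro (h' | h')
          exacts [h.two.ne_vertex h', hwx h'.symm]
        · rw [h.sign]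
          linarith
      intro d A x z h hm
      obtain ⟨f, hzf, hTf, hfc⟩ := hedge h
      by_cases hfd : A f = d
      · exact (hmain d A x z h hm f hzf hTf hfd).mono (by omega)
      -- otherwise the flip of an alternating cycle gives it this color
      have hfF : A f ∉ F := fun h' => hcF (by rw [← hTf, (h.agree _ h' f).1 rfl]; exact h')
      have hA := h.two.symm_vertex
      have hz0 := h.two.colorDegree_eq_zero hs h.sign h.degree
      have hzd : colorDegree A z d = 2 := by
        have := h.two.pair z
        omega
      have hcyc := hA.cycleBase hs h.sign.symm hfc hfd (Or.inr rfl) hzd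
      have hcd := h.two.ne
      have hc_iff : ∀ e, flip d (A f) (altCycle A d (A f) z) A e = c ↔ A e = c := fun e =>
        flip_eq_iff_of_ne hcd (Ne.symm hfc)
      refine CanReachAfter.of_flip_altCycle (n := 3 * m + 2) hs hA h.sign.symm hfc hfd
        (Or.inr rfl) hzd ?_
      refine hmain d _ x z ⟨h.two.of_colorDegree_eq (hcyc.colorDegree_flip hs), h.sign, ?_,
        h.agree.flip h.notMem hfF _, h.notMem⟩ ?_ f hzf hTf ?_
      · rw [hcyc.colorDegree_flip hs, h.degree]
      · simpa only [missing, Ne, hc_iff] using hm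
      · obtain ⟨-, g, -, hzg, -, hg, -, hgf⟩ := (hcyc.isAltCycle_altCycle hs).exists_pair
        have hgf' : g = f := colorDegree_le_one_iff.1 (hcyc.right z).le g f hzg hzf hgf rfl
        rw [hgf'] at hg
        rw [flip_apply_mem hg, Equiv.swap_apply_right]

/-- If no edge of color `c` is missing, then the edges of color `c` are those of the target. -/
theorem eq_iff_of_missing_eq_zero (hreg : ∀ v, {e : G.edgeSet | v ∈ e.1}.ncard = k)
    (hT : IsEdgeColoring T) (hC : IsEdgeColoring C) (h0 : missing T c C = 0) (e : G.edgeSet) :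
    C e = c ↔ T e = c := by
  rw [missing, Set.ncard_eq_zero] at h0
  have hsub : ∀ g, T g = c → C g = c := by
    intro g hg
    by_contra hne
    exact absurd (show g ∈ {e | T e = c ∧ C e ≠ c} from ⟨hg, hne⟩) (by simp [h0])
  refine ⟨fun h => ?_, hsub e⟩
  obtain ⟨u, w, huw⟩ := exists_eq_mk e
  have hu : u ∈ e.1 := by simp [huw]
  obtain ⟨g, ⟨hug, hg⟩, -⟩ := colorDegree_eq_one_iff.1 (hT.colorDegree_eq_one hreg u c)
  rwa [colorDegree_le_one_iff.1 (hC.colorDegree_eq_one hreg u c).le e g hu hug h (hsub g hg)]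

/-- The colors of the target are put in place one after the other. The edges of different colors are
disjoint, so the numbers of steps add up. -/
theorem canReach_agreeOn (hreg : ∀ v, {e : G.edgeSet | v ∈ e.1}.ncard = k)
    (hs : IsSign G s) (hT : IsEdgeColoring T) (hC : IsEdgeColoring C) (F : Finset (Fin k)) :
    CanReach (fun D => IsEdgeColoring D ∧ AgreeOn T F D) (3 * {e | T e ∈ F}.ncard) C := by
  classical
  induction F using Finset.induction_on with
  | empty => exact ⟨0, Nat.zero_le _, C, ⟨hC, by simp [AgreeOn]⟩, by simp [iterate]⟩
  | insert c F hcF ih =>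
    obtain ⟨i, hi, D, ⟨hD, hag⟩, hCD⟩ := ih
    have hle : missing T c D ≤ {e | T e = c}.ncard :=
      Set.ncard_le_ncard (fun e he => he.1) (Set.toFinite _)
    obtain ⟨j, hj, E, hE, hDE⟩ := (canReach_of_missing_le (c := c) hreg hs hT hcF
      (Q := fun D => IsEdgeColoring D ∧ AgreeOn T (insert c F) D) (fun E hE hagE h0 =>
        ⟨hE, fun t ht e => by
          rcases Finset.mem_insert.1 ht with rfl | ht
          · exact eq_iff_of_missing_eq_zero hreg hT hE h0 e
          · exact hagE t ht e⟩) _).1 D hD hag hle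
    refine ⟨i + j, ?_, E, hE, mem_support_iterate_add hCD hDE⟩
    have hcard : {e | T e ∈ insert c F}.ncard = {e | T e = c}.ncard + {e | T e ∈ F}.ncard := by
      rw [← Set.ncard_union_eq]
      · congr 1
        ext e
        simp
      · rw [Set.disjoint_left]
        intro e h1 h2
        rw [Set.mem_ofPred_eq] at h1 h2
        exact hcF (h1 ▸ h2)
    rw [hcard]
    omega

theorem chainDist_step_le (hreg : ∀ v, {e : G.edgeSet | v ∈ e.1}.ncard = k)
    (hs : IsSign G s) (hC : IsEdgeColoring C) (hT : IsEdgeColoring T) :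
    chainDist step C T ≤ ((3 * Nat.card G.edgeSet : ℕ) : ℕ∞) := by
  obtain ⟨j, hj, D, ⟨-, hD⟩, hCD⟩ := canReach_agreeOn hreg hs hT hC Finset.univ
  have : D = T := funext fun e => (hD (T e) (Finset.mem_univ _) e).2 rfl
  subst this
  refine (chainDist_le hCD).trans ?_
  have h1 : {e : G.edgeSet | D e ∈ Finset.univ}.ncard ≤ Nat.card G.edgeSet := Set.ncard_le_card _
  exact_mod_cast hj.trans (Nat.mul_le_mul_left 3 h1)

end Diameter

theorem ncard_incident_edges {V : Type*} [Fintype V] {G : SimpleGraph V} [DecidableRel G.Adj]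
    {k : ℕ} (hreg : G.IsRegularOfDegree k) (v : V) : {e : G.edgeSet | v ∈ e.1}.ncard = k := by
  classical
  rw [← hreg v, ← G.card_incidenceFinset_eq_degree, ← Set.ncard_coe_finset,
    G.coe_incidenceFinset, ← Set.ncard_image_of_injective _ Subtype.val_injective]
  congr 1
  ext e
  simp [SimpleGraph.incidenceSet, and_comm]

end LatinChain

theorem mainTheorem3 {V : Type*} [Fintype V] [DecidableEq V] (G : SimpleGraph V)
    [DecidableRel G.Adj] (k : ℕ) (hV : 2 ≤ Fintype.card V) (hbip : G.IsBipartite)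
    (hreg : G.IsRegularOfDegree k) :
    -- a step leads from edge colorings to edge colorings
    (∀ C : LatinChain.Labeling G k, LatinChain.IsEdgeColoring C →
      ∀ D ∈ (LatinChain.step C).support, LatinChain.IsEdgeColoring D) ∧
    -- the diameter
    LatinChain.chainDiameter (LatinChain.step (G := G) (k := k))
      {C | LatinChain.IsEdgeColoring C} ≤ ((3 * G.edgeFinset.card : ℕ) : ℕ∞) ∧
    -- the acceptance ratio for proposals by the transition probabilities
    (∀ C D : LatinChain.Labeling G k, LatinChain.IsEdgeColoring C → LatinChain.IsEdgeColoring D →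
      LatinChain.step C D ≠ 0 →
        (LatinChain.acceptance LatinChain.step (fun _ => 1) C D)⁻¹ ≤
          ((16 * Fintype.card V * (Fintype.card V - 1) : ℕ) : ℝ≥0∞)) ∧
    -- the acceptance ratio for proposals by single ways
    (∀ C D : LatinChain.Labeling G k, LatinChain.IsEdgeColoring C → LatinChain.IsEdgeColoring D →
      ∀ w : LatinChain.Way G k, LatinChain.wayProb C w D ≠ 0 →
        LatinChain.wayProb D (LatinChain.inverseWay C w D) C ≠ 0 ∧
        LatinChain.inverseWay D (LatinChain.inverseWay C w D) C = w ∧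
        (LatinChain.wayAcceptance (fun _ => 1) C w D)⁻¹ ≤
          ((16 * Fintype.card V * (Fintype.card V - 1) : ℕ) : ℝ≥0∞)) := by
  obtain ⟨s, hs⟩ := LatinChain.exists_isSign hbip
  have hreg' := LatinChain.ncard_incident_edges hreg
  have hne : Nonempty V := Fintype.card_pos_iff.1 (by omega)
  have hB : 1 ≤ 16 * Fintype.card V * (Fintype.card V - 1) :=
    Nat.mul_pos (by omega) (by omega)
  have hbound : ∀ C D : LatinChain.Labeling G k, LatinChain.IsEdgeColoring C →
      ∀ w : LatinChain.Way G k, LatinChain.wayProb C w D ≠ 0 →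
        LatinChain.WayBound (16 * Fintype.card V * (Fintype.card V - 1)) C w D := by
    intro C D hC w hw
    exact LatinChain.wayBound_of_ne_zero hreg' hV hs hC hw
  refine ⟨fun C hC D hD => LatinChain.isEdgeColoring_of_step hreg' hs hC hD, ?_, ?_, ?_⟩
  · have hcard : G.edgeFinset.card = Nat.card G.edgeSet := by
      rw [Nat.card_eq_fintype_card, SimpleGraph.edgeFinset_card]
    rw [hcard]
    exact iSup₂_le fun C hC => iSup₂_le fun D hD =>
      LatinChain.chainDist_step_le hreg' hs hC hD
  · intro C D hC _ hCD
    exact LatinChain.inv_min_one_div_le hB hCD (PMF.apply_ne_top _ _)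
      (LatinChain.step_le_mul_of_wayBound (hbound C D hC))
  · intro C D hC _ w hw
    obtain ⟨hinv, hle⟩ := hbound C D hC w hw
    refine ⟨fun h0 => hw ?_, hinv,
      LatinChain.inv_min_one_div_le hB hw (LatinChain.wayProb_ne_top C w D) hle⟩
    rwa [h0, mul_zero, nonpos_iff_eq_zero] at hle
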